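/- Let $V:\mathbb{R}^3\to\mathbb{R}$ be an integrable radial function with $V\ge 0$ and $V\not\equiv 0$ (that is, $V$ does not vanish almost everywhere), and let $\widehat V(p)=\int_{\mathbb{R}^3}e^{-ip\cdot x}V(x)\,dx$, which is real-valued and radial. Assume that $\widehat V\ge 0$, $\widehat V\in C^1(\mathbb{R}^3)\cap L^1(\mathbb{R}^3)$, $\|\widehat V\|_\infty<\infty$, $\|\nabla\widehat V\|_2<\infty$ and $\|\nabla\widehat V\|_\infty<\infty$. Assume in addition that $\widehat V\in C^3(\mathbb{R}^3)$ and that all derivatives of $\widehat V$ up to third order are bounded. For real measurable functions $\gamma,\alpha$ on $\mathbb{R}^3$ and $\rho_0\in\mathbb{R}$ put $\rho=\rho_0+(2\pi)^{-3}\int_{\mathbb{R}^3}\gamma(p)\,dp$, let $$\mathcal D=\{(\gamma,\alpha,\rho_0)\;:\;\gamma\in L^1((1+p^2)dp),\ \gamma\ge 0,\ \alpha^2\le\gamma(1+\gamma)\ \text{a.e.},\ \rho_0\ge 0\},$$ and for $T\ge 0$, $\mu\in\mathbb{R}$ define on $\mathcal D$ the grand canonical Bogoliubov free energy functional $$\begin{aligned}\mathcal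 F(\gamma,\alpha,\rho_0)={}&(2\pi)^{-3}\int_{\mathbb{R}^3}p^2\gamma(p)\,dp-\mu\rho-TS(\gamma,\alpha)+\frac{\widehat V(0)}{2}\rho^2\\&+\frac12(2\pi)^{-6}\iint_{\mathbb{R}^3\times\mathbb{R}^3}\widehat V(p-q)\bigl(\alpha(p)\alpha(q)+\gamma(p)\gamma(q)\bigr)\,dp\,dq\\&+\rho_0(2\pi)^{-3}\int_{\mathbb{R}^3}\widehat V(p)\bigl(\gamma(p)+\alpha(p)\bigr)\,dp,\end{aligned}$$ where $S(\gamma,\alpha)=(2\pi)^{-3}\int_{\mathbb{R}^3}\bigl[(\beta+\tfrac12)\ln(\beta+\tfrac12)-(\beta-\tfrac12)\ln(\beta-\tfrac12)\bigr]dp$, with $\beta(p)=\sqrt{(\tfrac12+\gamma(p))^2-\alpha(p)^2}$ and $0\ln 0=0$. Then for $T=0$ and every $\mu\in\mathbb{R}$ the functional $\mathcal F$ has a minimizer on $\mathcal D$: there is $(\gamma,\alpha,\rho_0)\in\mathcal D$ with $\mathcal F(\gamma,\alpha,\rho_0)\le\mathcal F(\gamma',\alpha',\rho_0')$ for all $(\gamma',\alpha',\rho_0')\in\mathcal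 D$. -/

import Mathlib

noncomputable section

namespace Bogoliubov

open MeasureTheory

/-- Position or momentum space `ℝ³` with its Euclidean norm. -/
abbrev Space : Type := EuclideanSpace ℝ (Fin 3)

/-- `∫ e^{-i p·x} V(x) dx`, as a complex number. -/
def fourierC (V : Space → ℝ) (p : Space) : ℂ :=
  ∫ x : Space, Complex.exp (-Complex.I * ((inner ℝ p x : ℝ) : ℂ)) * ((V x : ℝ) : ℂ)

/-- The Fourier transform `V̂` as a real function. For a radial `V` (indeed for every even one)
`fourierC V` is real, see `ofReal_Vhat`, so that nothing is lost in taking the real part. -/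
def Vhat (V : Space → ℝ) (p : Space) : ℝ := (fourierC V p).re

/-- `f` depends on `|x|` only. -/
def IsRadial (f : Space → ℝ) : Prop := ∀ x y : Space, ‖x‖ = ‖y‖ → f x = f y

theorem ofReal_Vhat {V : Space → ℝ} (hV : IsRadial V) (p : Space) :
    ((Vhat V p : ℝ) : ℂ) = fourierC V p := by
  have h : (starRingEnd ℂ) (fourierC V p) = fourierC V p := by
    unfold fourierC
    rw [← integral_conj, ← integral_neg_eq_self]
    refine integral_congr_ae (Filter.Eventually.of_forall fun x => ?_)
    have hx : V (-x) = V x := hV _ _ (norm_neg x)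
    simp [← Complex.exp_conj, hx]
  exact Complex.conj_eq_iff_re.mp h

/-- The standing assumptions on the two-body potential `V` and its Fourier transform.
Integrability of `V` is what makes the integral defining `V̂` meaningful; `V ≢ 0` is meant
as a statement about functions modulo null sets. `V̂` is radial because `V` is. -/
structure IsInteraction (V : Space → ℝ) : Prop where
  integrable : Integrable V
  radial : IsRadial V
  nonneg : ∀ x, 0 ≤ V x
  ne_zero : ¬ (V =ᵐ[volume] 0)
  hat_nonneg : ∀ p, 0 ≤ Vhat V p
  hat_contDiff : ContDiff ℝ 1 (Vhat V)
  hat_integrable : Integrable (Vhat V)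
  hat_bounded : ∃ C : ℝ, ∀ p, |Vhat V p| ≤ C
  grad_memLp : MemLp (gradient (Vhat V)) 2
  grad_bounded : ∃ C : ℝ, ∀ p, ‖gradient (Vhat V) p‖ ≤ C

/-- A triple `(γ, α, ρ₀)`. -/
abbrev Triple : Type := (Space → ℝ) × (Space → ℝ) × ℝ

/-- The domain `𝒟`: `γ ∈ L¹((1+p²)dp)`, `γ ≥ 0`, `α² ≤ γ(1+γ)`, `ρ₀ ≥ 0`. The functions are
representatives of classes modulo null sets, and the pointwise constraints hold a.e. -/
def domain : Set Triple :=
  {x | match x with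
    | (γ, α, ρ₀) =>
      Integrable (fun p : Space => (1 + ‖p‖ ^ 2) * γ p) ∧
      AEStronglyMeasurable α volume ∧
      (∀ᵐ p : Space, 0 ≤ γ p) ∧
      (∀ᵐ p : Space, α p ^ 2 ≤ γ p * (1 + γ p)) ∧
      0 ≤ ρ₀}

/-- `(2π)⁻³`. -/
def c₃ : ℝ := ((2 * Real.pi) ^ 3)⁻¹

/-- `β = √((1/2 + γ)² - α²)`, for values `g` of `γ` and `a` of `α`. -/
def beta (g a : ℝ) : ℝ := Real.sqrt ((1 / 2 + g) ^ 2 - a ^ 2)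

/-- The entropy density `s(β)`, with the convention `0 ln 0 = 0`. -/
def entropyDensity (b : ℝ) : ℝ :=
  (b + 1 / 2) * Real.log (b + 1 / 2) - (b - 1 / 2) * Real.log (b - 1 / 2)

/-- The entropy `S(γ, α)`. -/
def entropy (γ α : Space → ℝ) : ℝ :=
  c₃ * ∫ p : Space, entropyDensity (beta (γ p) (α p))

/-- The total density `ρ = ρ₀ + (2π)⁻³ ∫ γ`. -/
def density (γ : Space → ℝ) (ρ₀ : ℝ) : ℝ := ρ₀ + c₃ * ∫ p : Space, γ p

/-- The Bogoliubov free energy functional at temperature `T` and chemical potential `μ`. -/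
def freeEnergy (V : Space → ℝ) (T μ : ℝ) : Triple → ℝ
  | (γ, α, ρ₀) =>
    c₃ * (∫ p : Space, ‖p‖ ^ 2 * γ p)
      - μ * density γ ρ₀
      - T * entropy γ α
      + Vhat V 0 / 2 * density γ ρ₀ ^ 2
      + 1 / 2 * c₃ ^ 2 *
          (∫ z : Space × Space, Vhat V (z.1 - z.2) * (α z.1 * α z.2 + γ z.1 * γ z.2))
      + ρ₀ * (c₃ * ∫ p : Space, Vhat V p * (γ p + α p))

end Bogoliubov

end

/-!
At `T = 0` the energy is regularized by adding `ε (‖γ‖₂² + ‖α‖₂²)` and by restricting momenta to a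
ball of radius `R`. At a condensate density `t` optimal for the infimum the regularized energy is
strictly convex, so it has a unique, hence radial, minimizer, which satisfies pointwise
Euler–Lagrange conditions. Uniform bounds on densities, tails and gradients follow from these. Along
`R → ∞`, `ε → 0` the gradients `∂E/∂γ` and `∂E/∂α` converge locally uniformly by Arzelà–Ascoli, to
`A` and `B`, say.

Where `|B| < A`, the pair `(γ, α)` converges to the explicit pointwise minimizer of `A γ + B α`.
Equality `|B| = A` at a point `p₀ ≠ 0` is impossible: by radiality and the bound on second
differences, `A - |B|` would vanish to second order on the sphere `|p| = |p₀|`, which makes the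
limit of `γ` non-integrable. Particles can therefore be lost only at `p = 0`, and they are put
into the condensate, with the sign of `α` chosen so that this does not raise the energy.
-/

noncomputable section

namespace Bogoliubov

open MeasureTheory Filter Topology

/-! ### Admissible kernels -/

/-- An admissible interaction kernel: the properties of `v = V̂` on which the existence of a
minimizer rests. One constant `M` bounds `v`, its Lipschitz constant and its symmetric second
differences; it is part of the notion so that all the estimates below are explicit. -/
structure IsKernel (v : Space → ℝ) (M : ℝ) : Prop where
  continuous : Continuous v
  nonneg : ∀ p, 0 ≤ v p
  le : ∀ p, v p ≤ M
  integrable : Integrable v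
  radial : IsRadial v
  lipschitz : ∀ p q, |v p - v q| ≤ M * ‖p - q‖
  second_diff : ∀ p h, |v (p + h) + v (p - h) - 2 * v p| ≤ M * ‖h‖ ^ 2
  posSemidef : ∀ f : Space → ℝ, Integrable f →
    0 ≤ ∫ z : Space × Space, v (z.1 - z.2) * (f z.1 * f z.2)
  pos : 0 < v 0

section FourierTransform

theorem Vhat_eq_integral_cos {V : Space → ℝ} (hV : Integrable V) (p : Space) :
    Vhat V p = ∫ x, Real.cos (inner ℝ p x) * V x := by
  have hint : Integrable fun x : Space =>
      Complex.exp (-Complex.I * ((inner ℝ p x : ℝ) : ℂ)) * ((V x : ℝ) : ℂ) := by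
    refine hV.ofReal.bdd_mul (c := 1) ?_ (ae_of_all _ fun x => ?_)
    · exact Continuous.aestronglyMeasurable (by fun_prop)
    · rw [Complex.norm_exp]; simp
  have hre := integral_re hint
  simp only [RCLike.re_to_complex] at hre
  rw [Vhat, fourierC, ← hre]
  refine integral_congr_ae (ae_of_all _ fun x => ?_)
  simp [Complex.exp_re]

theorem Vhat_zero_pos {V : Space → ℝ} (hV : Integrable V) (h0 : ∀ x, 0 ≤ V x)
    (hne : ¬ V =ᵐ[volume] 0) : 0 < Vhat V 0 := by
  have hzero : Vhat V 0 = ∫ x, V x := by simp [Vhat_eq_integral_cos hV]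
  rw [hzero]
  refine (integral_nonneg h0).lt_of_ne fun h => hne ?_
  exact (integral_eq_zero_iff_of_nonneg h0 hV).mp h.symm

theorem IsRadial.Vhat {V : Space → ℝ} (hr : IsRadial V) (hV : Integrable V) :
    IsRadial (Vhat V) := by
  intro x y hxy
  set R := Submodule.reflection (Submodule.span ℝ {x - y})ᗮ
  have hRx : R x = y := Submodule.reflection_sub hxy
  rw [Vhat_eq_integral_cos hV, Vhat_eq_integral_cos hV, ← hRx,
    ← R.measurePreserving.integral_comp R.toHomeomorph.measurableEmbedding
      (fun z => Real.cos (inner ℝ (R x) z) * V z)]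
  refine integral_congr_ae (ae_of_all _ fun z => ?_)
  simp only [LinearIsometryEquiv.inner_map_map]
  rw [hr (R z) z (R.norm_map z)]

theorem integral_cos_inner_sub_mul_mul {E : Type*} [NormedAddCommGroup E] [InnerProductSpace ℝ E]
    [MeasurableSpace E] [BorelSpace E] {ν : Measure E} [SFinite ν] {f : E → ℝ}
    (hf : Integrable f ν) (x : E) :
    ∫ z : E × E, Real.cos (inner ℝ (z.1 - z.2) x) * (f z.1 * f z.2) ∂ν.prod ν
      = (∫ p, Real.cos (inner ℝ p x) * f p ∂ν) ^ 2
        + (∫ p, Real.sin (inner ℝ p x) * f p ∂ν) ^ 2 := by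
  have hcos : Integrable (fun p => Real.cos (inner ℝ p x) * f p) ν :=
    hf.bdd_mul (c := 1) (Continuous.aestronglyMeasurable (by fun_prop))
      (ae_of_all _ fun p => Real.abs_cos_le_one _)
  have hsin : Integrable (fun p => Real.sin (inner ℝ p x) * f p) ν :=
    hf.bdd_mul (c := 1) (Continuous.aestronglyMeasurable (by fun_prop))
      (ae_of_all _ fun p => Real.abs_sin_le_one _)
  rw [sq, sq, ← integral_prod_mul, ← integral_prod_mul,
    ← integral_add (hcos.mul_prod hcos) (hsin.mul_prod hsin)]
  refine integral_congr_ae (ae_of_all _ fun z => ?_)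
  simp only [inner_sub_left, Real.cos_sub]
  ring

theorem Vhat_posSemidef {V : Space → ℝ} (hV : Integrable V) (h0 : ∀ x, 0 ≤ V x)
    {f : Space → ℝ} (hf : Integrable f) :
    0 ≤ ∫ z : Space × Space, Vhat V (z.1 - z.2) * (f z.1 * f z.2) := by
  have hint : Integrable (fun w : (Space × Space) × Space =>
      Real.cos (inner ℝ (w.1.1 - w.1.2) w.2) * ((f w.1.1 * f w.1.2) * V w.2))
      ((volume.prod volume).prod volume) :=
    ((hf.mul_prod hf).mul_prod hV).bdd_mul (c := 1) (Continuous.aestronglyMeasurable (by fun_prop))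
      (ae_of_all _ fun p => Real.abs_cos_le_one _)
  calc 0 ≤ ∫ x, V x * ((∫ p, Real.cos (inner ℝ p x) * f p) ^ 2
          + (∫ p, Real.sin (inner ℝ p x) * f p) ^ 2) :=
        integral_nonneg fun x => mul_nonneg (h0 x) (by positivity)
    _ = ∫ x, ∫ z : Space × Space,
          Real.cos (inner ℝ (z.1 - z.2) x) * ((f z.1 * f z.2) * V x) := by
        refine integral_congr_ae (ae_of_all _ fun x => ?_)
        simp only [← integral_cos_inner_sub_mul_mul hf, ← integral_const_mul]
        exact integral_congr_ae (ae_of_all _ fun z => by ring)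
    _ = ∫ z : Space × Space, ∫ x,
          Real.cos (inner ℝ (z.1 - z.2) x) * ((f z.1 * f z.2) * V x) :=
        (integral_integral_swap hint).symm
    _ = ∫ z : Space × Space, Vhat V (z.1 - z.2) * (f z.1 * f z.2) := by
        refine integral_congr_ae (ae_of_all _ fun z => ?_)
        simp only [Vhat_eq_integral_cos hV, ← integral_mul_const]
        exact integral_congr_ae (ae_of_all _ fun x => by ring)

end FourierTransform

theorem abs_second_diff_le_of_norm_iteratedFDeriv_le {E : Type*} [NormedAddCommGroup E]
    [NormedSpace ℝ E] {v : E → ℝ} {C : ℝ} (h2 : ContDiff ℝ 2 v)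
    (hC : ∀ p, ‖iteratedFDeriv ℝ 2 v p‖ ≤ C) (p h : E) :
    |v (p + h) + v (p - h) - 2 * v p| ≤ C * ‖h‖ ^ 2 := by
  have hd : Differentiable ℝ v := h2.differentiable (by norm_num)
  have hd' : Differentiable ℝ (fderiv ℝ v) :=
    (h2.fderiv_right (m := 1) (by norm_num)).differentiable (by norm_num)
  have hlip : ∀ x y, ‖fderiv ℝ v y - fderiv ℝ v x‖ ≤ C * ‖y - x‖ := fun x y =>
    convex_univ.norm_image_sub_le_of_norm_fderiv_le (fun x _ => hd' x)
      (fun x _ => by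
        have := hC x
        rwa [← norm_iteratedFDeriv_fderiv, norm_iteratedFDeriv_one] at this)
      (Set.mem_univ x) (Set.mem_univ y)
  have hdiff : ∀ q, HasFDerivAt (fun q => v (q + h) - v q)
      (fderiv ℝ v (q + h) - fderiv ℝ v q) q := fun q =>
    (HasFDerivAt.comp q (hd (q + h)).hasFDerivAt ((hasFDerivAt_id q).add_const h)).sub
      (hd q).hasFDerivAt
  have hmean := convex_univ.norm_image_sub_le_of_norm_hasFDerivWithin_le (C := C * ‖h‖)
    (fun q _ => (hdiff q).hasFDerivWithinAt)
    (fun q _ => by simpa using hlip q (q + h)) (Set.mem_univ (p - h)) (Set.mem_univ p)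
  simp only [sub_add_cancel, sub_sub_cancel, Real.norm_eq_abs] at hmean
  calc |v (p + h) + v (p - h) - 2 * v p| = |v (p + h) - v p - (v p - v (p - h))| := by ring_nf
    _ ≤ C * ‖h‖ * ‖h‖ := hmean
    _ = C * ‖h‖ ^ 2 := by ring

theorem IsInteraction.exists_isKernel {V : Space → ℝ} (hV : IsInteraction V)
    (h2 : ContDiff ℝ 2 (Vhat V))
    (hbdd : ∃ C : ℝ, ∀ p, ‖iteratedFDeriv ℝ 2 (Vhat V) p‖ ≤ C) :
    ∃ M, IsKernel (Vhat V) M := by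
  obtain ⟨C₂, hC₂⟩ := hbdd
  obtain ⟨C₁, hC₁⟩ := hV.grad_bounded
  obtain ⟨C₀, hC₀⟩ := hV.hat_bounded
  have hlip : ∀ p q, |Vhat V p - Vhat V q| ≤ C₁ * ‖p - q‖ := fun p q =>
    convex_univ.norm_image_sub_le_of_norm_fderiv_le
      (fun x _ => h2.differentiable (by norm_num) x)
      (fun x _ => by simpa [gradient] using hC₁ x) (Set.mem_univ q) (Set.mem_univ p)
  refine ⟨max C₀ (max C₁ C₂), {
    continuous := h2.continuous
    nonneg := hV.hat_nonneg
    le := fun p => ((le_abs_self _).trans (hC₀ p)).trans (le_max_left _ _)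
    integrable := hV.hat_integrable
    radial := hV.radial.Vhat hV.integrable
    lipschitz := fun p q => (hlip p q).trans ?_
    second_diff := fun p h =>
      (abs_second_diff_le_of_norm_iteratedFDeriv_le h2 hC₂ p h).trans ?_
    posSemidef := fun f hf => Vhat_posSemidef hV.integrable hV.nonneg hf
    pos := Vhat_zero_pos hV.integrable hV.nonneg hV.ne_zero }⟩
  · gcongr
    exact (le_max_left _ _).trans (le_max_right _ _)
  · gcongr
    exact (le_max_right _ _).trans (le_max_right _ _)

/-! ### The energy and its expansion -/

section WeightedIntegrals

variable {X : Type*} [MeasurableSpace X] {ν : Measure X}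

theorem abs_integral_mul_le {w f : X → ℝ} {K : ℝ} (hf : Integrable f ν) (hw : ∀ x, |w x| ≤ K) :
    |∫ x, w x * f x ∂ν| ≤ K * ∫ x, |f x| ∂ν := by
  rw [← integral_const_mul, ← Real.norm_eq_abs]
  refine norm_integral_le_of_norm_le (hf.abs.const_mul K) (ae_of_all _ fun x => ?_)
  rw [Real.norm_eq_abs, abs_mul]
  exact mul_le_mul_of_nonneg_right (hw x) (abs_nonneg _)

theorem integral_mul_add_const_mul {w f g : X → ℝ} (hf : Integrable (fun x => w x * f x) ν)
    (hg : Integrable (fun x => w x * g x) ν) (s : ℝ) :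
    ∫ x, w x * (f x + s * g x) ∂ν = ∫ x, w x * f x ∂ν + s * ∫ x, w x * g x ∂ν := by
  rw [← integral_const_mul, ← integral_add hf (hg.const_mul s)]
  exact integral_congr_ae (ae_of_all _ fun x => by ring)

theorem integral_isRadial_mul_comp {w : Space → ℝ} (hw : IsRadial w) (f : Space → ℝ)
    (R : Space ≃ₗᵢ[ℝ] Space) : ∫ p, w p * f (R p) = ∫ p, w p * f p := by
  rw [← R.measurePreserving.integral_comp R.toHomeomorph.measurableEmbedding
    (fun q => w q * f q)]
  simp only [hw (R _) _ (R.norm_map _)]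

end WeightedIntegrals

/-- The interaction energy `(2π)⁻⁶ ∬ v(p-q) f(p) g(q) dp dq`. -/
def interaction (v f g : Space → ℝ) : ℝ :=
  c₃ ^ 2 * ∫ z : Space × Space, v (z.1 - z.2) * (f z.1 * g z.2)

/-- The potential `(2π)⁻³ v * f` generated by `f`. -/
def potential (v f : Space → ℝ) (p : Space) : ℝ := c₃ * ∫ q, v (p - q) * f q

/-- The coupling `(2π)⁻³ ∫ v f` of `f` to a unit mass at the origin, that is, to the condensate. -/
def coupling (v f : Space → ℝ) : ℝ := c₃ * ∫ p, v p * f p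

/-- The particle density `(2π)⁻³ ∫ f` of a momentum distribution `f`. -/
def mass (f : Space → ℝ) : ℝ := c₃ * ∫ p, f p

/-- The kinetic energy `(2π)⁻³ ∫ p² f(p) dp`. -/
def kinetic (f : Space → ℝ) : ℝ := c₃ * ∫ p : Space, ‖p‖ ^ 2 * f p

/-- The free energy at temperature zero with a general kernel `v` for `V̂`, and `t` for `ρ₀`. The
double integral is split into its `γγ` and `αα` parts, which presupposes that `γ` and `α` are
integrable. -/
def energy (v : Space → ℝ) (μ : ℝ) (γ α : Space → ℝ) (t : ℝ) : ℝ :=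
  kinetic γ - μ * (t + mass γ) + v 0 / 2 * (t + mass γ) ^ 2
    + 1 / 2 * (interaction v α α + interaction v γ γ) + t * (coupling v γ + coupling v α)

theorem c₃_pos : 0 < c₃ := by unfold c₃; positivity

section OneBody

theorem abs_mass_le (f : Space → ℝ) : |mass f| ≤ c₃ * ∫ q, |f q| := by
  rw [mass, abs_mul, abs_of_pos c₃_pos]
  exact mul_le_mul_of_nonneg_left abs_integral_le_integral_abs c₃_pos.le

theorem mass_nonneg {f : Space → ℝ} (hf : ∀ᵐ p, 0 ≤ f p) : 0 ≤ mass f :=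
  mul_nonneg c₃_pos.le (integral_nonneg_of_ae hf)

theorem kinetic_nonneg {f : Space → ℝ} (hf : ∀ᵐ p, 0 ≤ f p) : 0 ≤ kinetic f :=
  mul_nonneg c₃_pos.le (integral_nonneg_of_ae
    (hf.mono fun _ hq => mul_nonneg (sq_nonneg _) hq))

theorem mass_comp_isometry (f : Space → ℝ) (R : Space ≃ₗᵢ[ℝ] Space) :
    mass (f ∘ R) = mass f := by
  simpa [mass] using congrArg (c₃ * ·)
    (integral_isRadial_mul_comp (w := fun _ => 1) (fun _ _ _ => rfl) f R)

theorem kinetic_comp_isometry (f : Space → ℝ) (R : Space ≃ₗᵢ[ℝ] Space) :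
    kinetic (f ∘ R) = kinetic f :=
  congrArg (c₃ * ·) (integral_isRadial_mul_comp (fun _ _ h => by simp only [h]) f R)

theorem mass_add_const_mul {f g : Space → ℝ} (hf : Integrable f) (hg : Integrable g) (s : ℝ) :
    mass (fun p => f p + s * g p) = mass f + s * mass g := by
  rw [mass, integral_add hf (hg.const_mul s), integral_const_mul, mass, mass]
  ring

theorem kinetic_add_const_mul {f g : Space → ℝ} (hf : Integrable fun p : Space => ‖p‖ ^ 2 * f p)
    (hg : Integrable fun p : Space => ‖p‖ ^ 2 * g p) (s : ℝ) :
    kinetic (fun p => f p + s * g p) = kinetic f + s * kinetic g := by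
  rw [kinetic, integral_mul_add_const_mul hf hg, kinetic, kinetic]
  ring

end OneBody

section TwoBody

variable {v : Space → ℝ} {M : ℝ} (hv : IsKernel v M)
include hv

theorem IsKernel.bound_pos : 0 < M := hv.pos.trans_le (hv.le 0)

theorem IsKernel.abs_le (p : Space) : |v p| ≤ M := by
  rw [abs_of_nonneg (hv.nonneg p)]; exact hv.le p

theorem IsKernel.neg (p : Space) : v (-p) = v p := hv.radial _ _ (norm_neg p)

theorem IsKernel.sub_comm (p q : Space) : v (p - q) = v (q - p) := by
  rw [← neg_sub, hv.neg]

theorem IsKernel.map_isometry_sub (R : Space ≃ₗᵢ[ℝ] Space) (p q : Space) :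
    v (R p - R q) = v (p - q) := by
  rw [← map_sub, hv.radial (R (p - q)) (p - q) (R.norm_map _)]

theorem IsKernel.integrable_mul {f : Space → ℝ} (hf : Integrable f) :
    Integrable fun p => v p * f p :=
  hf.bdd_mul (c := M) hv.continuous.aestronglyMeasurable (ae_of_all _ hv.abs_le)

theorem IsKernel.integrable_sub_mul {f : Space → ℝ} (hf : Integrable f) (p : Space) :
    Integrable fun q => v (p - q) * f q :=
  hf.bdd_mul (c := M) (hv.continuous.comp (by fun_prop)).aestronglyMeasurable
    (ae_of_all _ fun _ => hv.abs_le _)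

theorem IsKernel.integrable_interaction {f g : Space → ℝ} (hf : Integrable f)
    (hg : Integrable g) :
    Integrable fun z : Space × Space => v (z.1 - z.2) * (f z.1 * g z.2) :=
  (hf.mul_prod hg).bdd_mul (c := M) (hv.continuous.comp (by fun_prop)).aestronglyMeasurable
    (ae_of_all _ fun _ => hv.abs_le _)

theorem IsKernel.abs_potential_le {f : Space → ℝ} (hf : Integrable f) (p : Space) :
    |potential v f p| ≤ c₃ * M * ∫ q, |f q| := by
  rw [potential, abs_mul, abs_of_pos c₃_pos, mul_assoc]
  exact mul_le_mul_of_nonneg_left (abs_integral_mul_le hf fun q => hv.abs_le _) c₃_pos.le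

theorem IsKernel.abs_potential_sub_le {f : Space → ℝ} (hf : Integrable f) (p p' : Space) :
    |potential v f p - potential v f p'| ≤ c₃ * M * (∫ q, |f q|) * ‖p - p'‖ := by
  have hdiff : potential v f p - potential v f p'
      = c₃ * ∫ q, (v (p - q) - v (p' - q)) * f q := by
    simp only [potential, sub_mul]
    rw [integral_sub (hv.integrable_sub_mul hf p) (hv.integrable_sub_mul hf p'), mul_sub]
  have hlip : ∀ q, |v (p - q) - v (p' - q)| ≤ M * ‖p - p'‖ := fun q => by
    simpa only [sub_sub_sub_cancel_right] using hv.lipschitz (p - q) (p' - q)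
  rw [hdiff, abs_mul, abs_of_pos c₃_pos]
  calc c₃ * |∫ q, (v (p - q) - v (p' - q)) * f q| ≤ c₃ * (M * ‖p - p'‖ * ∫ q, |f q|) :=
        mul_le_mul_of_nonneg_left (abs_integral_mul_le hf hlip) c₃_pos.le
    _ = c₃ * M * (∫ q, |f q|) * ‖p - p'‖ := by ring

theorem IsKernel.abs_potential_second_diff_le {f : Space → ℝ} (hf : Integrable f) (p h : Space) :
    |potential v f (p + h) + potential v f (p - h) - 2 * potential v f p|
      ≤ c₃ * M * (∫ q, |f q|) * ‖h‖ ^ 2 := by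
  have hdiff : potential v f (p + h) + potential v f (p - h) - 2 * potential v f p
      = c₃ * ∫ q, (v (p + h - q) + v (p - h - q) - 2 * v (p - q)) * f q := by
    have hplus := hv.integrable_sub_mul hf (p + h)
    have hminus := hv.integrable_sub_mul hf (p - h)
    simp only [potential, sub_mul, add_mul, mul_assoc]
    rw [integral_sub (by exact hplus.add hminus) ((hv.integrable_sub_mul hf p).const_mul 2),
      integral_add hplus hminus, integral_const_mul]
    ring
  have hsecond : ∀ q, |v (p + h - q) + v (p - h - q) - 2 * v (p - q)| ≤ M * ‖h‖ ^ 2 := fun q => by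
    simpa only [sub_add_eq_add_sub, sub_right_comm] using hv.second_diff (p - q) h
  rw [hdiff, abs_mul, abs_of_pos c₃_pos]
  calc c₃ * |∫ q, (v (p + h - q) + v (p - h - q) - 2 * v (p - q)) * f q|
      ≤ c₃ * (M * ‖h‖ ^ 2 * ∫ q, |f q|) :=
        mul_le_mul_of_nonneg_left (abs_integral_mul_le hf hsecond) c₃_pos.le
    _ = c₃ * M * (∫ q, |f q|) * ‖h‖ ^ 2 := by ring

theorem IsKernel.continuous_potential {f : Space → ℝ} (hf : Integrable f) :
    Continuous (potential v f) := by
  have h0 : 0 ≤ c₃ * M * ∫ q, |f q| :=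
    mul_nonneg (mul_pos c₃_pos hv.bound_pos).le (integral_nonneg fun _ => abs_nonneg _)
  refine (LipschitzWith.of_dist_le_mul (K := ⟨_, h0⟩) fun p p' => ?_).continuous
  rw [Real.dist_eq, dist_eq_norm]
  exact hv.abs_potential_sub_le hf p p'

theorem IsKernel.integrable_potential_mul {f g : Space → ℝ} (hf : Integrable f)
    (hg : Integrable g) : Integrable fun p => potential v f p * g p :=
  hg.bdd_mul (c := c₃ * M * ∫ q, |f q|) (hv.continuous_potential hf).aestronglyMeasurable
    (ae_of_all _ fun p => hv.abs_potential_le hf p)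

theorem IsKernel.potential_nonneg {f : Space → ℝ} (hf : ∀ᵐ p, 0 ≤ f p) (p : Space) :
    0 ≤ potential v f p :=
  mul_nonneg c₃_pos.le (integral_nonneg_of_ae (hf.mono fun _ hq => mul_nonneg (hv.nonneg _) hq))

theorem IsKernel.potential_comp_isometry (f : Space → ℝ) (R : Space ≃ₗᵢ[ℝ] Space) (p : Space) :
    potential v (f ∘ R) p = potential v f (R p) := by
  rw [potential, potential, ← R.measurePreserving.integral_comp R.toHomeomorph.measurableEmbedding
    (fun q => v (R p - q) * f q)]
  simp only [hv.map_isometry_sub, Function.comp_apply]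

theorem IsKernel.coupling_eq_potential_zero (f : Space → ℝ) :
    coupling v f = potential v f 0 := by
  simp only [coupling, potential, zero_sub, hv.neg]

theorem IsKernel.abs_coupling_le {f : Space → ℝ} (hf : Integrable f) :
    |coupling v f| ≤ c₃ * M * ∫ q, |f q| := by
  rw [hv.coupling_eq_potential_zero]
  exact hv.abs_potential_le hf 0

theorem IsKernel.coupling_comp_isometry (f : Space → ℝ) (R : Space ≃ₗᵢ[ℝ] Space) :
    coupling v (f ∘ R) = coupling v f :=
  congrArg (c₃ * ·) (integral_isRadial_mul_comp hv.radial f R)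

theorem IsKernel.coupling_add_const_mul {f g : Space → ℝ} (hf : Integrable f) (hg : Integrable g)
    (s : ℝ) : coupling v (fun p => f p + s * g p) = coupling v f + s * coupling v g := by
  rw [coupling, integral_mul_add_const_mul (hv.integrable_mul hf) (hv.integrable_mul hg),
    coupling, coupling]
  ring

theorem IsKernel.interaction_eq {f g : Space → ℝ} (hf : Integrable f) (hg : Integrable g) :
    interaction v f g = c₃ * ∫ p, f p * potential v g p := by
  rw [interaction, Measure.volume_eq_prod, integral_prod _ (hv.integrable_interaction hf hg), sq,
    mul_assoc, ← integral_const_mul]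
  refine congrArg (c₃ * ·) (integral_congr_ae (ae_of_all _ fun p => ?_))
  simp only [potential, mul_left_comm (f p) c₃, ← integral_const_mul (f p)]
  exact congrArg (c₃ * ·) (integral_congr_ae (ae_of_all _ fun q => by ring))

theorem IsKernel.abs_interaction_le {f g : Space → ℝ} (hf : Integrable f) (hg : Integrable g) :
    |interaction v f g| ≤ c₃ ^ 2 * M * ((∫ q, |f q|) * ∫ q, |g q|) := by
  rw [interaction, abs_mul, abs_of_pos (pow_pos c₃_pos 2), mul_assoc, ← integral_prod_mul]
  simp only [← abs_mul]
  exact mul_le_mul_of_nonneg_left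
    (abs_integral_mul_le (hf.mul_prod hg) fun _ => hv.abs_le _) (pow_pos c₃_pos 2).le

theorem IsKernel.interaction_self_nonneg {f : Space → ℝ} (hf : Integrable f) :
    0 ≤ interaction v f f :=
  mul_nonneg (pow_pos c₃_pos 2).le (hv.posSemidef f hf)

theorem IsKernel.interaction_comm (f g : Space → ℝ) :
    interaction v f g = interaction v g f := by
  rw [interaction, Measure.volume_eq_prod, ← integral_prod_swap]
  simp only [Prod.fst_swap, Prod.snd_swap, hv.sub_comm, mul_comm (f _)]
  rfl

theorem IsKernel.interaction_comp_isometry (f g : Space → ℝ) (R : Space ≃ₗᵢ[ℝ] Space) :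
    interaction v (f ∘ R) (g ∘ R) = interaction v f g := by
  have hR := R.measurePreserving.prod R.measurePreserving
  rw [interaction, interaction, Measure.volume_eq_prod, ← hR.integral_comp
    (R.toHomeomorph.prodCongr R.toHomeomorph).measurableEmbedding
    (fun z : Space × Space => v (z.1 - z.2) * (f z.1 * g z.2))]
  simp only [Prod.map, Function.comp_apply, hv.map_isometry_sub]

theorem IsKernel.interaction_add_const_mul_left {f g h : Space → ℝ} (hf : Integrable f)
    (hg : Integrable g) (hh : Integrable h) (s : ℝ) :
    interaction v (fun p => f p + s * g p) h = interaction v f h + s * interaction v g h := by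
  have hlin := integral_mul_add_const_mul (hv.integrable_interaction hf hh)
    (hv.integrable_interaction hg hh) s
  simp only [← mul_assoc s, ← add_mul] at hlin
  rw [interaction, hlin, interaction, interaction]
  ring

theorem IsKernel.interaction_self_add_const_mul {f g : Space → ℝ} (hf : Integrable f)
    (hg : Integrable g) (s : ℝ) :
    interaction v (fun p => f p + s * g p) (fun p => f p + s * g p)
      = interaction v f f + 2 * s * interaction v f g + s ^ 2 * interaction v g g := by
  have hfg : Integrable fun p => f p + s * g p := hf.add (hg.const_mul s)
  rw [hv.interaction_add_const_mul_left hf hg hfg, hv.interaction_comm f, hv.interaction_comm g,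
    hv.interaction_add_const_mul_left hf hg hf, hv.interaction_add_const_mul_left hf hg hg,
    hv.interaction_comm g f]
  ring

end TwoBody

/-- The variational derivative `∂E/∂γ(p)` of the energy `E`. -/
def gradGamma (v : Space → ℝ) (μ : ℝ) (γ : Space → ℝ) (t : ℝ) (p : Space) : ℝ :=
  ‖p‖ ^ 2 - μ + v 0 * (t + mass γ) + potential v γ p + t * v p

/-- The variational derivative `∂E/∂α(p)` of the energy `E`. -/
def gradAlpha (v α : Space → ℝ) (t : ℝ) (p : Space) : ℝ := potential v α p + t * v p

section Expansion

variable {v : Space → ℝ} {M : ℝ} (hv : IsKernel v M)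
include hv

theorem IsKernel.integrable_gradGamma_mul {γ δ : Space → ℝ} (hγ : Integrable γ)
    (hδ : Integrable δ) (hδ2 : Integrable fun p : Space => ‖p‖ ^ 2 * δ p) (μ t : ℝ) :
    Integrable fun p => gradGamma v μ γ t p * δ p := by
  have := ((hδ2.add (hδ.const_mul (v 0 * (t + mass γ) - μ))).add
    (hv.integrable_potential_mul hγ hδ)).add ((hv.integrable_mul hδ).const_mul t)
  refine this.congr (ae_of_all _ fun p => ?_)
  simp only [Pi.add_apply, gradGamma]
  ring

theorem IsKernel.integrable_gradAlpha_mul {α β : Space → ℝ} (hα : Integrable α)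
    (hβ : Integrable β) (t : ℝ) : Integrable fun p => gradAlpha v α t p * β p := by
  have := (hv.integrable_potential_mul hα hβ).add ((hv.integrable_mul hβ).const_mul t)
  refine this.congr (ae_of_all _ fun p => ?_)
  simp only [Pi.add_apply, gradAlpha]
  ring

theorem IsKernel.integral_gradGamma_mul {γ δ : Space → ℝ} (hγ : Integrable γ) (hδ : Integrable δ)
    (hδ2 : Integrable fun p : Space => ‖p‖ ^ 2 * δ p) (μ t : ℝ) :
    c₃ * ∫ p, gradGamma v μ γ t p * δ p
      = kinetic δ + (v 0 * (t + mass γ) - μ) * mass δ + interaction v γ δ + t * coupling v δ := by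
  have hmass := hδ.const_mul (v 0 * (t + mass γ) - μ)
  have hpot := hv.integrable_potential_mul hγ hδ
  have hsplit : ∀ p, gradGamma v μ γ t p * δ p = ‖p‖ ^ 2 * δ p + (v 0 * (t + mass γ) - μ) * δ p
      + potential v γ p * δ p + t * (v p * δ p) := fun p => by unfold gradGamma; ring
  simp only [hsplit]
  rw [integral_add (by exact (hδ2.add hmass).add hpot) ((hv.integrable_mul hδ).const_mul t),
    integral_add (by exact hδ2.add hmass) hpot, integral_add hδ2 hmass, integral_const_mul,
    integral_const_mul, hv.interaction_comm, hv.interaction_eq hδ hγ, kinetic, coupling, mass, mass]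
  simp only [mul_comm (δ _)]
  ring

theorem IsKernel.integral_gradAlpha_mul {α β : Space → ℝ} (hα : Integrable α) (hβ : Integrable β)
    (t : ℝ) : c₃ * ∫ p, gradAlpha v α t p * β p = interaction v α β + t * coupling v β := by
  have hsplit : ∀ p, gradAlpha v α t p * β p = potential v α p * β p + t * (v p * β p) :=
    fun p => by unfold gradAlpha; ring
  simp only [hsplit]
  rw [integral_add (hv.integrable_potential_mul hα hβ) ((hv.integrable_mul hβ).const_mul t),
    integral_const_mul, hv.interaction_comm, hv.interaction_eq hβ hα, coupling]
  simp only [mul_comm (β _)]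
  ring

theorem IsKernel.energy_add_const_mul {γ α δ β : Space → ℝ} (hγ : Integrable γ)
    (hα : Integrable α) (hδ : Integrable δ) (hβ : Integrable β)
    (hγ2 : Integrable fun p : Space => ‖p‖ ^ 2 * γ p)
    (hδ2 : Integrable fun p : Space => ‖p‖ ^ 2 * δ p) (μ t s : ℝ) :
    energy v μ (fun p => γ p + s * δ p) (fun p => α p + s * β p) t
      = energy v μ γ α t
        + s * (c₃ * ∫ p, (gradGamma v μ γ t p * δ p + gradAlpha v α t p * β p))
        + s ^ 2 * (v 0 / 2 * mass δ ^ 2 + 1 / 2 * (interaction v β β + interaction v δ δ)) := by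
  rw [integral_add (hv.integrable_gradGamma_mul hγ hδ hδ2 μ t)
    (hv.integrable_gradAlpha_mul hα hβ t), mul_add, hv.integral_gradGamma_mul hγ hδ hδ2,
    hv.integral_gradAlpha_mul hα hβ]
  unfold energy
  rw [kinetic_add_const_mul hγ2 hδ2, mass_add_const_mul hγ hδ,
    hv.interaction_self_add_const_mul hα hβ, hv.interaction_self_add_const_mul hγ hδ,
    hv.coupling_add_const_mul hγ hδ, hv.coupling_add_const_mul hα hβ]
  ring

theorem IsKernel.energy_comp_isometry (μ : ℝ) (γ α : Space → ℝ) (t : ℝ)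
    (R : Space ≃ₗᵢ[ℝ] Space) : energy v μ (γ ∘ R) (α ∘ R) t = energy v μ γ α t := by
  simp only [energy, kinetic_comp_isometry, mass_comp_isometry, hv.interaction_comp_isometry,
    hv.coupling_comp_isometry]

end Expansion

theorem energy_add_right (v : Space → ℝ) (μ : ℝ) (γ α : Space → ℝ) (t s : ℝ) :
    energy v μ γ α (t + s) = energy v μ γ α t
      + s * (-μ + v 0 * (t + mass γ) + (coupling v γ + coupling v α)) + v 0 / 2 * s ^ 2 := by
  unfold energy; ring

theorem freeEnergy_eq_energy {V : Space → ℝ} {M : ℝ} (hv : IsKernel (Vhat V) M)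
    {γ α : Space → ℝ} (hγ : Integrable γ) (hα : Integrable α) (μ t : ℝ) :
    freeEnergy V 0 μ (γ, α, t) = energy (Vhat V) μ γ α t := by
  simp only [freeEnergy, energy, density, interaction, coupling, kinetic, mass, mul_add]
  rw [integral_add (hv.integrable_interaction hα hα) (hv.integrable_interaction hγ hγ),
    integral_add (hv.integrable_mul hγ) (hv.integrable_mul hα)]
  ring

/-! ### States and lower bounds -/

section Integration

variable {X : Type*} [MeasurableSpace X] {ν : Measure X}

theorem integrable_of_memLp_of_ae_eq_zero {E : Type*} [NormedAddCommGroup E] {f : X → E}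
    {p : ENNReal} {s : Set X} (hp : 1 ≤ p) (hf : MemLp f p ν) (hs : ν s ≠ ⊤)
    (h0 : ∀ᵐ x ∂ν, x ∉ s → f x = 0) : Integrable f ν := by
  have : IsFiniteMeasure (ν.restrict s) := isFiniteMeasure_restrict.2 hs
  exact IntegrableOn.integrable_of_ae_notMem_eq_zero (hf.restrict s |>.integrable hp) h0

theorem integrable_continuous_mul_of_ae_eq_zero [TopologicalSpace X] [T2Space X]
    [OpensMeasurableSpace X] {w f : X → ℝ} {K : Set X} (hw : Continuous w)
    (hf : Integrable f ν) (hK : IsCompact K) (h0 : ∀ᵐ x ∂ν, x ∉ K → f x = 0) :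
    Integrable (fun x => w x * f x) ν :=
  (hf.integrableOn.continuousOn_mul hw.continuousOn hK).integrable_of_ae_notMem_eq_zero
    (h0.mono fun x hx hxK => by rw [hx hxK, mul_zero])

theorem integrable_and_integral_le_of_tendsto {f : ℕ → X → ℝ} {g : X → ℝ} {k : ℕ → ℝ} {l : ℝ}
    (hf : ∀ n, Integrable (f n) ν) (h0 : ∀ n, ∀ᵐ x ∂ν, 0 ≤ f n x)
    (hfg : ∀ᵐ x ∂ν, Tendsto (fun n => f n x) atTop (𝓝 (g x)))
    (hk : ∀ n, ∫ x, f n x ∂ν ≤ k n) (hl : Tendsto k atTop (𝓝 l)) :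
    Integrable g ν ∧ ∫ x, g x ∂ν ≤ l := by
  have hg0 : 0 ≤ᵐ[ν] g := by
    filter_upwards [ae_all_iff.2 h0, hfg] with x hx0 hx
    exact ge_of_tendsto' hx hx0
  have hl0 : 0 ≤ l := ge_of_tendsto' hl fun n => (integral_nonneg_of_ae (h0 n)).trans (hk n)
  have hfatou : ∫⁻ x, ENNReal.ofReal (g x) ∂ν ≤ ENNReal.ofReal l :=
    calc ∫⁻ x, ENNReal.ofReal (g x) ∂ν
        = ∫⁻ x, liminf (fun n => ENNReal.ofReal (f n x)) atTop ∂ν :=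
          lintegral_congr_ae (hfg.mono fun x hx =>
            ((ENNReal.continuous_ofReal.tendsto _).comp hx).liminf_eq.symm)
      _ ≤ liminf (fun n => ∫⁻ x, ENNReal.ofReal (f n x) ∂ν) atTop :=
          lintegral_liminf_le' fun n => (hf n).1.aemeasurable.ennreal_ofReal
      _ ≤ liminf (fun n => ENNReal.ofReal (k n)) atTop := by
          refine liminf_le_liminf (Eventually.of_forall fun n => ?_)
          rw [← ofReal_integral_eq_lintegral_ofReal (hf n) (h0 n)]
          exact ENNReal.ofReal_le_ofReal (hk n)
      _ = ENNReal.ofReal l := ((ENNReal.continuous_ofReal.tendsto l).comp hl).liminf_eq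
  have hg : Integrable g ν := by
    refine ⟨aestronglyMeasurable_of_tendsto_ae _ (fun n => (hf n).1) hfg, ?_⟩
    rw [hasFiniteIntegral_iff_ofReal hg0]
    exact hfatou.trans_lt ENNReal.ofReal_lt_top
  rw [← ofReal_integral_eq_lintegral_ofReal hg hg0, ENNReal.ofReal_le_ofReal_iff hl0] at hfatou
  exact ⟨hg, hfatou⟩

end Integration

/-- The pointwise constraint `0 ≤ γ`, `α² ≤ γ (1 + γ)`. -/
def Feasible (g a : ℝ) : Prop := 0 ≤ g ∧ a ^ 2 ≤ g * (1 + g)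

theorem Feasible.abs_le {g a : ℝ} (h : Feasible g a) : |a| ≤ g + 1 / 2 :=
  abs_le_of_sq_le_sq (by nlinarith [h.1, h.2]) (by linarith [h.1])

theorem feasible_zero : Feasible 0 0 := ⟨le_rfl, by norm_num⟩

theorem Feasible.neg {g a : ℝ} (h : Feasible g a) : Feasible g (-a) := ⟨h.1, by simpa using h.2⟩

theorem Feasible.two_mul_abs_mul_le {g a g' a' : ℝ} (h : Feasible g a) (h' : Feasible g' a') :
    2 * |a * a'| ≤ g + g' + 2 * (g * g') := by
  obtain ⟨hg, hga⟩ := h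
  obtain ⟨hg', hga'⟩ := h'
  have hprod : a ^ 2 * a' ^ 2 ≤ (g * (1 + g)) * (g' * (1 + g')) :=
    mul_le_mul hga hga' (sq_nonneg _) (by positivity)
  rw [← abs_two, ← abs_mul, abs_two]
  refine abs_le_of_sq_le_sq ?_ (by positivity)
  nlinarith [sq_nonneg (g - g')]

theorem Feasible.segment {g a g' a' s : ℝ} (h : Feasible g a) (h' : Feasible g' a') (h0 : 0 ≤ s)
    (h1 : s ≤ 1) : Feasible (g + s * (g' - g)) (a + s * (a' - a)) := by
  have hcross := (mul_le_mul_of_nonneg_left (le_abs_self (a * a')) zero_le_two).trans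
    (h.two_mul_abs_mul_le h')
  obtain ⟨hg, hga⟩ := h
  obtain ⟨hg', hga'⟩ := h'
  refine ⟨by nlinarith, ?_⟩
  linear_combination mul_le_mul_of_nonneg_left hga (sq_nonneg (1 - s))
    + mul_le_mul_of_nonneg_left hga' (sq_nonneg s)
    + mul_le_mul_of_nonneg_left hcross (mul_nonneg h0 (sub_nonneg.2 h1))

/-- Integrable pairs of finite kinetic energy satisfying the pointwise constraint. -/
structure IsState (γ α : Space → ℝ) : Prop where
  integrable_gamma : Integrable γ
  integrable_alpha : Integrable α
  integrable_kinetic : Integrable fun p : Space => ‖p‖ ^ 2 * γ p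
  feasible : ∀ᵐ p, Feasible (γ p) (α p)

/-- Square integrable pairs supported in a ball satisfying the pointwise constraint. -/
structure IsTestState (R : ℝ) (γ α : Space → ℝ) : Prop where
  memLp_gamma : MemLp γ 2
  memLp_alpha : MemLp α 2
  support : ∀ᵐ p : Space, R < ‖p‖ → γ p = 0 ∧ α p = 0
  feasible : ∀ᵐ p, Feasible (γ p) (α p)

theorem IsTestState.ae_eq_zero_gamma {R : ℝ} {γ α : Space → ℝ} (h : IsTestState R γ α) :
    ∀ᵐ p, p ∉ Metric.closedBall (0 : Space) R → γ p = 0 :=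
  h.support.mono fun _ hp hR => (hp (by simpa using hR)).1

theorem IsTestState.ae_eq_zero_alpha {R : ℝ} {γ α : Space → ℝ} (h : IsTestState R γ α) :
    ∀ᵐ p, p ∉ Metric.closedBall (0 : Space) R → α p = 0 :=
  h.support.mono fun _ hp hR => (hp (by simpa using hR)).2

theorem IsState.nonneg {γ α : Space → ℝ} (h : IsState γ α) : ∀ᵐ p, 0 ≤ γ p :=
  h.feasible.mono fun _ hp => hp.1

theorem IsTestState.isState {R : ℝ} {γ α : Space → ℝ} (h : IsTestState R γ α) :
    IsState γ α := by
  have hball : volume (Metric.closedBall (0 : Space) R) ≠ ⊤ := measure_closedBall_lt_top.ne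
  have hγ := integrable_of_memLp_of_ae_eq_zero one_le_two h.memLp_gamma hball
    h.ae_eq_zero_gamma
  exact ⟨hγ, integrable_of_memLp_of_ae_eq_zero one_le_two h.memLp_alpha hball h.ae_eq_zero_alpha,
    integrable_continuous_mul_of_ae_eq_zero (by fun_prop) hγ (isCompact_closedBall 0 R)
      h.ae_eq_zero_gamma, h.feasible⟩

theorem IsTestState.mono {R R' : ℝ} {γ α : Space → ℝ} (h : IsTestState R γ α) (hR : R ≤ R') :
    IsTestState R' γ α :=
  ⟨h.memLp_gamma, h.memLp_alpha, h.support.mono fun _ hp h' => hp (hR.trans_lt h'), h.feasible⟩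

theorem isTestState_zero (R : ℝ) : IsTestState R (fun _ => 0) (fun _ => 0) :=
  ⟨MemLp.zero, MemLp.zero, ae_of_all _ fun _ _ => ⟨rfl, rfl⟩, ae_of_all _ fun _ => feasible_zero⟩

theorem IsState.abs_alpha_le {γ α : Space → ℝ} (h : IsState γ α) : ∀ᵐ p, |α p| ≤ γ p + 1 / 2 :=
  h.feasible.mono fun _ hp => hp.abs_le

section LowerBound

variable {v : Space → ℝ} {M : ℝ} (hv : IsKernel v M)
include hv

theorem IsKernel.mass_nonneg : 0 ≤ mass v := Bogoliubov.mass_nonneg (ae_of_all _ hv.nonneg)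

theorem IsKernel.neg_half_mass_le_coupling_add {γ α : Space → ℝ} (h : IsState γ α) :
    -(1 / 2 * mass v) ≤ coupling v γ + coupling v α := by
  have hγ := hv.integrable_mul h.integrable_gamma
  have hα := hv.integrable_mul h.integrable_alpha
  have hpoint : ∀ᵐ p, -(1 / 2 * v p) ≤ v p * γ p + v p * α p := by
    filter_upwards [h.abs_alpha_le] with p hp
    have hpos : 0 ≤ γ p + α p + 1 / 2 := by linarith [neg_abs_le (α p)]
    linarith [mul_nonneg (hv.nonneg p) hpos]
  have hint := integral_mono_ae (hv.integrable.const_mul _).neg (hγ.add hα) hpoint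
  simp only [Pi.neg_apply, Pi.add_apply] at hint
  rw [integral_neg, integral_const_mul, integral_add hγ hα] at hint
  unfold coupling mass
  linarith [mul_le_mul_of_nonneg_left hint c₃_pos.le]

theorem IsKernel.le_energy {γ α : Space → ℝ} (h : IsState γ α) (μ : ℝ) {t : ℝ} (ht : 0 ≤ t) :
    kinetic γ + v 0 / 2 * (t + mass γ) ^ 2 - (|μ| + 1 / 2 * mass v) * (t + mass γ)
      ≤ energy v μ γ α t := by
  have hmass := Bogoliubov.mass_nonneg h.nonneg
  have hμ : μ * (t + mass γ) ≤ |μ| * (t + mass γ) :=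
    mul_le_mul_of_nonneg_right (le_abs_self _) (by positivity)
  have hcoupling := mul_le_mul_of_nonneg_left (hv.neg_half_mass_le_coupling_add h) ht
  unfold energy
  linarith [mul_nonneg hv.mass_nonneg hmass, hv.interaction_self_nonneg h.integrable_gamma,
    hv.interaction_self_nonneg h.integrable_alpha]

end LowerBound

theorem energy_zero (v : Space → ℝ) (μ t : ℝ) :
    energy v μ (fun _ => 0) (fun _ => 0) t = -μ * t + v 0 / 2 * t ^ 2 := by
  simp [energy, kinetic, mass, interaction, coupling]

section Continuity

variable {f : ℕ → Space → ℝ} {g : Space → ℝ} (hf : ∀ n, Integrable (f n)) (hg : Integrable g)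
  (h : Tendsto (fun n => ∫ p, |f n p - g p|) atTop (𝓝 0))
include hf hg h

theorem tendsto_mass : Tendsto (fun n => mass (f n)) atTop (𝓝 (mass g)) := by
  rw [tendsto_iff_dist_tendsto_zero]
  refine squeeze_zero (fun _ => dist_nonneg) (fun n => ?_) (by simpa using h.const_mul c₃)
  have := abs_mass_le fun p => f n p - g p
  unfold mass at *
  rwa [Real.dist_eq, ← mul_sub, ← integral_sub (hf n) hg]

variable {v : Space → ℝ} {M : ℝ} (hv : IsKernel v M)
include hv

theorem IsKernel.tendsto_coupling :
    Tendsto (fun n => coupling v (f n)) atTop (𝓝 (coupling v g)) := by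
  rw [tendsto_iff_dist_tendsto_zero]
  refine squeeze_zero (fun _ => dist_nonneg) (fun n => ?_)
    (by simpa using h.const_mul (c₃ * M))
  have hsub := hv.coupling_add_const_mul hg ((hf n).sub hg) 1
  simp only [Pi.sub_apply, one_mul, add_sub_cancel] at hsub
  rw [Real.dist_eq, hsub, add_sub_cancel_left]
  exact hv.abs_coupling_le ((hf n).sub hg)

theorem IsKernel.tendsto_interaction :
    Tendsto (fun n => interaction v (f n) (f n)) atTop (𝓝 (interaction v g g)) := by
  rw [tendsto_iff_dist_tendsto_zero]
  have hlim : Tendsto (fun n => 2 * (c₃ ^ 2 * M * ((∫ p, |g p|) * ∫ p, |f n p - g p|))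
      + c₃ ^ 2 * M * ((∫ p, |f n p - g p|) * ∫ p, |f n p - g p|)) atTop (𝓝 0) := by
    have hcross := ((h.const_mul (∫ p, |g p|)).const_mul (c₃ ^ 2 * M)).const_mul 2
    have hsquare := (h.mul h).const_mul (c₃ ^ 2 * M)
    simpa using hcross.add hsquare
  refine squeeze_zero (fun _ => dist_nonneg) (fun n => ?_) hlim
  have hδ := (hf n).sub hg
  have hexpand := hv.interaction_self_add_const_mul hg hδ 1
  simp only [Pi.sub_apply, one_mul, add_sub_cancel, one_pow, mul_one] at hexpand
  rw [Real.dist_eq, hexpand, add_assoc, add_sub_cancel_left]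
  refine (abs_add_le _ _).trans (add_le_add ?_ (hv.abs_interaction_le hδ hδ))
  rw [abs_mul, abs_two]
  exact mul_le_mul_of_nonneg_left (hv.abs_interaction_le hg hδ) zero_le_two

end Continuity

theorem exists_isMinOn_of_midpoint {H : Type*} [NormedAddCommGroup H] [CompleteSpace H]
    {K : Set H} (hK : K.Nonempty) {J : H → ℝ} (hbdd : BddBelow (J '' K)) {κ : ℝ} (hκ : 0 < κ)
    (hmid : ∀ x ∈ K, ∀ y ∈ K, ∃ m ∈ K, J m ≤ (J x + J y) / 2 - κ * ‖x - y‖ ^ 2)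
    (hlsc : ∀ (u : ℕ → H) (x : H) (l : ℝ), (∀ n, u n ∈ K) → Tendsto u atTop (𝓝 x) →
      Tendsto (fun n => J (u n)) atTop (𝓝 l) → x ∈ K ∧ J x ≤ l) :
    ∃ x ∈ K, IsMinOn J K x := by
  have hle : ∀ x ∈ K, sInf (J '' K) ≤ J x := fun x hx => csInf_le hbdd ⟨x, hx, rfl⟩
  have hex : ∀ n : ℕ, ∃ x ∈ K, J x < sInf (J '' K) + 1 / ((n : ℝ) + 1) := fun n => by
    obtain ⟨_, ⟨x, hx, rfl⟩, h⟩ := exists_lt_of_csInf_lt (hK.image J)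
      (lt_add_of_pos_right _ (Nat.one_div_pos_of_nat (α := ℝ) (n := n)))
    exact ⟨x, hx, h⟩
  choose u huK hu using hex
  have hJ : Tendsto (fun n => J (u n)) atTop (𝓝 (sInf (J '' K))) := by
    refine tendsto_of_tendsto_of_tendsto_of_le_of_le tendsto_const_nhds
      (h := fun n : ℕ => sInf (J '' K) + 1 / ((n : ℝ) + 1)) ?_ (fun n => hle _ (huK n))
      (fun n => (hu n).le)
    simpa using tendsto_one_div_add_atTop_nhds_zero_nat.const_add (sInf (J '' K))
  have hC : CauchySeq u := by
    rw [Metric.cauchySeq_iff']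
    intro e he
    obtain ⟨N, hN⟩ := exists_nat_one_div_lt (mul_pos hκ (pow_pos he 2))
    refine ⟨N, fun n hn => ?_⟩
    obtain ⟨m, hm, hmJ⟩ := hmid _ (huK n) _ (huK N)
    have hnN : 1 / ((n : ℝ) + 1) ≤ 1 / ((N : ℝ) + 1) := by gcongr
    rw [dist_eq_norm]
    refine lt_of_pow_lt_pow_left₀ 2 he.le (lt_of_mul_lt_mul_left (a := κ) ?_ hκ.le)
    linarith [hle m hm, hu n, hu N]
  obtain ⟨x, hx⟩ := cauchySeq_tendsto_of_complete hC
  obtain ⟨hxK, hxJ⟩ := hlsc u x _ huK hx hJ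
  exact ⟨x, hxK, fun y hy => hxJ.trans (hle y hy)⟩

/-! ### The regularized energy -/

/-- The squared norm `(2π)⁻³ ∫ (γ² + α²)` used to regularize the energy. -/
def sqNorm (γ α : Space → ℝ) : ℝ := c₃ * ∫ p, (γ p ^ 2 + α p ^ 2)

/-- The energy with a quadratic regularization, which makes it uniformly convex at fixed `t`. -/
def regEnergy (v : Space → ℝ) (μ ε : ℝ) (γ α : Space → ℝ) (t : ℝ) : ℝ :=
  energy v μ γ α t + ε * sqNorm γ α

/-- The integrand of the directional derivative of `regEnergy` at `(γ, α)` towards `(γ', α')`. -/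
def regEnergySlope (v : Space → ℝ) (μ ε t : ℝ) (γ α γ' α' : Space → ℝ) (p : Space) : ℝ :=
  gradGamma v μ γ t p * (γ' p - γ p) + gradAlpha v α t p * (α' p - α p)
    + ε * (2 * (γ p * (γ' p - γ p) + α p * (α' p - α p)))

/-- The quadratic part of `regEnergy` in the direction `(δ, β)`. -/
def regEnergyQuad (v : Space → ℝ) (ε : ℝ) (δ β : Space → ℝ) : ℝ :=
  v 0 / 2 * mass δ ^ 2 + 1 / 2 * (interaction v β β + interaction v δ δ) + ε * sqNorm δ β

/-- `(γ, α)` minimizes the regularized energy at condensate density `t` among the test states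
supported in the ball of radius `R`. -/
structure IsRegMin (v : Space → ℝ) (μ ε t R : ℝ) (γ α : Space → ℝ) : Prop where
  isTestState : IsTestState R γ α
  le : ∀ δ β, IsTestState R δ β → regEnergy v μ ε γ α t ≤ regEnergy v μ ε δ β t

/-- `(x, y)` minimizes the linear functional `A g + B a` over the feasible pairs `(g, a)`, up to
the error `ε (g² + a²)` left by the regularization. -/
def IsLinearMin (A B ε x y : ℝ) : Prop :=
  ∀ g a, Feasible g a → A * x + B * y ≤ A * g + B * a + ε * (g ^ 2 + a ^ 2)

section SqNorm

theorem sqNorm_nonneg (γ α : Space → ℝ) : 0 ≤ sqNorm γ α :=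
  mul_nonneg c₃_pos.le (integral_nonneg fun _ => by positivity)

theorem sqNorm_add_const_mul {γ α δ β : Space → ℝ} (hγ : MemLp γ 2) (hα : MemLp α 2)
    (hδ : MemLp δ 2) (hβ : MemLp β 2) (s : ℝ) :
    sqNorm (fun p => γ p + s * δ p) (fun p => α p + s * β p)
      = sqNorm γ α + s * (c₃ * ∫ p, 2 * (γ p * δ p + α p * β p)) + s ^ 2 * sqNorm δ β := by
  have hconst : Integrable fun p => γ p ^ 2 + α p ^ 2 := hγ.integrable_sq.add hα.integrable_sq
  have hlin : Integrable fun p => 2 * (γ p * δ p + α p * β p) :=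
    ((hγ.integrable_mul hδ).add (hα.integrable_mul hβ)).const_mul 2
  have hquad : Integrable fun p => δ p ^ 2 + β p ^ 2 := hδ.integrable_sq.add hβ.integrable_sq
  have hsum : Integrable fun p => γ p ^ 2 + α p ^ 2 + s * (2 * (γ p * δ p + α p * β p)) :=
    hconst.add (hlin.const_mul s)
  have hexpand : ∀ p, (γ p + s * δ p) ^ 2 + (α p + s * β p) ^ 2 = γ p ^ 2 + α p ^ 2
      + s * (2 * (γ p * δ p + α p * β p)) + s ^ 2 * (δ p ^ 2 + β p ^ 2) := fun p => by ring
  simp only [sqNorm, hexpand]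
  rw [integral_add hsum (hquad.const_mul _),
    integral_add hconst (hlin.const_mul s), integral_const_mul s, integral_const_mul (s ^ 2)]
  ring

theorem ae_eq_of_sqNorm_sub_eq_zero {γ α γ' α' : Space → ℝ} (hγ : MemLp γ 2) (hα : MemLp α 2)
    (hγ' : MemLp γ' 2) (hα' : MemLp α' 2)
    (h : sqNorm (fun p => γ' p - γ p) (fun p => α' p - α p) = 0) :
    γ' =ᵐ[volume] γ ∧ α' =ᵐ[volume] α := by
  have hsum : Integrable fun p => (γ' p - γ p) ^ 2 + (α' p - α p) ^ 2 :=
    (hγ'.sub hγ).integrable_sq.add (hα'.sub hα).integrable_sq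
  have hint : ∫ p, ((γ' p - γ p) ^ 2 + (α' p - α p) ^ 2) = 0 :=
    (mul_eq_zero.1 h).resolve_left c₃_pos.ne'
  rw [integral_eq_zero_iff_of_nonneg (fun p => by simp only [Pi.zero_apply]; positivity)
    hsum] at hint
  have hsq : ∀ᵐ p, (γ' p - γ p) ^ 2 = 0 ∧ (α' p - α p) ^ 2 = 0 :=
    hint.mono fun p hp => (add_eq_zero_iff_of_nonneg (sq_nonneg _) (sq_nonneg _)).1 hp
  exact ⟨hsq.mono fun p hp => sub_eq_zero.1 (pow_eq_zero_iff two_ne_zero |>.1 hp.1),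
    hsq.mono fun p hp => sub_eq_zero.1 (pow_eq_zero_iff two_ne_zero |>.1 hp.2)⟩

theorem sqNorm_comp_isometry (γ α : Space → ℝ) (T : Space ≃ₗᵢ[ℝ] Space) :
    sqNorm (γ ∘ T) (α ∘ T) = sqNorm γ α :=
  congrArg (c₃ * ·) (T.measurePreserving.integral_comp T.toHomeomorph.measurableEmbedding
    fun q => γ q ^ 2 + α q ^ 2)

end SqNorm

section Congr

variable {γ α γ' α' : Space → ℝ} (hγ : γ =ᵐ[volume] γ') (hα : α =ᵐ[volume] α')

theorem interaction_congr (v : Space → ℝ) (hγ : γ =ᵐ[volume] γ') (hα : α =ᵐ[volume] α') :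
    interaction v γ α = interaction v γ' α' := by
  have hfst : (fun z : Space × Space => γ z.1) =ᵐ[volume.prod volume] fun z => γ' z.1 :=
    Measure.quasiMeasurePreserving_fst.ae_eq_comp hγ
  have hsnd : (fun z : Space × Space => α z.2) =ᵐ[volume.prod volume] fun z => α' z.2 :=
    Measure.quasiMeasurePreserving_snd.ae_eq_comp hα
  refine congrArg (c₃ ^ 2 * ·) (integral_congr_ae ?_)
  filter_upwards [hfst, hsnd] with z hz1 hz2
  rw [hz1, hz2]

theorem coupling_congr (v : Space → ℝ) (hγ : γ =ᵐ[volume] γ') : coupling v γ = coupling v γ' :=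
  congrArg (c₃ * ·) (integral_congr_ae (hγ.mono fun p hp => by simp only [hp]))

include hγ hα

theorem energy_congr (v : Space → ℝ) (μ t : ℝ) :
    energy v μ γ α t = energy v μ γ' α' t := by
  have hmass : mass γ = mass γ' := congrArg (c₃ * ·) (integral_congr_ae hγ)
  have hkinetic : kinetic γ = kinetic γ' :=
    congrArg (c₃ * ·) (integral_congr_ae (hγ.mono fun p hp => by simp only [hp]))
  simp only [energy, hmass, hkinetic, coupling_congr v hγ, coupling_congr v hα,
    interaction_congr v hγ hγ, interaction_congr v hα hα]

theorem regEnergy_congr (v : Space → ℝ) (μ ε t : ℝ) :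
    regEnergy v μ ε γ α t = regEnergy v μ ε γ' α' t := by
  have hsq : sqNorm γ α = sqNorm γ' α' := by
    refine congrArg (c₃ * ·) (integral_congr_ae ?_)
    filter_upwards [hγ, hα] with p hpγ hpα
    rw [hpγ, hpα]
  simp only [regEnergy, energy_congr hγ hα, hsq]

theorem IsTestState.congr {R : ℝ} (h : IsTestState R γ α) : IsTestState R γ' α' := by
  refine ⟨h.memLp_gamma.ae_eq hγ, h.memLp_alpha.ae_eq hα, ?_, ?_⟩
  · filter_upwards [h.support, hγ, hα] with p hp hpγ hpα
    rwa [← hpγ, ← hpα]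
  · filter_upwards [h.feasible, hγ, hα] with p hp hpγ hpα
    rwa [← hpγ, ← hpα]

end Congr

section TestStates

variable {R : ℝ} {γ α γ' α' : Space → ℝ}

theorem IsTestState.comp_isometry (h : IsTestState R γ α) (T : Space ≃ₗᵢ[ℝ] Space) :
    IsTestState R (γ ∘ T) (α ∘ T) := by
  have hT := T.measurePreserving
  refine ⟨h.memLp_gamma.comp_measurePreserving hT, h.memLp_alpha.comp_measurePreserving hT, ?_,
    hT.quasiMeasurePreserving.ae h.feasible⟩
  filter_upwards [hT.quasiMeasurePreserving.ae h.support] with p hp hR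
  exact hp (by rwa [T.norm_map])

theorem IsTestState.segment (h : IsTestState R γ α) (h' : IsTestState R γ' α')
    {s : ℝ} (h0 : 0 ≤ s) (h1 : s ≤ 1) :
    IsTestState R (fun p => γ p + s * (γ' p - γ p)) (fun p => α p + s * (α' p - α p)) := by
  refine ⟨h.memLp_gamma.add ((h'.memLp_gamma.sub h.memLp_gamma).const_mul s),
    h.memLp_alpha.add ((h'.memLp_alpha.sub h.memLp_alpha).const_mul s), ?_, ?_⟩
  · filter_upwards [h.support, h'.support] with p hp hp' hR
    simp [hp hR, hp' hR]
  · filter_upwards [h.feasible, h'.feasible] with p hp hp'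
    exact hp.segment hp' h0 h1

theorem IsTestState.integrable_sq_norm_mul_sub (h : IsTestState R γ α)
    (h' : IsTestState R γ' α') : Integrable fun p : Space => ‖p‖ ^ 2 * (γ' p - γ p) :=
  (h'.isState.integrable_kinetic.sub h.isState.integrable_kinetic).congr
    (ae_of_all _ fun _ => (mul_sub _ _ _).symm)

open Classical in
theorem IsTestState.piecewise_const (h : IsTestState R γ α) {g a : ℝ} (hga : Feasible g a)
    {S : Set Space} (hS : MeasurableSet S) (hSR : S ⊆ Metric.closedBall 0 R) :
    IsTestState R (S.piecewise (fun _ => g) γ) (S.piecewise (fun _ => a) α) := by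
  have : IsFiniteMeasure (volume.restrict S) := isFiniteMeasure_restrict.2
    ((measure_mono hSR).trans_lt measure_closedBall_lt_top).ne
  refine ⟨(memLp_const g).piecewise hS (h.memLp_gamma.restrict _),
    (memLp_const a).piecewise hS (h.memLp_alpha.restrict _), ?_, ?_⟩
  · filter_upwards [h.support] with p hp hR
    have hpS : p ∉ S := fun hpS => absurd (hSR hpS) (by simpa using hR)
    simpa only [Set.piecewise_eq_of_notMem _ _ _ hpS] using hp hR
  · filter_upwards [h.feasible] with p hp
    by_cases hpS : p ∈ S
    · simpa only [Set.piecewise_eq_of_mem _ _ _ hpS] using hga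
    · simpa only [Set.piecewise_eq_of_notMem _ _ _ hpS] using hp

end TestStates

section Convexity

variable {v : Space → ℝ} {M : ℝ} (hv : IsKernel v M)
include hv

theorem IsKernel.mul_sqNorm_le_regEnergyQuad {δ β : Space → ℝ} (hδ : Integrable δ)
    (hβ : Integrable β) (ε : ℝ) : ε * sqNorm δ β ≤ regEnergyQuad v ε δ β := by
  have hmass : 0 ≤ v 0 / 2 * mass δ ^ 2 := mul_nonneg (half_pos hv.pos).le (sq_nonneg _)
  unfold regEnergyQuad
  linarith [hv.interaction_self_nonneg hδ, hv.interaction_self_nonneg hβ]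

variable {R : ℝ} {γ α γ' α' : Space → ℝ} (h : IsTestState R γ α) (h' : IsTestState R γ' α')
include h h'

theorem IsKernel.integrable_regEnergySlope (μ ε t : ℝ) :
    Integrable (regEnergySlope v μ ε t γ α γ' α') :=
  ((hv.integrable_gradGamma_mul h.isState.integrable_gamma
      (h'.isState.integrable_gamma.sub h.isState.integrable_gamma)
      (h.integrable_sq_norm_mul_sub h') μ t).add
    (hv.integrable_gradAlpha_mul h.isState.integrable_alpha
      (h'.isState.integrable_alpha.sub h.isState.integrable_alpha) t)).add
  ((((h.memLp_gamma.integrable_mul (h'.memLp_gamma.sub h.memLp_gamma)).add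
    (h.memLp_alpha.integrable_mul (h'.memLp_alpha.sub h.memLp_alpha))).const_mul 2).const_mul ε)

theorem IsKernel.regEnergy_segment (μ ε t s : ℝ) :
    regEnergy v μ ε (fun p => γ p + s * (γ' p - γ p)) (fun p => α p + s * (α' p - α p)) t
      = regEnergy v μ ε γ α t + s * (c₃ * ∫ p, regEnergySlope v μ ε t γ α γ' α' p)
        + s ^ 2 * regEnergyQuad v ε (fun p => γ' p - γ p) (fun p => α' p - α p) := by
  have hs := h.isState
  have hδ := h'.isState.integrable_gamma.sub hs.integrable_gamma
  have hβ := h'.isState.integrable_alpha.sub hs.integrable_alpha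
  have hδ2 := h.integrable_sq_norm_mul_sub h'
  have lδ := h'.memLp_gamma.sub h.memLp_gamma
  have lβ := h'.memLp_alpha.sub h.memLp_alpha
  have hslope : ∫ p, regEnergySlope v μ ε t γ α γ' α' p
      = (∫ p, (gradGamma v μ γ t p * (γ' p - γ p) + gradAlpha v α t p * (α' p - α p)))
        + ε * ∫ p, 2 * (γ p * (γ' p - γ p) + α p * (α' p - α p)) := by
    rw [← integral_const_mul]
    exact integral_add ((hv.integrable_gradGamma_mul hs.integrable_gamma hδ hδ2 μ t).add
      (hv.integrable_gradAlpha_mul hs.integrable_alpha hβ t))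
      ((((h.memLp_gamma.integrable_mul lδ).add
        (h.memLp_alpha.integrable_mul lβ)).const_mul 2).const_mul ε)
  have henergy := hv.energy_add_const_mul hs.integrable_gamma hs.integrable_alpha hδ hβ
    hs.integrable_kinetic hδ2 μ t s
  have hsq := sqNorm_add_const_mul h.memLp_gamma h.memLp_alpha lδ lβ s
  simp only [Pi.sub_apply] at henergy hsq
  rw [regEnergy, henergy, hsq, hslope, regEnergy, regEnergyQuad]
  change _ = _ + _ * (v 0 / 2 * mass (γ' - γ) ^ 2 + 1 / 2 * (interaction v (α' - α) (α' - α)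
    + interaction v (γ' - γ) (γ' - γ)) + ε * sqNorm (γ' - γ) (α' - α))
  change _ + ε * (_ + _ + _ * sqNorm (γ' - γ) (α' - α)) = _
  ring

theorem IsKernel.regEnergy_midpoint_le (μ ε t : ℝ) :
    regEnergy v μ ε (fun p => γ p + 1 / 2 * (γ' p - γ p)) (fun p => α p + 1 / 2 * (α' p - α p)) t
      ≤ (regEnergy v μ ε γ α t + regEnergy v μ ε γ' α' t) / 2
        - ε / 4 * sqNorm (fun p => γ' p - γ p) (fun p => α' p - α p) := by
  have hmid := hv.regEnergy_segment h h' μ ε t (1 / 2)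
  have hend := hv.regEnergy_segment h h' μ ε t 1
  have hquad := hv.mul_sqNorm_le_regEnergyQuad
    (h'.isState.integrable_gamma.sub h.isState.integrable_gamma)
    (h'.isState.integrable_alpha.sub h.isState.integrable_alpha) ε
  simp only [one_mul, add_sub_cancel, one_pow] at hend
  rw [hmid, hend]
  change ε * sqNorm (fun p => γ' p - γ p) (fun p => α' p - α p)
    ≤ regEnergyQuad v ε (fun p => γ' p - γ p) (fun p => α' p - α p) at hquad
  linarith

end Convexity

section Radial

variable {v : Space → ℝ} {M : ℝ} (hv : IsKernel v M)
include hv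

theorem IsKernel.isRadial_potential {f : Space → ℝ}
    (hf : ∀ T : Space ≃ₗᵢ[ℝ] Space, f ∘ T =ᵐ[volume] f) : IsRadial (potential v f) := by
  intro x y hxy
  set T := Submodule.reflection (Submodule.span ℝ {x - y})ᗮ
  have hTx : T x = y := Submodule.reflection_sub hxy
  rw [← hTx, ← hv.potential_comp_isometry]
  exact congrArg (c₃ * ·) (integral_congr_ae ((hf T).mono fun p hp => by simp only [hp]))

variable {μ ε t R : ℝ} {γ α : Space → ℝ} (hε : 0 < ε) (hmin : IsRegMin v μ ε t R γ α)
include hε hmin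

theorem IsRegMin.ae_eq {γ' α' : Space → ℝ} (h' : IsTestState R γ' α')
    (heq : regEnergy v μ ε γ' α' t = regEnergy v μ ε γ α t) :
    γ' =ᵐ[volume] γ ∧ α' =ᵐ[volume] α := by
  have h := hmin.isTestState
  have hmid := hv.regEnergy_midpoint_le h h' μ ε t
  have hle := hmin.le _ _ (h.segment h' (s := 1 / 2) (by norm_num) (by norm_num))
  refine ae_eq_of_sqNorm_sub_eq_zero h.memLp_gamma h.memLp_alpha h'.memLp_gamma h'.memLp_alpha
    (le_antisymm ?_ (sqNorm_nonneg _ _))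
  rw [heq] at hmid
  by_contra! hpos
  linarith [mul_pos hε hpos]

theorem IsRegMin.ae_eq_comp_isometry (T : Space ≃ₗᵢ[ℝ] Space) :
    γ ∘ T =ᵐ[volume] γ ∧ α ∘ T =ᵐ[volume] α :=
  hmin.ae_eq hv hε (hmin.isTestState.comp_isometry T)
    (by simp only [regEnergy, hv.energy_comp_isometry, sqNorm_comp_isometry])

end Radial

theorem nonneg_of_forall_nonneg_add_mul {a b : ℝ} (h : ∀ s, 0 < s → s ≤ 1 → 0 ≤ a + s * b) :
    0 ≤ a := by
  have hlim : Tendsto (fun s : ℝ => a + s * b) (𝓝[>] 0) (𝓝 (a + 0 * b)) :=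
    ((continuous_const.add (continuous_id.mul continuous_const)).tendsto 0).mono_left
      nhdsWithin_le_nhds
  rw [zero_mul, add_zero] at hlim
  refine ge_of_tendsto hlim ?_
  filter_upwards [Ioc_mem_nhdsGT zero_lt_one] with s hs
  exact h s hs.1 hs.2

section EulerLagrange

variable {v : Space → ℝ} {M : ℝ} (hv : IsKernel v M) {μ ε t R : ℝ} {γ α : Space → ℝ}
  (hmin : IsRegMin v μ ε t R γ α)
include hv hmin

theorem IsRegMin.integral_regEnergySlope_nonneg {γ' α' : Space → ℝ} (h' : IsTestState R γ' α') :
    0 ≤ ∫ p, regEnergySlope v μ ε t γ α γ' α' p := by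
  have h := hmin.isTestState
  refine nonneg_of_mul_nonneg_right (nonneg_of_forall_nonneg_add_mul
    (b := regEnergyQuad v ε (fun p => γ' p - γ p) fun p => α' p - α p) fun s h0 h1 => ?_) c₃_pos
  have hle := hmin.le _ _ (h.segment h' h0.le h1)
  rw [hv.regEnergy_segment h h'] at hle
  exact nonneg_of_mul_nonneg_right (by linarith) h0

theorem IsRegMin.ae_regEnergySlope_const_nonneg {g a : ℝ} (hga : Feasible g a) :
    ∀ᵐ p : Space, ‖p‖ ≤ R → 0 ≤ regEnergySlope v μ ε t γ α (fun _ => g) (fun _ => a) p := by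
  classical
  have h := hmin.isTestState
  have hball : MeasurableSet (Metric.closedBall (0 : Space) R) :=
    Metric.isClosed_closedBall.measurableSet
  have hind : ∀ S : Set Space,
      S.indicator (regEnergySlope v μ ε t γ α (fun _ => g) (fun _ => a))
        = regEnergySlope v μ ε t γ α (S.piecewise (fun _ => g) γ) (S.piecewise (fun _ => a) α) := by
    intro S
    ext p
    by_cases hp : p ∈ S <;> simp [regEnergySlope, hp]
  have hint : IntegrableOn (regEnergySlope v μ ε t γ α (fun _ => g) (fun _ => a))
      (Metric.closedBall 0 R) := by
    rw [← integrable_indicator_iff hball, hind]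
    exact hv.integrable_regEnergySlope h (h.piecewise_const hga hball subset_rfl) μ ε t
  have hae := ae_nonneg_restrict_of_forall_setIntegral_nonneg_inter hint fun S hS _ => by
    rw [← integral_indicator (hS.inter hball), hind]
    exact hmin.integral_regEnergySlope_nonneg hv
      (h.piecewise_const hga (hS.inter hball) Set.inter_subset_right)
  filter_upwards [(ae_restrict_iff' hball).1 hae] with p hp hpR
  exact hp (by simpa using hpR)

theorem IsRegMin.ae_isLinearMin (hε : 0 < ε) : ∀ᵐ p : Space, ‖p‖ ≤ R →
    IsLinearMin (gradGamma v μ γ t p) (gradAlpha v α t p) ε (γ p) (α p) := by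
  obtain ⟨D, hDc, hDd⟩ := TopologicalSpace.exists_countable_dense {x : ℝ × ℝ // Feasible x.1 x.2}
  have hall : ∀ᵐ p : Space, ∀ x ∈ D, ‖p‖ ≤ R →
      0 ≤ regEnergySlope v μ ε t γ α (fun _ => x.1.1) (fun _ => x.1.2) p :=
    (ae_ball_iff hDc).2 fun x _ => hmin.ae_regEnergySlope_const_nonneg hv x.2
  filter_upwards [hall] with p hp hpR g a hga
  have hclosed : IsClosed {x : {x : ℝ × ℝ // Feasible x.1 x.2} |
      0 ≤ regEnergySlope v μ ε t γ α (fun _ => x.1.1) (fun _ => x.1.2) p} :=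
    isClosed_le continuous_const (by unfold regEnergySlope; fun_prop)
  have hslope : 0 ≤ regEnergySlope v μ ε t γ α (fun _ => g) (fun _ => a) p :=
    hclosed.closure_subset_iff.2 (fun x hx => hp x hx hpR) (hDd ⟨(g, a), hga⟩)
  have hyoung : 2 * (γ p * (g - γ p) + α p * (a - α p)) ≤ g ^ 2 + a ^ 2 := by
    nlinarith [sq_nonneg (γ p - g), sq_nonneg (α p - a), sq_nonneg (γ p), sq_nonneg (α p)]
  unfold regEnergySlope at hslope
  linarith [mul_le_mul_of_nonneg_left hyoung hε.le]

end EulerLagrange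

/-! ### Existence of regularized minimizers -/

section Lp

variable {X : Type*} [MeasurableSpace X] {ν : Measure X}

theorem norm_sq_eq_integral_sq (f : Lp ℝ 2 ν) : ‖f‖ ^ 2 = ∫ x, f x ^ 2 ∂ν := by
  rw [← real_inner_self_eq_norm_sq, L2.inner_def]
  refine integral_congr_ae (ae_of_all _ fun x => ?_)
  simp [sq]

theorem tendsto_integral_abs_sub_of_tendsto_Lp {q : ENNReal} [Fact (1 ≤ q)] {s : Set X}
    {u : ℕ → Lp ℝ q ν} {f : Lp ℝ q ν} (hu : Tendsto u atTop (𝓝 f)) (hs : ν s ≠ ⊤)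
    (hus : ∀ n, ∀ᵐ x ∂ν, x ∉ s → u n x = 0) (hfs : ∀ᵐ x ∂ν, x ∉ s → f x = 0) :
    Tendsto (fun n => ∫ x, |u n x - f x| ∂ν) atTop (𝓝 0) := by
  have : IsFiniteMeasure (ν.restrict s) := isFiniteMeasure_restrict.2 hs
  have hexp : 0 ≤ 1 / (1 : ENNReal).toReal - 1 / q.toReal := by
    rcases eq_or_ne q ⊤ with rfl | hq
    · simp
    · rw [ENNReal.toReal_one, one_div_one, sub_nonneg]
      exact div_le_one_of_le₀ (by simpa using ENNReal.toReal_mono hq (Fact.out : 1 ≤ q))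
        ENNReal.toReal_nonneg
  set C := (ν.restrict s) Set.univ ^ (1 / (1 : ENNReal).toReal - 1 / q.toReal)
  have hC : C ≠ ⊤ := ENNReal.rpow_ne_top_of_nonneg hexp (measure_ne_top _ _)
  have hlim : Tendsto (fun n => eLpNorm (⇑(u n) - ⇑f) q ν * C) atTop (𝓝 0) := by
    simpa using ENNReal.Tendsto.mul_const ((Lp.tendsto_Lp_iff_tendsto_eLpNorm' u f).1 hu)
      (.inr hC)
  have hnorm : Tendsto (fun n => eLpNorm (⇑(u n) - ⇑f) 1 (ν.restrict s)) atTop (𝓝 0) := by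
    refine tendsto_of_tendsto_of_tendsto_of_le_of_le tendsto_const_nhds hlim
      (fun _ => zero_le) fun n => ?_
    have hmeas := (Lp.aestronglyMeasurable (u n)).sub (Lp.aestronglyMeasurable f)
    refine (eLpNorm_le_eLpNorm_mul_rpow_measure_univ (Fact.out : 1 ≤ q) hmeas.restrict).trans ?_
    gcongr
    exact Measure.restrict_le_self
  refine ((ENNReal.tendsto_toReal ENNReal.zero_ne_top).comp hnorm).congr fun n => ?_
  have hmeas := ((Lp.aestronglyMeasurable (u n)).sub (Lp.aestronglyMeasurable f)).restrict (s := s)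
  rw [Function.comp_apply, eLpNorm_one_eq_lintegral_enorm, ← integral_norm_eq_lintegral_enorm hmeas]
  refine setIntegral_eq_integral_of_ae_compl_eq_zero ?_
  filter_upwards [hus n, hfs] with x hux hfx hxs
  simp [hux hxs, hfx hxs]

end Lp

theorem tendsto_kinetic_of_ae_eq_zero {R : ℝ} {f : ℕ → Space → ℝ} {g : Space → ℝ}
    (hf : ∀ n, Integrable (f n)) (hg : Integrable g)
    (hfR : ∀ n, ∀ᵐ p, p ∉ Metric.closedBall (0 : Space) R → f n p = 0)
    (hgR : ∀ᵐ p, p ∉ Metric.closedBall (0 : Space) R → g p = 0)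
    (h : Tendsto (fun n => ∫ p, |f n p - g p|) atTop (𝓝 0)) :
    Tendsto (fun n => kinetic (f n)) atTop (𝓝 (kinetic g)) := by
  have hball := isCompact_closedBall (0 : Space) R
  have hfi := fun n => integrable_continuous_mul_of_ae_eq_zero (w := fun p : Space => ‖p‖ ^ 2)
    (by fun_prop) (hf n) hball (hfR n)
  have hgi := integrable_continuous_mul_of_ae_eq_zero (w := fun p : Space => ‖p‖ ^ 2)
    (by fun_prop) hg hball hgR
  rw [tendsto_iff_dist_tendsto_zero]
  refine squeeze_zero (fun _ => dist_nonneg) (fun n => ?_)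
    (by simpa using h.const_mul (c₃ * R ^ 2))
  unfold kinetic
  rw [Real.dist_eq, ← mul_sub, ← integral_sub (hfi n) hgi, abs_mul, abs_of_pos c₃_pos, mul_assoc,
    ← integral_const_mul]
  refine mul_le_mul_of_nonneg_left (abs_integral_le_integral_abs.trans
    (integral_mono_ae ((hfi n).sub hgi).abs (((hf n).sub hg).abs.const_mul _) ?_)) c₃_pos.le
  filter_upwards [hfR n, hgR] with p hfp hgp
  rw [← mul_sub, abs_mul, abs_of_nonneg (sq_nonneg ‖p‖)]
  by_cases hp : p ∈ Metric.closedBall (0 : Space) R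
  · exact mul_le_mul_of_nonneg_right
      (pow_le_pow_left₀ (norm_nonneg _) (mem_closedBall_zero_iff.1 hp) 2) (abs_nonneg _)
  · simp [hfp hp, hgp hp]

section LpTestStates

variable {R : ℝ} {f g : Lp ℝ 2 (volume : Measure Space)}

theorem sqNorm_coeFn (f g : Lp ℝ 2 (volume : Measure Space)) :
    sqNorm f g = c₃ * (‖f‖ ^ 2 + ‖g‖ ^ 2) := by
  rw [norm_sq_eq_integral_sq, norm_sq_eq_integral_sq,
    ← integral_add (Lp.memLp f).integrable_sq (Lp.memLp g).integrable_sq]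
  rfl

theorem sqNorm_coeFn_sub (f g f' g' : Lp ℝ 2 (volume : Measure Space)) :
    sqNorm (fun p => f' p - f p) (fun p => g' p - g p) = c₃ * (‖f' - f‖ ^ 2 + ‖g' - g‖ ^ 2) := by
  rw [← sqNorm_coeFn]
  refine congrArg (c₃ * ·) (integral_congr_ae ?_)
  filter_upwards [Lp.coeFn_sub f' f, Lp.coeFn_sub g' g] with p hf hg
  simp only [hf, hg, Pi.sub_apply]

theorem isClosed_feasible : IsClosed {x : ℝ × ℝ | Feasible x.1 x.2} :=
  (isClosed_le continuous_const continuous_fst).inter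
    (isClosed_le (by fun_prop) (by fun_prop) : IsClosed {x : ℝ × ℝ | x.2 ^ 2 ≤ x.1 * (1 + x.1)})

variable {u w : ℕ → Lp ℝ 2 (volume : Measure Space)} (hu : Tendsto u atTop (𝓝 f))
  (hw : Tendsto w atTop (𝓝 g)) (h : ∀ n, IsTestState R (u n) (w n))
include hu hw h

theorem IsTestState.of_tendsto_Lp : IsTestState R f g := by
  obtain ⟨φ, hφ, huφ⟩ := (tendstoInMeasure_of_tendsto_Lp hu).exists_seq_tendsto_ae
  obtain ⟨ψ, hψ, hwψ⟩ :=
    (tendstoInMeasure_of_tendsto_Lp (hw.comp hφ.tendsto_atTop)).exists_seq_tendsto_ae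
  refine ⟨Lp.memLp _, Lp.memLp _, ?_, ?_⟩
  · filter_upwards [huφ, hwψ, ae_all_iff.2 fun n => (h n).support] with p hup hwp hp hR
    refine ⟨tendsto_nhds_unique hup ?_, tendsto_nhds_unique hwp ?_⟩
    · simp only [fun n => (hp n hR).1, tendsto_const_nhds]
    · simp only [Function.comp_apply, fun n => (hp n hR).2, tendsto_const_nhds]
  · filter_upwards [huφ, hwψ, ae_all_iff.2 fun n => (h n).feasible] with p hup hwp hp
    exact isClosed_feasible.mem_of_tendsto ((hup.comp hψ.tendsto_atTop).prodMk_nhds hwp)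
      (Eventually.of_forall fun n => hp (φ (ψ n)))

theorem IsKernel.tendsto_regEnergy_of_tendsto_Lp {v : Space → ℝ} {M : ℝ} (hv : IsKernel v M)
    (μ ε t : ℝ) :
    Tendsto (fun n => regEnergy v μ ε (u n) (w n) t) atTop (𝓝 (regEnergy v μ ε f g t)) := by
  have hball : volume (Metric.closedBall (0 : Space) R) ≠ ⊤ := measure_closedBall_lt_top.ne
  have hfg := IsTestState.of_tendsto_Lp hu hw h
  have hu1 := tendsto_integral_abs_sub_of_tendsto_Lp hu hball
    (fun n => (h n).ae_eq_zero_gamma) hfg.ae_eq_zero_gamma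
  have hw1 := tendsto_integral_abs_sub_of_tendsto_Lp hw hball
    (fun n => (h n).ae_eq_zero_alpha) hfg.ae_eq_zero_alpha
  have hui := fun n => (h n).isState.integrable_gamma
  have hwi := fun n => (h n).isState.integrable_alpha
  have hfi := hfg.isState.integrable_gamma
  have hgi := hfg.isState.integrable_alpha
  have hmass := (tendsto_mass hui hfi hu1).const_add t
  have hkinetic := tendsto_kinetic_of_ae_eq_zero hui hfi (fun n => (h n).ae_eq_zero_gamma)
    hfg.ae_eq_zero_gamma hu1
  have hinteraction :=
    (hv.tendsto_interaction hwi hgi hw1).add (hv.tendsto_interaction hui hfi hu1)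
  have hcoupling := (hv.tendsto_coupling hui hfi hu1).add (hv.tendsto_coupling hwi hgi hw1)
  have hsq : Tendsto (fun n => sqNorm (u n) (w n)) atTop (𝓝 (sqNorm f g)) := by
    simp only [sqNorm_coeFn]
    exact ((hu.norm.pow 2).add (hw.norm.pow 2)).const_mul _
  exact ((((hkinetic.sub (hmass.const_mul μ)).add ((hmass.pow 2).const_mul (v 0 / 2))).add
    (hinteraction.const_mul (1 / 2))).add (hcoupling.const_mul t)).add (hsq.const_mul ε)

end LpTestStates

section Existence

variable {v : Space → ℝ} {M : ℝ} (hv : IsKernel v M)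
include hv

theorem IsKernel.exists_le_energy (μ : ℝ) : ∃ b : ℝ, ∀ γ α t, IsState γ α → 0 ≤ t →
    b ≤ energy v μ γ α t := by
  refine ⟨-((|μ| + 1 / 2 * mass v) ^ 2 / (2 * v 0)), fun γ α t h ht => ?_⟩
  have hle := hv.le_energy h μ ht
  have hkinetic := kinetic_nonneg h.nonneg
  have hv0 := hv.pos
  set D := |μ| + 1 / 2 * mass v
  have hcomplete : v 0 / 2 * (t + mass γ) ^ 2 - D * (t + mass γ) + D ^ 2 / (2 * v 0)
      = (v 0 * (t + mass γ) - D) ^ 2 / (2 * v 0) := by field_simp; ring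
  have hsq : 0 ≤ (v 0 * (t + mass γ) - D) ^ 2 / (2 * v 0) := by positivity
  linarith

theorem IsKernel.exists_isRegMin (μ : ℝ) {t ε : ℝ} (ht : 0 ≤ t) (hε : 0 < ε) (R : ℝ) :
    ∃ γ α, IsRegMin v μ ε t R γ α := by
  obtain ⟨b, hb⟩ := hv.exists_le_energy μ
  let H := Lp ℝ 2 (volume : Measure Space) × Lp ℝ 2 (volume : Measure Space)
  let K : Set H := {x | IsTestState R x.1 x.2}
  let J : H → ℝ := fun x => regEnergy v μ ε x.1 x.2 t
  have hrep : ∀ {δ β : Space → ℝ}, IsTestState R δ β → ∃ m ∈ K, J m = regEnergy v μ ε δ β t :=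
    fun {δ β} h => by
      have hδ := h.memLp_gamma.coeFn_toLp
      have hβ := h.memLp_alpha.coeFn_toLp
      exact ⟨(h.memLp_gamma.toLp, h.memLp_alpha.toLp), h.congr hδ.symm hβ.symm,
        regEnergy_congr hδ hβ v μ ε t⟩
  obtain ⟨x, hx, hmin⟩ : ∃ x ∈ K, IsMinOn J K x := by
    refine exists_isMinOn_of_midpoint (κ := ε / 4 * c₃) ?_ ⟨b, ?_⟩
      (mul_pos (by positivity) c₃_pos) (fun x hx y hy => ?_) fun u x l hu hux hJ => ?_
    · obtain ⟨m, hm, -⟩ := hrep (isTestState_zero R)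
      exact ⟨m, hm⟩
    · rintro _ ⟨x, hx, rfl⟩
      exact (hb _ _ t (IsTestState.isState hx) ht).trans
        (le_add_of_nonneg_right (mul_nonneg hε.le (sqNorm_nonneg _ _)))
    · obtain ⟨m, hm, hmJ⟩ :=
        hrep (IsTestState.segment hx hy (s := 1 / 2) (by norm_num) (by norm_num))
      refine ⟨m, hm, ?_⟩
      rw [hmJ]
      refine (hv.regEnergy_midpoint_le hx hy μ ε t).trans (sub_le_sub_left ?_ _)
      rw [sqNorm_coeFn_sub, mul_assoc, ← norm_neg, neg_sub]
      gcongr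
      · exact c₃_pos.le
      · rcases max_choice ‖(y - x).1‖ ‖(y - x).2‖ with h | h <;> rw [Prod.norm_def, h]
        · exact le_add_of_nonneg_right (sq_nonneg _)
        · exact le_add_of_nonneg_left (sq_nonneg _)
    · have hfst := (continuous_fst.tendsto x).comp hux
      have hsnd := (continuous_snd.tendsto x).comp hux
      exact ⟨.of_tendsto_Lp hfst hsnd hu,
        (tendsto_nhds_unique (hv.tendsto_regEnergy_of_tendsto_Lp hfst hsnd hu μ ε t) hJ).le⟩
  refine ⟨x.1, x.2, hx, fun δ β h => ?_⟩
  obtain ⟨m, hm, hmJ⟩ := hrep h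
  exact hmJ ▸ hmin hm

end Existence

/-! ### Minimizing sequences and a priori bounds -/

theorem IsState.integral_abs_gamma {γ α : Space → ℝ} (h : IsState γ α) :
    ∫ p, |γ p| = ∫ p, γ p :=
  integral_congr_ae (h.nonneg.mono fun _ hp => abs_of_nonneg hp)

/-- The infimum of the energy over all test states and all condensate densities `s ≥ 0`. -/
def groundEnergy (v : Space → ℝ) (μ : ℝ) : ℝ :=
  sInf {e | ∃ R γ α s, IsTestState R γ α ∧ 0 ≤ s ∧ energy v μ γ α s = e}

section CondensateDensity

variable {v : Space → ℝ} {M : ℝ} (hv : IsKernel v M)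
include hv

theorem IsKernel.bddBelow_energy (μ : ℝ) :
    BddBelow {e | ∃ R γ α s, IsTestState R γ α ∧ 0 ≤ s ∧ energy v μ γ α s = e} := by
  obtain ⟨b, hb⟩ := hv.exists_le_energy μ
  exact ⟨b, by rintro _ ⟨R, γ, α, s, h, hs, rfl⟩; exact hb _ _ _ h.isState hs⟩

theorem IsKernel.groundEnergy_le {R : ℝ} {γ α : Space → ℝ} (h : IsTestState R γ α) (μ : ℝ)
    {s : ℝ} (hs : 0 ≤ s) : groundEnergy v μ ≤ energy v μ γ α s :=
  csInf_le (hv.bddBelow_energy μ) ⟨R, γ, α, s, h, hs, rfl⟩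

theorem IsKernel.exists_density_le_of_energy_le (μ E : ℝ) :
    ∃ C : ℝ, ∀ γ α t, IsState γ α → 0 ≤ t → energy v μ γ α t ≤ E →
      t + mass γ ≤ C ∧ kinetic γ ≤ C := by
  set D := |μ| + 1 / 2 * mass v with hD
  set X := |E| + D ^ 2 / v 0 with hX
  have hv0 := hv.pos
  have hX0 : 0 ≤ X := by positivity
  refine ⟨1 + 4 * X / v 0 + X, fun γ α t h ht hE => ?_⟩
  have hle := (hv.le_energy h μ ht).trans (hE.trans (le_abs_self E))
  rw [← hD] at hle
  have hkinetic := kinetic_nonneg h.nonneg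
  set ρ := t + mass γ
  have hcomplete : v 0 / 4 * ρ ^ 2 - D * ρ + D ^ 2 / v 0
      = (v 0 * ρ - 2 * D) ^ 2 / (4 * v 0) := by
    field_simp; ring
  have hsquare : 0 ≤ (v 0 * ρ - 2 * D) ^ 2 / (4 * v 0) := by positivity
  have hsum : kinetic γ + v 0 / 4 * ρ ^ 2 ≤ X := by rw [hX]; linarith
  have hρ0 : 0 ≤ v 0 / 4 * ρ ^ 2 := by positivity
  have hρ : ρ ^ 2 ≤ 4 * X / v 0 := by
    rw [le_div_iff₀ hv0]; linarith
  have hX4 : 0 ≤ 4 * X / v 0 := by positivity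
  constructor
  · nlinarith [sq_nonneg (ρ - 1)]
  · linarith [hsum]

theorem IsKernel.abs_coupling_add_coupling_le {γ α : Space → ℝ} (h : IsState γ α) :
    |coupling v γ + coupling v α| ≤ 2 * M * mass γ + 1 / 2 * mass v := by
  have hγ := hv.integrable_mul h.integrable_gamma
  have hα := hv.integrable_mul h.integrable_alpha
  have hγM := h.integrable_gamma.const_mul (2 * M)
  have hvhalf := hv.integrable.const_mul (1 / 2)
  have hpoint : ∀ᵐ p, |v p * γ p + v p * α p| ≤ 2 * M * γ p + 1 / 2 * v p := by
    filter_upwards [h.nonneg, h.abs_alpha_le] with p hp hpα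
    have hsum : |γ p + α p| ≤ 2 * γ p + 1 / 2 := by
      refine (abs_add_le _ _).trans ?_
      rw [abs_of_nonneg hp]; linarith
    rw [← mul_add, abs_mul, abs_of_nonneg (hv.nonneg p)]
    linarith [mul_le_mul_of_nonneg_left hsum (hv.nonneg p),
      mul_le_mul_of_nonneg_right (hv.le p) hp]
  calc |coupling v γ + coupling v α| = c₃ * |∫ p, (v p * γ p + v p * α p)| := by
        rw [integral_add hγ hα, coupling, coupling, ← mul_add, abs_mul, abs_of_pos c₃_pos]
    _ ≤ c₃ * ∫ p, (2 * M * γ p + 1 / 2 * v p) :=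
        mul_le_mul_of_nonneg_left (abs_integral_le_integral_abs.trans
          (integral_mono_ae (hγ.add hα).abs (hγM.add hvhalf) hpoint)) c₃_pos.le
    _ = 2 * M * mass γ + 1 / 2 * mass v := by
        rw [integral_add hγM hvhalf, integral_const_mul, integral_const_mul, mass, mass]
        ring

theorem IsKernel.energy_le_energy_add {γ α : Space → ℝ} (h : IsState γ α) (μ : ℝ) {s C : ℝ}
    (hs : 0 ≤ s) (hC : s + mass γ ≤ C) (t : ℝ) :
    energy v μ γ α t ≤ energy v μ γ α s
      + |t - s| * (|μ| + v 0 * C + (2 * M * C + 1 / 2 * mass v)) + v 0 / 2 * (t - s) ^ 2 := by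
  have hmass := Bogoliubov.mass_nonneg h.nonneg
  have hslope : |-μ + v 0 * (s + mass γ) + (coupling v γ + coupling v α)|
      ≤ |μ| + v 0 * C + (2 * M * C + 1 / 2 * mass v) := by
    refine (abs_add_three _ _ _).trans (add_le_add_three (abs_neg μ).le ?_ ?_)
    · rw [abs_of_nonneg (mul_nonneg hv.pos.le (by linarith))]
      exact mul_le_mul_of_nonneg_left hC hv.pos.le
    · refine (hv.abs_coupling_add_coupling_le h).trans ?_
      have := mul_le_mul_of_nonneg_left (by linarith : mass γ ≤ C)
        (by linarith [hv.bound_pos] : 0 ≤ 2 * M)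
      linarith
  have hlinear := (le_abs_self _).trans ((abs_mul (t - s) _).trans_le
    (mul_le_mul_of_nonneg_left hslope (abs_nonneg (t - s))))
  have hexpand := energy_add_right v μ γ α s (t - s)
  rw [add_sub_cancel] at hexpand
  linarith

theorem IsKernel.exists_optimal_density (μ : ℝ) : ∃ t : ℝ, 0 ≤ t ∧
    ∀ δ > 0, ∃ R γ α, IsTestState R γ α ∧ energy v μ γ α t < groundEnergy v μ + δ := by
  have hne : {e | ∃ R γ α s, IsTestState R γ α ∧ 0 ≤ s ∧ energy v μ γ α s = e}.Nonempty :=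
    ⟨_, 0, _, _, 0, isTestState_zero 0, le_rfl, rfl⟩
  obtain ⟨u, hu_anti, hu, hu_mem⟩ := exists_seq_tendsto_sInf hne (hv.bddBelow_energy μ)
  choose R γ α s h hs hsu using hu_mem
  obtain ⟨C, hC⟩ := hv.exists_density_le_of_energy_le μ (u 0)
  have hdensity : ∀ n, s n + mass (γ n) ≤ C := fun n =>
    (hC _ _ _ (h n).isState (hs n) ((hsu n).trans_le (hu_anti n.zero_le))).1
  obtain ⟨t, ht, φ, hφ, hφt⟩ := (isCompact_Icc (a := (0 : ℝ)) (b := C)).tendsto_subseq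
    (x := s) fun n => ⟨hs n, by linarith [hdensity n, Bogoliubov.mass_nonneg (h n).isState.nonneg]⟩
  refine ⟨t, ht.1, fun δ hδ => ?_⟩
  have hlim : ∀ a b : ℝ, Tendsto (fun n => u (φ n) + |t - s (φ n)| * a + b * (t - s (φ n)) ^ 2)
      atTop (𝓝 (groundEnergy v μ)) := fun a b => by
    have hdiff : Tendsto (fun n => t - s (φ n)) atTop (𝓝 0) := by simpa using hφt.const_sub t
    have hu' : Tendsto u atTop (𝓝 (groundEnergy v μ)) := hu
    simpa using ((hu'.comp hφ.tendsto_atTop).add (hdiff.abs.mul_const a)).add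
      ((hdiff.pow 2).const_mul b)
  obtain ⟨n, hn⟩ := ((hlim _ _).eventually (gt_mem_nhds (lt_add_of_pos_right _ hδ))).exists
  refine ⟨R (φ n), γ (φ n), α (φ n), h _, lt_of_le_of_lt ?_ hn⟩
  simpa only [hsu] using
    hv.energy_le_energy_add (h (φ n)).isState μ (hs (φ n)) (hdensity (φ n)) t

end CondensateDensity

/-- A minimizing sequence at condensate density `t` that consists of regularized minimizers, with
the regularization being removed. -/
structure IsApproxSeq (v : Space → ℝ) (μ t : ℝ) (R ε : ℕ → ℝ) (γ α : ℕ → Space → ℝ) : Prop where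
  isRegMin : ∀ n, IsRegMin v μ (ε n) t (R n) (γ n) (α n)
  tendsto_R : Tendsto R atTop atTop
  eps_pos : ∀ n, 0 < ε n
  tendsto_eps : Tendsto ε atTop (𝓝 0)
  tendsto_energy : Tendsto (fun n => energy v μ (γ n) (α n) t) atTop (𝓝 (groundEnergy v μ))

section ApproxSeq

variable {v : Space → ℝ} {μ t : ℝ} {R ε : ℕ → ℝ} {γ α : ℕ → Space → ℝ}

theorem IsApproxSeq.isState (h : IsApproxSeq v μ t R ε γ α) (n : ℕ) : IsState (γ n) (α n) :=
  (h.isRegMin n).isTestState.isState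

theorem IsApproxSeq.subseq (h : IsApproxSeq v μ t R ε γ α) {φ : ℕ → ℕ} (hφ : StrictMono φ) :
    IsApproxSeq v μ t (R ∘ φ) (ε ∘ φ) (γ ∘ φ) (α ∘ φ) :=
  ⟨fun _ => h.isRegMin _, h.tendsto_R.comp hφ.tendsto_atTop, fun _ => h.eps_pos _,
    h.tendsto_eps.comp hφ.tendsto_atTop, h.tendsto_energy.comp hφ.tendsto_atTop⟩

end ApproxSeq

section Minimizers

variable {v : Space → ℝ} {M : ℝ} (hv : IsKernel v M)
include hv

theorem IsKernel.exists_isRegMin_energy_lt {μ t : ℝ} (ht : 0 ≤ t)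
    (hopt : ∀ δ > 0, ∃ R γ α, IsTestState R γ α ∧ energy v μ γ α t < groundEnergy v μ + δ)
    {δ : ℝ} (hδ : 0 < δ) (r : ℝ) : ∃ R ε γ α, r ≤ R ∧ 0 < ε ∧ ε ≤ δ ∧
      IsRegMin v μ ε t R γ α ∧ energy v μ γ α t < groundEnergy v μ + 2 * δ := by
  obtain ⟨R, γ', α', h', hlt⟩ := hopt δ hδ
  have hsq := sqNorm_nonneg γ' α'
  set ε := δ / (1 + sqNorm γ' α') with hε
  have hε0 : 0 < ε := by positivity
  have hεsq : ε * (1 + sqNorm γ' α') = δ := by rw [hε]; field_simp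
  obtain ⟨γ, α, hmin⟩ := hv.exists_isRegMin μ ht hε0 (max R r)
  refine ⟨max R r, ε, γ, α, le_max_right _ _, hε0, by nlinarith, hmin, ?_⟩
  have hle := hmin.le _ _ (h'.mono (le_max_left _ _))
  unfold regEnergy at hle
  linarith [mul_nonneg hε0.le (sqNorm_nonneg γ α)]

theorem IsKernel.exists_isApproxSeq (μ : ℝ) :
    ∃ t : ℝ, 0 ≤ t ∧ ∃ R ε γ α, IsApproxSeq v μ t R ε γ α := by
  obtain ⟨t, ht, hopt⟩ := hv.exists_optimal_density μ
  choose R ε γ α hR hε0 hε hmin hlt using fun n : ℕ =>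
    hv.exists_isRegMin_energy_lt ht hopt (Nat.one_div_pos_of_nat (α := ℝ) (n := n)) n
  have hlim := tendsto_one_div_add_atTop_nhds_zero_nat (𝕜 := ℝ)
  refine ⟨t, ht, R, ε, γ, α, hmin, tendsto_atTop_mono hR tendsto_natCast_atTop_atTop, hε0,
    squeeze_zero (fun n => (hε0 n).le) hε hlim,
    tendsto_of_tendsto_of_tendsto_of_le_of_le tendsto_const_nhds ?_
      (fun n => hv.groundEnergy_le (hmin n).isTestState μ ht) fun n => (hlt n).le⟩
  simpa using (hlim.const_mul 2).const_add (groundEnergy v μ)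

theorem IsRegMin.gradGamma_mul_add_gradAlpha_mul_nonpos {μ ε t R : ℝ} {γ α : Space → ℝ}
    (hmin : IsRegMin v μ ε t R γ α) (hε : 0 < ε) :
    ∀ᵐ p, gradGamma v μ γ t p * γ p + gradAlpha v α t p * α p ≤ 0 := by
  filter_upwards [hmin.ae_isLinearMin hv hε, hmin.isTestState.support] with p hlin hsupp
  rcases le_or_gt ‖p‖ R with hR | hR
  · simpa using hlin hR 0 0 feasible_zero
  · simp [hsupp hR]

end Minimizers

theorem Feasible.mul_abs_le {g a A B : ℝ} (h : Feasible g a) (hA : 0 < A) (hB : 2 * |B| ≤ A)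
    (hle : A * g + B * a ≤ 0) : A * |a| ≤ 4 / 3 * |B| := by
  obtain ⟨hg, hga⟩ := h
  have hAg : A * g ≤ |B| * |a| := by
    have := neg_abs_le (B * a)
    rw [abs_mul] at this
    linarith
  rw [← sq_abs] at hga
  rcases (abs_nonneg a).eq_or_lt with ha | ha
  · rw [← ha, mul_zero]; positivity
  have hAa : A ^ 2 * |a| ^ 2 ≤ A * (A * g) + (A * g) ^ 2 := by nlinarith [sq_nonneg A]
  have hlin : A * (A * g) ≤ A * (|B| * |a|) := mul_le_mul_of_nonneg_left hAg hA.le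
  have hquad : (A * g) ^ 2 ≤ (A / 2 * |a|) ^ 2 := pow_le_pow_left₀ (by positivity)
    (hAg.trans (mul_le_mul_of_nonneg_right (by linarith) ha.le)) 2
  have hcancel : (A * |a|) * (A * |a|) ≤ (A * |a|) * (4 / 3 * |B|) := by nlinarith
  exact le_of_mul_le_mul_left hcancel (by positivity)

/-- The momenta of modulus at least `r`. -/
def tail (r : ℝ) : Set Space := {p | r ≤ ‖p‖}

theorem measurableSet_tail (r : ℝ) : MeasurableSet (tail r) :=
  (isClosed_le continuous_const continuous_norm).measurableSet

theorem compl_tail (r : ℝ) : (tail r)ᶜ = Metric.ball (0 : Space) r := by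
  ext p; simp [tail]

theorem setIntegral_tail_le {f : Space → ℝ} (h0 : ∀ᵐ p, 0 ≤ f p) (hf : Integrable f)
    (hk : Integrable fun p : Space => ‖p‖ ^ 2 * f p) {r : ℝ} (hr : 0 < r) :
    ∫ p in tail r, f p ≤ (∫ p : Space, ‖p‖ ^ 2 * f p) / r ^ 2 := by
  rw [le_div_iff₀ (by positivity), ← integral_mul_const,
    ← integral_indicator (measurableSet_tail r)]
  refine integral_mono_ae ((hf.mul_const _).indicator (measurableSet_tail r)) hk
    (h0.mono fun p hp => Set.indicator_apply_le' (fun hpr => ?_) fun _ => by positivity)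
  rw [mul_comm]
  exact mul_le_mul_of_nonneg_right (pow_le_pow_left₀ hr.le hpr 2) hp

theorem IsState.setIntegral_abs_alpha_le {γ α : Space → ℝ} (h : IsState γ α) {s : Set Space}
    (hs : volume s ≠ ⊤) : ∫ p in s, |α p| ≤ (∫ p, |γ p|) + 1 / 2 * volume.real s := by
  have hγ : IntegrableOn (fun p => |γ p|) s := h.integrable_gamma.abs.integrableOn
  calc ∫ p in s, |α p| ≤ ∫ p in s, (|γ p| + 1 / 2) :=
        integral_mono_ae h.integrable_alpha.abs.integrableOn (hγ.add (integrableOn_const hs))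
          (ae_restrict_of_ae (h.abs_alpha_le.mono fun p hp =>
            hp.trans (add_le_add_left (le_abs_self _) _)))
    _ = (∫ p in s, |γ p|) + 1 / 2 * volume.real s := by
        rw [integral_add hγ (integrableOn_const hs), setIntegral_const, smul_eq_mul, mul_comm]
    _ ≤ (∫ p, |γ p|) + 1 / 2 * volume.real s :=
        add_le_add_left (setIntegral_le_integral h.integrable_gamma.abs
          (ae_of_all _ fun _ => abs_nonneg _)) _

section GradientBounds

variable {v : Space → ℝ} {M : ℝ} (hv : IsKernel v M)
include hv

theorem IsKernel.integrable_sub_mul_prod {f : Space → ℝ} (hf : Integrable f) :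
    Integrable (fun z : Space × Space => v (z.1 - z.2) * f z.2) (volume.prod volume) :=
  (hf.convolution_integrand (ContinuousLinearMap.mul ℝ ℝ) hv.integrable).congr
    (ae_of_all _ fun _ => mul_comm _ _)

theorem IsKernel.integrable_potential {f : Space → ℝ} (hf : Integrable f) :
    Integrable (potential v f) :=
  (hv.integrable_sub_mul_prod hf).integral_prod_left.const_mul c₃

theorem IsKernel.integral_potential {f : Space → ℝ} (hf : Integrable f) :
    ∫ p, potential v f p = mass v * ∫ p, f p := by
  unfold potential mass
  rw [integral_const_mul, integral_integral_swap (hv.integrable_sub_mul_prod hf), mul_assoc,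
    ← integral_const_mul (∫ q, v q)]
  simp only [integral_mul_const, integral_sub_right_eq_self v]

theorem IsKernel.abs_gradAlpha_le (α : Space → ℝ) {t : ℝ} (ht : 0 ≤ t) (p : Space) :
    |gradAlpha v α t p| ≤ potential v (fun q => |α q|) p + t * v p := by
  refine (abs_add_le _ _).trans (add_le_add ?_ (abs_of_nonneg (mul_nonneg ht (hv.nonneg p))).le)
  rw [potential, abs_mul, abs_of_pos c₃_pos]
  refine mul_le_mul_of_nonneg_left (abs_integral_le_integral_abs.trans_eq ?_) c₃_pos.le
  simp only [abs_mul, abs_of_nonneg (hv.nonneg _)]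

theorem IsKernel.integral_abs_gradAlpha_le {α : Space → ℝ} (hα : Integrable α) {t : ℝ}
    (ht : 0 ≤ t) : ∫ p, |gradAlpha v α t p| ≤ mass v * (∫ p, |α p|) + t * ∫ p, v p := by
  have hpot := hv.integrable_potential hα.abs
  have hcond := hv.integrable.const_mul t
  rw [← hv.integral_potential hα.abs, ← integral_const_mul, ← integral_add hpot hcond]
  exact integral_mono_of_nonneg (ae_of_all _ fun _ => abs_nonneg _) (hpot.add hcond)
    (ae_of_all _ fun p => hv.abs_gradAlpha_le α ht p)

theorem IsKernel.integrable_gradAlpha {α : Space → ℝ} (hα : Integrable α) (t : ℝ) :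
    Integrable (gradAlpha v α t) :=
  (hv.integrable_potential hα).add (hv.integrable.const_mul t)

variable {γ α : Space → ℝ} (h : IsState γ α) {μ t : ℝ} (ht : 0 ≤ t)
include h

theorem IsKernel.potential_abs_le (p : Space) :
    potential v (fun q => |α q|) p ≤ M * mass γ + 1 / 2 * mass v := by
  have hγM := h.integrable_gamma.const_mul M
  have hvhalf : Integrable fun q => 1 / 2 * v (p - q) :=
    (hv.integrable.comp_sub_left p).const_mul (1 / 2)
  have hpoint : ∀ᵐ q, v (p - q) * |α q| ≤ M * γ q + 1 / 2 * v (p - q) := by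
    filter_upwards [h.nonneg, h.abs_alpha_le] with q hq hqα
    linarith [mul_le_mul_of_nonneg_left hqα (hv.nonneg (p - q)),
      mul_le_mul_of_nonneg_right (hv.le (p - q)) hq]
  calc potential v (fun q => |α q|) p ≤ c₃ * ∫ q, (M * γ q + 1 / 2 * v (p - q)) :=
        mul_le_mul_of_nonneg_left (integral_mono_ae
          (hv.integrable_sub_mul h.integrable_alpha.abs p) (hγM.add hvhalf) hpoint) c₃_pos.le
    _ = M * mass γ + 1 / 2 * mass v := by
        rw [integral_add hγM hvhalf, integral_const_mul, integral_const_mul,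
          integral_sub_left_eq_self, mass, mass]
        ring

include ht

theorem IsKernel.abs_gradAlpha_le_const (p : Space) :
    |gradAlpha v α t p| ≤ M * (t + mass γ) + 1 / 2 * mass v := by
  linarith [hv.abs_gradAlpha_le α ht p, hv.potential_abs_le h p,
    mul_le_mul_of_nonneg_left (hv.le p) ht]

theorem IsKernel.le_gradGamma (μ : ℝ) (p : Space) : ‖p‖ ^ 2 - μ ≤ gradGamma v μ γ t p := by
  unfold gradGamma
  linarith [hv.potential_nonneg h.nonneg p, mul_nonneg ht (hv.nonneg p),
    mul_nonneg hv.pos.le (add_nonneg ht (Bogoliubov.mass_nonneg h.nonneg))]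

variable (hEL : ∀ᵐ p, gradGamma v μ γ t p * γ p + gradAlpha v α t p * α p ≤ 0) {r : ℝ}
  (hr : 0 < r)
include hEL hr

theorem IsKernel.setIntegral_tail_abs_alpha_le
    (hr2 : 2 * |μ| + 4 * (M * (t + mass γ) + 1 / 2 * mass v) ≤ r ^ 2) :
    ∫ p in tail r, |α p| ≤ 3 / r ^ 2 * (mass v * (∫ p, |α p|) + t * ∫ p, v p) := by
  have hrpos : 0 < r ^ 2 := by positivity
  have hbound : 0 ≤ M * (t + mass γ) + 1 / 2 * mass v :=
    (abs_nonneg _).trans (hv.abs_gradAlpha_le_const h ht 0)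
  have hpoint : ∀ᵐ p, (tail r).indicator (fun p => |α p|) p
      ≤ 3 / r ^ 2 * |gradAlpha v α t p| := by
    filter_upwards [h.feasible, hEL] with p hp hE
    refine Set.indicator_apply_le' (fun hpr => ?_) fun _ => by positivity
    have hpr2 : r ^ 2 ≤ ‖p‖ ^ 2 := pow_le_pow_left₀ hr.le hpr 2
    have hA : r ^ 2 / 2 ≤ gradGamma v μ γ t p := by
      linarith [hv.le_gradGamma h ht μ p, le_abs_self μ]
    have hα := hp.mul_abs_le (by linarith)
      (by linarith [hv.abs_gradAlpha_le_const h ht p, abs_nonneg μ]) hE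
    rw [div_mul_eq_mul_div, le_div_iff₀ hrpos]
    linarith [abs_nonneg (gradAlpha v α t p), mul_le_mul_of_nonneg_right hA (abs_nonneg (α p))]
  calc ∫ p in tail r, |α p| ≤ ∫ p, 3 / r ^ 2 * |gradAlpha v α t p| := by
        rw [← integral_indicator (measurableSet_tail r)]
        exact integral_mono_ae (h.integrable_alpha.abs.indicator (measurableSet_tail r))
          ((hv.integrable_gradAlpha h.integrable_alpha t).abs.const_mul _) hpoint
    _ ≤ 3 / r ^ 2 * (mass v * (∫ p, |α p|) + t * ∫ p, v p) := by
        rw [integral_const_mul]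
        exact mul_le_mul_of_nonneg_left (hv.integral_abs_gradAlpha_le h.integrable_alpha ht)
          (by positivity)

theorem IsKernel.integral_abs_alpha_le
    (hr2 : 2 * |μ| + 4 * (M * (t + mass γ) + 1 / 2 * mass v) ≤ r ^ 2)
    (hr6 : 6 * mass v ≤ r ^ 2) :
    ∫ p, |α p| ≤ 2 * ((∫ p, |γ p|) + 1 / 2 * volume.real (Metric.ball (0 : Space) r)
      + 3 / r ^ 2 * (t * ∫ p, v p)) := by
  have htail := hv.setIntegral_tail_abs_alpha_le h ht hEL hr hr2
  have hball := h.setIntegral_abs_alpha_le (s := Metric.ball (0 : Space) r)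
    measure_ball_lt_top.ne
  have hsplit := integral_add_compl (measurableSet_tail r) h.integrable_alpha.abs
  rw [compl_tail] at hsplit
  have habsorb : 3 / r ^ 2 * (mass v * ∫ p, |α p|) ≤ 1 / 2 * ∫ p, |α p| := by
    rw [← mul_assoc]
    refine mul_le_mul_of_nonneg_right ?_ (integral_nonneg fun _ => abs_nonneg _)
    rw [div_mul_eq_mul_div, div_le_iff₀ (by positivity)]
    linarith
  rw [mul_add] at htail
  linarith

end GradientBounds

/-- A priori bounds on a state `(γ, α)` at condensate density `t`, with tails of order `r⁻²` for
radii `r ≥ r₀`. -/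
structure HasBounds (C r₀ t : ℝ) (γ α : Space → ℝ) : Prop where
  add_mass_le : t + mass γ ≤ C
  integral_abs_gamma_le : ∫ p, |γ p| ≤ C
  integral_sq_norm_mul_gamma_le : ∫ p : Space, ‖p‖ ^ 2 * γ p ≤ C
  integral_abs_alpha_le : ∫ p, |α p| ≤ C
  tail_gamma_le : ∀ r, r₀ ≤ r → ∫ p in tail r, |γ p| ≤ C / r ^ 2
  tail_alpha_le : ∀ r, r₀ ≤ r → ∫ p in tail r, |α p| ≤ C / r ^ 2

theorem IsKernel.exists_integral_le {v : Space → ℝ} {M : ℝ} (hv : IsKernel v M) (μ E : ℝ) {t : ℝ}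
    (ht : 0 ≤ t) : ∃ C r₀ : ℝ, 1 ≤ r₀ ∧ ∀ γ α, IsState γ α → energy v μ γ α t ≤ E →
      (∀ᵐ p, gradGamma v μ γ t p * γ p + gradAlpha v α t p * α p ≤ 0) →
      t + mass γ ≤ C ∧ ∫ p, |γ p| ≤ C ∧ ∫ p : Space, ‖p‖ ^ 2 * γ p ≤ C ∧ ∫ p, |α p| ≤ C ∧
      2 * |μ| + 4 * (M * (t + mass γ) + 1 / 2 * mass v) ≤ r₀ := by
  obtain ⟨C₀, hC₀⟩ := hv.exists_density_le_of_energy_le μ E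
  have hM := hv.bound_pos
  have hmv := hv.mass_nonneg
  set r₀ := 1 + (2 * |μ| + 4 * (M * |C₀| + 1 / 2 * mass v) + 6 * mass v) with hr₀_def
  have hr₀ : 1 ≤ r₀ := le_add_of_nonneg_right (by positivity)
  have hsq : r₀ ≤ r₀ ^ 2 := le_self_pow₀ hr₀ two_ne_zero
  set Y := 2 * (|C₀| / c₃ + 1 / 2 * volume.real (Metric.ball (0 : Space) r₀)
    + 3 / r₀ ^ 2 * (t * ∫ p, v p)) with hY
  refine ⟨max (max |C₀| (|C₀| / c₃)) Y, r₀, hr₀, fun γ α h hE hEL => ?_⟩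
  obtain ⟨hdensity, hkinetic⟩ := hC₀ γ α t h ht hE
  have hdensity : t + mass γ ≤ |C₀| := hdensity.trans (le_abs_self C₀)
  have hγ : ∫ p, |γ p| ≤ |C₀| / c₃ := by
    rw [h.integral_abs_gamma, le_div_iff₀' c₃_pos]
    exact (le_add_of_nonneg_left ht).trans hdensity
  have hkin : ∫ p : Space, ‖p‖ ^ 2 * γ p ≤ |C₀| / c₃ := by
    rw [le_div_iff₀' c₃_pos]
    exact hkinetic.trans (le_abs_self C₀)
  have hr : 2 * |μ| + 4 * (M * (t + mass γ) + 1 / 2 * mass v) + 6 * mass v ≤ r₀ := by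
    linarith [mul_le_mul_of_nonneg_left hdensity hM.le]
  have hpos : 0 ≤ 2 * |μ| + 4 * (M * (t + mass γ) + 1 / 2 * mass v) := by
    have := Bogoliubov.mass_nonneg h.nonneg
    positivity
  have hα : ∫ p, |α p| ≤ Y := by
    refine (hv.integral_abs_alpha_le h ht hEL (zero_lt_one.trans_le hr₀) (by linarith)
      (by linarith)).trans ?_
    rw [hY]
    gcongr
  exact ⟨le_max_of_le_left (le_max_of_le_left hdensity),
    le_max_of_le_left (le_max_of_le_right hγ), le_max_of_le_left (le_max_of_le_right hkin),
    le_max_of_le_right hα, by linarith⟩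

theorem IsKernel.exists_hasBounds {v : Space → ℝ} {M : ℝ} (hv : IsKernel v M) (μ E : ℝ) {t : ℝ}
    (ht : 0 ≤ t) : ∃ C r₀ : ℝ, ∀ γ α, IsState γ α → energy v μ γ α t ≤ E →
      (∀ᵐ p, gradGamma v μ γ t p * γ p + gradAlpha v α t p * α p ≤ 0) →
      HasBounds C r₀ t γ α := by
  obtain ⟨C, r₀, hr₀, hC⟩ := hv.exists_integral_le μ E ht
  set K := 3 * (mass v * C + t * ∫ p, v p)
  refine ⟨max C K, r₀, fun γ α h hE hEL => ?_⟩
  obtain ⟨hmass, hγ, hkin, hα, hradius⟩ := hC γ α h hE hEL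
  refine ⟨le_max_of_le_left hmass, le_max_of_le_left hγ, le_max_of_le_left hkin,
    le_max_of_le_left hα, fun r hr => ?_, fun r hr => ?_⟩
  · rw [integral_congr_ae (ae_restrict_of_ae (h.nonneg.mono fun p hp => abs_of_nonneg hp))]
    exact (setIntegral_tail_le h.nonneg h.integrable_gamma h.integrable_kinetic
      (by linarith)).trans (div_le_div_of_nonneg_right (le_max_of_le_left hkin) (sq_nonneg r))
  · have hsq : r ≤ r ^ 2 := le_self_pow₀ (hr₀.trans hr) two_ne_zero
    refine (hv.setIntegral_tail_abs_alpha_le h ht hEL (by linarith) (by linarith)).trans ?_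
    rw [div_mul_eq_mul_div]
    refine div_le_div_of_nonneg_right (le_max_of_le_right ?_) (sq_nonneg r)
    exact mul_le_mul_of_nonneg_left (add_le_add_left
      (mul_le_mul_of_nonneg_left hα hv.mass_nonneg) _) (by norm_num)

theorem IsApproxSeq.exists_hasBounds {v : Space → ℝ} {M μ t : ℝ} {R ε : ℕ → ℝ}
    {γ α : ℕ → Space → ℝ} (h : IsApproxSeq v μ t R ε γ α) (hv : IsKernel v M) (ht : 0 ≤ t) :
    ∃ C r₀ : ℝ, ∀ n, HasBounds C r₀ t (γ n) (α n) := by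
  obtain ⟨E, hE⟩ := h.tendsto_energy.bddAbove_range
  obtain ⟨C, r₀, hb⟩ := hv.exists_hasBounds μ E ht
  exact ⟨C, r₀, fun n => hb _ _ (h.isState n) (hE ⟨n, rfl⟩)
    ((h.isRegMin n).gradGamma_mul_add_gradAlpha_mul_nonpos hv (h.eps_pos n))⟩

/-! ### Limits of the gradients -/

theorem exists_subseq_tendsto_of_equicontinuous {X F : Type*} [TopologicalSpace X]
    [TopologicalSpace.SeparableSpace X] [PseudoMetricSpace F] {f : ℕ → X → F}
    (hf : Equicontinuous f) {K : Set F} (hK : IsCompact K) (hfK : ∀ n x, f n x ∈ K) :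
    ∃ φ : ℕ → ℕ, StrictMono φ ∧ ∃ g : X → F, ∀ x, Tendsto (fun n => f (φ n) x) atTop (𝓝 (g x)) := by
  rcases isEmpty_or_nonempty X with hX | hX
  · exact ⟨id, strictMono_id, isEmptyElim, isEmptyElim⟩
  obtain ⟨D, hD⟩ := TopologicalSpace.exists_dense_seq X
  obtain ⟨a, -, φ, hφ, ha⟩ := (isCompact_univ_pi fun _ : ℕ => hK).tendsto_subseq
    (x := fun n k => f n (D k)) fun n k _ => hfK n (D k)
  rw [tendsto_pi_nhds] at ha
  have hcauchy : ∀ x, CauchySeq fun n => f (φ n) x := fun x => by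
    refine Metric.cauchySeq_iff.2 fun e he => ?_
    obtain ⟨_, hk, k, rfl⟩ := mem_closure_iff_nhds.1 (hD x) _
      (Metric.equicontinuousAt_iff_right.1 (hf x) (e / 3) (by positivity))
    obtain ⟨N, hN⟩ := Metric.cauchySeq_iff.1 (ha k).cauchySeq (e / 3) (by positivity)
    refine ⟨N, fun m hm n hn => ?_⟩
    have hleft : dist (f (φ m) x) (f (φ m) (D k)) < e / 3 := hk (φ m)
    have hright : dist (f (φ n) (D k)) (f (φ n) x) < e / 3 := by
      rw [dist_comm]; exact hk (φ n)
    have hmiddle : dist (f (φ m) (D k)) (f (φ n) (D k)) < e / 3 := hN m hm n hn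
    linarith [dist_triangle4 (f (φ m) x) (f (φ m) (D k)) (f (φ n) (D k)) (f (φ n) x)]
  have hlim : ∀ x, ∃ y, Tendsto (fun n => f (φ n) x) atTop (𝓝 y) := fun x =>
    let ⟨y, _, hy⟩ := cauchySeq_tendsto_of_isComplete hK.isComplete (fun n => hfK (φ n) x)
      (hcauchy x)
    ⟨y, hy⟩
  choose g hg using hlim
  exact ⟨φ, hφ, g, hg⟩

section LinearMin

variable {A B e g a : ℕ → ℝ} {A₀ B₀ g₀ a₀ : ℝ}

theorem isCompact_feasible_le (K : ℝ) : IsCompact {x : ℝ × ℝ | Feasible x.1 x.2 ∧ x.1 ≤ K} := by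
  refine (isCompact_Icc (a := ((0, -(K + 1 / 2)) : ℝ × ℝ)) (b := (K, K + 1 / 2))).of_isClosed_subset
    (isClosed_feasible.inter (isClosed_le continuous_fst continuous_const)) ?_
  rintro ⟨x, y⟩ ⟨h, hx⟩
  have hy := abs_le.1 (h.abs_le.trans (add_le_add_left hx (1 / 2)))
  exact ⟨⟨h.1, hy.1⟩, ⟨hx, hy.2⟩⟩

theorem Feasible.sub_abs_mul_le {A B g a : ℝ} (h : Feasible g a) (hle : A * g + B * a ≤ 0) :
    (A - |B|) * g ≤ |B| / 2 := by
  have hBa := neg_abs_le (B * a)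
  rw [abs_mul] at hBa
  linarith [mul_le_mul_of_nonneg_left h.abs_le (abs_nonneg B)]

theorem IsLinearMin.mul_add_mul_nonpos {A B ε g a : ℝ} (h : IsLinearMin A B ε g a) :
    A * g + B * a ≤ 0 := by
  simpa using h 0 0 feasible_zero

theorem IsLinearMin.of_tendsto (hA : Tendsto A atTop (𝓝 A₀)) (hB : Tendsto B atTop (𝓝 B₀))
    (he : Tendsto e atTop (𝓝 0)) (hg : Tendsto g atTop (𝓝 g₀)) (ha : Tendsto a atTop (𝓝 a₀))
    (h : ∀ᶠ n in atTop, IsLinearMin (A n) (B n) (e n) (g n) (a n)) :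
    IsLinearMin A₀ B₀ 0 g₀ a₀ := fun x y hxy =>
  le_of_tendsto_of_tendsto ((hA.mul hg).add (hB.mul ha))
    (((hA.mul_const x).add (hB.mul_const y)).add (he.mul_const (x ^ 2 + y ^ 2)))
    (h.mono fun _ hn => hn x y hxy)

theorem IsLinearMin.le_sub_abs_mul_abs {A B g a x y : ℝ} (h : IsLinearMin A B 0 g a)
    (hxy : Feasible x y) : A * g + B * a ≤ A * x - |B| * |y| := by
  rw [← abs_mul]
  rcases abs_choice (B * y) with hBy | hBy
  · linarith [h x (-y) hxy.neg]
  · linarith [h x y hxy]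

theorem not_isLinearMin_of_le_abs {A B g a : ℝ} (hA : 0 < A) (hAB : A ≤ |B|)
    (hga : Feasible g a) : ¬ IsLinearMin A B 0 g a := fun hmin => by
  obtain ⟨hg, ha⟩ := hga
  set s := √((g + 1) * (1 + (g + 1)))
  have habs : |a| < g + 1 / 2 := abs_lt_of_sq_lt_sq (by linarith) (by linarith)
  have has : |a| + 1 < s := Real.lt_sqrt_of_sq_lt (by nlinarith [sq_abs a])
  have hcomp := hmin.le_sub_abs_mul_abs (x := g + 1) (y := s)
    ⟨by linarith, (Real.sq_sqrt (by positivity)).le⟩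
  rw [abs_of_nonneg (Real.sqrt_nonneg _)] at hcomp
  have hBa := neg_abs_le (B * a)
  rw [abs_mul] at hBa
  linarith [mul_lt_mul_of_pos_left has (hA.trans_le hAB)]

/-- The `γ`-component of the minimizer of `A g + B a` over feasible pairs, for `|B| < A`. -/
def linearMinGamma (A B : ℝ) : ℝ := A / (2 * √(A ^ 2 - B ^ 2)) - 1 / 2

/-- The `α`-component of the minimizer of `A g + B a` over feasible pairs, for `|B| < A`. -/
def linearMinAlpha (A B : ℝ) : ℝ := -B / (2 * √(A ^ 2 - B ^ 2))

theorem feasible_linearMin {A B : ℝ} (h : |B| < A) :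
    Feasible (linearMinGamma A B) (linearMinAlpha A B) := by
  have hA : 0 < A := (abs_nonneg B).trans_lt h
  have hd : 0 < A ^ 2 - B ^ 2 := sub_pos.2 (sq_lt_sq.2 (h.trans_le (le_abs_self A)))
  have hS := Real.sqrt_pos.2 hd
  have hSsq := Real.sq_sqrt hd.le
  unfold linearMinGamma linearMinAlpha
  set S := √(A ^ 2 - B ^ 2)
  have hSA : S ≤ A := le_of_sq_le_sq (by linarith [sq_nonneg B]) hA.le
  refine ⟨?_, le_of_eq ?_⟩
  · rw [sub_nonneg, div_le_div_iff₀ two_pos (by positivity)]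
    linarith
  · field_simp
    linear_combination hSsq

/- In the rotated variables `X = A (g + 1/2) + B a` and `Y = A a + B (g + 1/2)` the constraint reads
`X² - Y² ≥ (A² - B²) / 4`, and the objective is `X - A / 2`. -/
theorem Feasible.le_sq_sub_sq {A B g a : ℝ} (hga : Feasible g a) (h : B ^ 2 ≤ A ^ 2) :
    (A ^ 2 - B ^ 2) / 4 ≤ (A * (g + 1 / 2) + B * a) ^ 2 - (A * a + B * (g + 1 / 2)) ^ 2 := by
  have hprod : 0 ≤ (A ^ 2 - B ^ 2) * (g * (1 + g) - a ^ 2) :=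
    mul_nonneg (sub_nonneg.2 h) (sub_nonneg.2 hga.2)
  linarith

theorem IsLinearMin.eq_linearMin {A B g a : ℝ} (hmin : IsLinearMin A B 0 g a)
    (hga : Feasible g a) (h : |B| < A) : g = linearMinGamma A B ∧ a = linearMinAlpha A B := by
  have hA : 0 < A := (abs_nonneg B).trans_lt h
  have hd : 0 < A ^ 2 - B ^ 2 := sub_pos.2 (sq_lt_sq.2 (h.trans_le (le_abs_self A)))
  have hS := Real.sqrt_pos.2 hd
  have hSsq := Real.sq_sqrt hd.le
  have hcomp := hmin _ _ (feasible_linearMin h)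
  unfold linearMinGamma linearMinAlpha at hcomp ⊢
  set S := √(A ^ 2 - B ^ 2)
  set X := A * (g + 1 / 2) + B * a with hX
  set Y := A * a + B * (g + 1 / 2) with hY
  have hvalue : A * (A / (2 * S) - 1 / 2) + B * (-B / (2 * S)) = S / 2 - A / 2 := by
    field_simp
    linear_combination -hSsq
  have hXle : X ≤ S / 2 := by linarith
  have hX0 : 0 ≤ X := by
    have hBa := neg_abs_le (B * a)
    rw [abs_mul] at hBa
    linarith [mul_le_mul h.le hga.abs_le (abs_nonneg a) hA.le]
  have hXY : S ^ 2 / 4 ≤ X ^ 2 - Y ^ 2 := hSsq ▸ hga.le_sq_sub_sq (sub_nonneg.1 hd.le)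
  have hXsq : X ^ 2 ≤ (S / 2) ^ 2 := pow_le_pow_left₀ hX0 hXle 2
  have hYzero : Y = 0 := pow_eq_zero_iff two_ne_zero |>.1 (by linarith [sq_nonneg Y])
  have hXeq : X = S / 2 := hXle.antisymm
    (le_of_sq_le_sq (by linarith [sq_nonneg Y]) hX0)
  have hinv : S ^ 2 * (g + 1 / 2) = A * X - B * Y ∧ S ^ 2 * a = A * Y - B * X := by
    rw [hSsq, hX, hY]; constructor <;> ring
  rw [hYzero, hXeq] at hinv
  constructor
  · rw [eq_sub_iff_add_eq, eq_div_iff (by positivity)]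
    exact mul_left_cancel₀ hS.ne' (by linear_combination 2 * hinv.1)
  · rw [eq_div_iff (by positivity)]
    exact mul_left_cancel₀ hS.ne' (by linear_combination 2 * hinv.2)

variable (hA : Tendsto A atTop (𝓝 A₀)) (hB : Tendsto B atTop (𝓝 B₀)) (he : Tendsto e atTop (𝓝 0))
  (hga : ∀ n, Feasible (g n) (a n))
  (hmin : ∀ᶠ n in atTop, IsLinearMin (A n) (B n) (e n) (g n) (a n))
include hA hB he hga hmin

theorem tendsto_atTop_of_isLinearMin (hA₀ : 0 < A₀) (hle : A₀ ≤ |B₀|) :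
    Tendsto g atTop atTop := by
  by_contra hnot
  obtain ⟨K, hK⟩ : ∃ K, ∃ᶠ n in atTop, g n ≤ K := by
    simp only [tendsto_atTop, not_forall, not_eventually, not_le] at hnot
    exact hnot.imp fun K hK => hK.mono fun _ => le_of_lt
  obtain ⟨x, hx, φ, hφ, hlim⟩ := (isCompact_feasible_le K).tendsto_subseq'
    (x := fun n => (g n, a n)) (hK.mono fun n hn => ⟨hga n, hn⟩)
  have hφ' := hφ.tendsto_atTop
  exact not_isLinearMin_of_le_abs hA₀ hle hx.1 (.of_tendsto (hA.comp hφ') (hB.comp hφ')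
    (he.comp hφ') hlim.fst_nhds hlim.snd_nhds (hφ'.eventually hmin))

theorem tendsto_linearMin_of_isLinearMin (hlt : |B₀| < A₀) :
    Tendsto g atTop (𝓝 (linearMinGamma A₀ B₀)) ∧ Tendsto a atTop (𝓝 (linearMinAlpha A₀ B₀)) := by
  set d := (A₀ - |B₀|) / 2
  have hd0 : 0 < d := half_pos (sub_pos.2 hlt)
  have hbdd : ∀ᶠ n in atTop, g n ≤ (|B₀| + 1) / 2 / d := by
    filter_upwards [hmin, (hA.sub hB.abs).eventually (lt_mem_nhds (half_lt_self (sub_pos.2 hlt))),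
      hB.abs.eventually (gt_mem_nhds (lt_add_one |B₀|))] with n hn hgap hBn
    have hdg : d * g n ≤ (A n - |B n|) * g n := mul_le_mul_of_nonneg_right hgap.le (hga n).1
    rw [le_div_iff₀ hd0, mul_comm]
    linarith [(hga n).sub_abs_mul_le hn.mul_add_mul_nonpos]
  have hpair : Tendsto (fun n => (g n, a n)) atTop
      (𝓝 (linearMinGamma A₀ B₀, linearMinAlpha A₀ B₀)) := by
    refine (isCompact_feasible_le _).tendsto_nhds_of_unique_mapClusterPt
      (hbdd.mono fun n hn => ⟨hga n, hn⟩) fun x hx hcluster => ?_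
    obtain ⟨φ, hφ, hlim⟩ := hcluster.tendsto_subseq
    have hφ' := hφ.tendsto_atTop
    exact Prod.ext_iff.2 (IsLinearMin.eq_linearMin (.of_tendsto (hA.comp hφ') (hB.comp hφ')
      (he.comp hφ') hlim.fst_nhds hlim.snd_nhds (hφ'.eventually hmin)) hx.1 hlt)
  exact ⟨hpair.fst_nhds, hpair.snd_nhds⟩

end LinearMin

section GradBounds

/-- A common bound for `gradAlpha v f t`, its Lipschitz constant and its second differences,
valid when `∫ |f| ≤ C`. -/
def gradBound (M C t : ℝ) : ℝ := c₃ * M * C + t * M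

theorem gradGamma_eq (v : Space → ℝ) (μ : ℝ) (γ : Space → ℝ) (t : ℝ) (p : Space) :
    gradGamma v μ γ t p = ‖p‖ ^ 2 - μ + v 0 * (t + mass γ) + gradAlpha v γ t p := by
  unfold gradGamma gradAlpha
  ring

variable {v : Space → ℝ} {M C t : ℝ} {f : Space → ℝ} (hv : IsKernel v M) (hf : Integrable f)
  (hC : ∫ p, |f p| ≤ C) (ht : 0 ≤ t)
include hv hf hC ht

theorem IsKernel.abs_gradAlpha_le_gradBound (p : Space) :
    |gradAlpha v f t p| ≤ gradBound M C t := by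
  have hpot := (hv.abs_potential_le hf p).trans
    (mul_le_mul_of_nonneg_left hC (mul_pos c₃_pos hv.bound_pos).le)
  have hcond : |t * v p| ≤ t * M := by
    rw [abs_of_nonneg (mul_nonneg ht (hv.nonneg p))]
    exact mul_le_mul_of_nonneg_left (hv.le p) ht
  exact (abs_add_le _ _).trans (add_le_add hpot hcond)

theorem IsKernel.abs_gradAlpha_sub_le (p q : Space) :
    |gradAlpha v f t p - gradAlpha v f t q| ≤ gradBound M C t * ‖p - q‖ := by
  have hpot := (hv.abs_potential_sub_le hf p q).trans (mul_le_mul_of_nonneg_right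
    (mul_le_mul_of_nonneg_left hC (mul_pos c₃_pos hv.bound_pos).le) (norm_nonneg _))
  have hcond : |t * v p - t * v q| ≤ t * M * ‖p - q‖ := by
    rw [← mul_sub, abs_mul, abs_of_nonneg ht, mul_assoc]
    exact mul_le_mul_of_nonneg_left (hv.lipschitz p q) ht
  rw [gradBound, add_mul, gradAlpha, gradAlpha, add_sub_add_comm]
  exact (abs_add_le _ _).trans (add_le_add hpot hcond)

theorem IsKernel.lipschitzWith_gradAlpha :
    LipschitzWith (gradBound M C t).toNNReal (gradAlpha v f t) :=
  LipschitzWith.of_dist_le' fun p q => by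
    rw [Real.dist_eq, dist_eq_norm]
    exact hv.abs_gradAlpha_sub_le hf hC ht p q

theorem IsKernel.abs_gradAlpha_second_diff_le (p k : Space) :
    |gradAlpha v f t (p + k) + gradAlpha v f t (p - k) - 2 * gradAlpha v f t p|
      ≤ gradBound M C t * ‖k‖ ^ 2 := by
  have hpot := (hv.abs_potential_second_diff_le hf p k).trans (mul_le_mul_of_nonneg_right
    (mul_le_mul_of_nonneg_left hC (mul_pos c₃_pos hv.bound_pos).le) (sq_nonneg _))
  have hcond : |t * (v (p + k) + v (p - k) - 2 * v p)| ≤ t * M * ‖k‖ ^ 2 := by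
    rw [abs_mul, abs_of_nonneg ht, mul_assoc]
    exact mul_le_mul_of_nonneg_left (hv.second_diff p k) ht
  have hsplit : gradAlpha v f t (p + k) + gradAlpha v f t (p - k) - 2 * gradAlpha v f t p
      = (potential v f (p + k) + potential v f (p - k) - 2 * potential v f p)
        + t * (v (p + k) + v (p - k) - 2 * v p) := by
    unfold gradAlpha
    ring
  rw [hsplit, gradBound, add_mul]
  exact (abs_add_le _ _).trans (add_le_add hpot hcond)

end GradBounds

/-- An approximating sequence at positive condensate density whose masses converge to `N` and whose
gradients converge pointwise to `(A, B)`. -/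
structure IsConvSeq (v : Space → ℝ) (M μ t : ℝ) (R ε : ℕ → ℝ) (γ α : ℕ → Space → ℝ) (N C r₀ : ℝ)
    (A B : Space → ℝ) : Prop extends IsApproxSeq v μ t R ε γ α where
  isKernel : IsKernel v M
  pos : 0 < t
  hasBounds : ∀ n, HasBounds C r₀ t (γ n) (α n)
  tendsto_mass : Tendsto (fun n => mass (γ n)) atTop (𝓝 N)
  tendsto_gradGamma : ∀ p, Tendsto (fun n => gradGamma v μ (γ n) t p) atTop (𝓝 (A p))
  tendsto_gradAlpha : ∀ p, Tendsto (fun n => gradAlpha v (α n) t p) atTop (𝓝 (B p))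

theorem IsApproxSeq.exists_isConvSeq {v : Space → ℝ} {M μ t : ℝ} {R ε : ℕ → ℝ}
    {γ α : ℕ → Space → ℝ} (h : IsApproxSeq v μ t R ε γ α) (hv : IsKernel v M) (ht : 0 < t) :
    ∃ R ε γ α N C r₀ A B, IsConvSeq v M μ t R ε γ α N C r₀ A B := by
  obtain ⟨C, r₀, hb⟩ := h.exists_hasBounds hv ht.le
  obtain ⟨N, -, φ, hφ, hN⟩ := (isCompact_Icc (a := 0) (b := C)).tendsto_subseq
    (x := fun n => mass (γ n)) fun n =>
      ⟨mass_nonneg (h.isState n).nonneg, by linarith [(hb n).add_mass_le]⟩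
  have hγ := fun n => (h.isState (φ n)).integrable_gamma
  have hα := fun n => (h.isState (φ n)).integrable_alpha
  have hγC := fun n => (hb (φ n)).integral_abs_gamma_le
  have hαC := fun n => (hb (φ n)).integral_abs_alpha_le
  set L := gradBound M C t
  obtain ⟨ψ, hψ, g, hg⟩ := exists_subseq_tendsto_of_equicontinuous
    (f := fun n p => (gradAlpha v (γ (φ n)) t p, gradAlpha v (α (φ n)) t p))
    (LipschitzWith.uniformEquicontinuous _ _ fun n =>
      (hv.lipschitzWith_gradAlpha (hγ n) (hγC n) ht.le).prodMk
        (hv.lipschitzWith_gradAlpha (hα n) (hαC n) ht.le)).equicontinuous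
    ((isCompact_Icc (a := -L) (b := L)).prod (isCompact_Icc (a := -L) (b := L))) fun n p =>
      ⟨abs_le.1 (hv.abs_gradAlpha_le_gradBound (hγ n) (hγC n) ht.le p),
        abs_le.1 (hv.abs_gradAlpha_le_gradBound (hα n) (hαC n) ht.le p)⟩
  have hN' := hN.comp hψ.tendsto_atTop
  refine ⟨_, _, _, _, N, C, r₀, fun p => ‖p‖ ^ 2 - μ + v 0 * (t + N) + (g p).1,
    fun p => (g p).2, (h.subseq hφ).subseq hψ, hv, ht, fun n => hb _, hN', fun p => ?_,
    fun p => (hg p).snd_nhds⟩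
  simp only [gradGamma_eq]
  exact (((hN'.const_add t).const_mul (v 0)).const_add _).add (hg p).fst_nhds

namespace IsConvSeq

variable {v : Space → ℝ} {M μ t : ℝ} {R ε : ℕ → ℝ} {γ α : ℕ → Space → ℝ} {N C r₀ : ℝ}
  {A B : Space → ℝ} (h : IsConvSeq v M μ t R ε γ α N C r₀ A B)
include h

theorem isState (n : ℕ) : IsState (γ n) (α n) := h.toIsApproxSeq.isState n

theorem abs_gradAlpha_gamma_sub_le (n : ℕ) (p q : Space) :
    |gradAlpha v (γ n) t p - gradAlpha v (γ n) t q| ≤ gradBound M C t * ‖p - q‖ :=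
  h.isKernel.abs_gradAlpha_sub_le (h.isState n).integrable_gamma
    (h.hasBounds n).integral_abs_gamma_le h.pos.le p q

theorem equicontinuous_gradGamma : Equicontinuous fun n => gradGamma v μ (γ n) t := fun p => by
  have hmodulus : Tendsto (fun q : Space => |‖p‖ ^ 2 - ‖q‖ ^ 2| + gradBound M C t * ‖p - q‖) (𝓝 p)
      (𝓝 0) := by
    have hcont : Continuous fun q : Space =>
      |‖p‖ ^ 2 - ‖q‖ ^ 2| + gradBound M C t * ‖p - q‖ := by fun_prop
    simpa using hcont.tendsto p
  refine Metric.equicontinuousAt_of_continuity_modulus _ hmodulus _ (Eventually.of_forall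
    fun q n => ?_)
  have hdiff : gradGamma v μ (γ n) t p - gradGamma v μ (γ n) t q
      = (‖p‖ ^ 2 - ‖q‖ ^ 2) + (gradAlpha v (γ n) t p - gradAlpha v (γ n) t q) := by
    simp only [gradGamma_eq]
    ring
  rw [Real.dist_eq, hdiff]
  exact (abs_add_le _ _).trans (add_le_add_right (h.abs_gradAlpha_gamma_sub_le n p q) _)

theorem equicontinuous_gradAlpha : Equicontinuous fun n => gradAlpha v (α n) t :=
  (LipschitzWith.uniformEquicontinuous _ _ fun n => h.isKernel.lipschitzWith_gradAlpha
    (h.isState n).integrable_alpha (h.hasBounds n).integral_abs_alpha_le h.pos.le).equicontinuous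

theorem continuous_limGradGamma : Continuous A :=
  (tendsto_pi_nhds.2 h.tendsto_gradGamma).continuous_of_equicontinuous h.equicontinuous_gradGamma

theorem continuous_limGradAlpha : Continuous B :=
  (tendsto_pi_nhds.2 h.tendsto_gradAlpha).continuous_of_equicontinuous h.equicontinuous_gradAlpha

theorem limGradGamma_second_diff_le (p k : Space) :
    A (p + k) + A (p - k) - 2 * A p ≤ (2 + gradBound M C t) * ‖k‖ ^ 2 :=
  le_of_tendsto' (((h.tendsto_gradGamma (p + k)).add (h.tendsto_gradGamma (p - k))).sub
    ((h.tendsto_gradGamma p).const_mul 2)) fun n => by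
    have hsecond := (abs_le.1 (h.isKernel.abs_gradAlpha_second_diff_le
      (h.isState n).integrable_gamma (h.hasBounds n).integral_abs_gamma_le h.pos.le p k)).2
    simp only [gradGamma_eq]
    linarith [parallelogram_law_with_norm ℝ p k]

theorem abs_limGradAlpha_second_diff_le (p k : Space) :
    |B (p + k) + B (p - k) - 2 * B p| ≤ gradBound M C t * ‖k‖ ^ 2 :=
  le_of_tendsto' (((h.tendsto_gradAlpha (p + k)).add (h.tendsto_gradAlpha (p - k))).sub
    ((h.tendsto_gradAlpha p).const_mul 2)).abs fun n =>
    h.isKernel.abs_gradAlpha_second_diff_le (h.isState n).integrable_alpha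
      (h.hasBounds n).integral_abs_alpha_le h.pos.le p k

theorem isRadial_limGradGamma : IsRadial A := fun p q hpq =>
  tendsto_nhds_unique (h.tendsto_gradGamma p) ((h.tendsto_gradGamma q).congr fun n => by
    simp only [gradGamma, hpq, h.isKernel.radial p q hpq, h.isKernel.isRadial_potential (fun T =>
      ((h.isRegMin n).ae_eq_comp_isometry h.isKernel (h.eps_pos n) T).1) p q hpq])

theorem isRadial_limGradAlpha : IsRadial B := fun p q hpq =>
  tendsto_nhds_unique (h.tendsto_gradAlpha p) ((h.tendsto_gradAlpha q).congr fun n => by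
    simp only [gradAlpha, h.isKernel.radial p q hpq, h.isKernel.isRadial_potential (fun T =>
      ((h.isRegMin n).ae_eq_comp_isometry h.isKernel (h.eps_pos n) T).2) p q hpq])

theorem energy_add (n : ℕ) (s : ℝ) : energy v μ (γ n) (α n) (t + s) = energy v μ (γ n) (α n) t
    + s * (gradGamma v μ (γ n) t 0 + gradAlpha v (α n) t 0 - 2 * (t * v 0)) + v 0 / 2 * s ^ 2 := by
  rw [energy_add_right, h.isKernel.coupling_eq_potential_zero,
    h.isKernel.coupling_eq_potential_zero, gradGamma, gradAlpha, norm_zero]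
  ring

/- `A 0 + B 0 - 2 t v 0` is the limiting derivative of the energy in the condensate density, which
vanishes because `t` minimizes. -/
theorem limGradGamma_zero_add_limGradAlpha_zero : A 0 + B 0 = 2 * (t * v 0) := by
  set d := A 0 + B 0 - 2 * (t * v 0)
  have hnonneg : ∀ s, -t ≤ s → 0 ≤ s * d + v 0 / 2 * s ^ 2 := fun s hs => by
    have hlim := (h.tendsto_energy.add ((((h.tendsto_gradGamma 0).add
      (h.tendsto_gradAlpha 0)).sub_const (2 * (t * v 0))).const_mul s)).add_const (v 0 / 2 * s ^ 2)
    have hge := ge_of_tendsto' hlim fun n => (h.isKernel.groundEnergy_le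
      (h.isRegMin n).isTestState μ (by linarith : 0 ≤ t + s)).trans_eq (h.energy_add n s)
    linarith
  have hmin : IsLocalMin (fun s => s * d + v 0 / 2 * s ^ 2) 0 := by
    filter_upwards [lt_mem_nhds (neg_lt_zero.2 h.pos)] with s hs
    simpa using hnonneg s hs.le
  have hderiv : HasDerivAt (fun s => s * d + v 0 / 2 * s ^ 2) d 0 := by
    simpa using ((hasDerivAt_id' (0 : ℝ)).mul_const d).fun_add
      (((hasDerivAt_id' (0 : ℝ)).fun_pow 2).const_mul (v 0 / 2))
  linarith [hmin.hasDerivAt_eq_zero hderiv]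

/- Compare with the state that has the same density entirely in the condensate. -/
theorem le_add_mass : μ ≤ v 0 * (t + N) := by
  have hcompare : ∀ n, t * (gradGamma v μ (γ n) t 0 + gradAlpha v (α n) t 0 - 2 * (t * v 0) + μ
      - v 0 * (t + mass (γ n))) ≤ energy v μ (γ n) (α n) t - groundEnergy v μ := fun n => by
    have hcond := h.isKernel.groundEnergy_le (isTestState_zero 0) μ
      (add_nonneg h.pos.le (mass_nonneg (h.isState n).nonneg))
    rw [energy_zero] at hcond
    rw [gradGamma, gradAlpha, ← h.isKernel.coupling_eq_potential_zero,
      ← h.isKernel.coupling_eq_potential_zero, norm_zero]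
    unfold energy
    linarith [h.isKernel.interaction_self_nonneg (h.isState n).integrable_gamma,
      h.isKernel.interaction_self_nonneg (h.isState n).integrable_alpha,
      kinetic_nonneg (h.isState n).nonneg]
  have hlim := le_of_tendsto_of_tendsto' ((((((h.tendsto_gradGamma 0).add
    (h.tendsto_gradAlpha 0)).sub_const (2 * (t * v 0))).add_const μ).sub
      ((h.tendsto_mass.const_add t).const_mul (v 0))).const_mul t)
    (h.tendsto_energy.sub_const (groundEnergy v μ)) hcompare
  rw [h.limGradGamma_zero_add_limGradAlpha_zero, sub_self, sub_self, zero_add] at hlim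
  exact sub_nonpos.1 (nonpos_of_mul_nonpos_right hlim h.pos)

theorem sq_norm_le_limGradGamma (p : Space) : ‖p‖ ^ 2 ≤ A p := by
  have hge : ‖p‖ ^ 2 - μ + v 0 * (t + N) ≤ A p :=
    le_of_tendsto_of_tendsto' (((h.tendsto_mass.const_add t).const_mul (v 0)).const_add _)
      (h.tendsto_gradGamma p) fun n => by
        unfold gradGamma
        linarith [h.isKernel.potential_nonneg (h.isState n).nonneg p,
          mul_nonneg h.pos.le (h.isKernel.nonneg p)]
  linarith [h.le_add_mass]

theorem limGradGamma_pos {p : Space} (hp : p ≠ 0) : 0 < A p :=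
  (pow_pos (norm_pos_iff.2 hp) 2).trans_le (h.sq_norm_le_limGradGamma p)

theorem ae_eventually_isLinearMin : ∀ᵐ p : Space, ∀ᶠ n in atTop,
    IsLinearMin (gradGamma v μ (γ n) t p) (gradAlpha v (α n) t p) (ε n) (γ n p) (α n p) := by
  filter_upwards [ae_all_iff.2 fun n => (h.isRegMin n).ae_isLinearMin h.isKernel (h.eps_pos n)]
    with p hp
  filter_upwards [h.tendsto_R.eventually_ge_atTop ‖p‖] with n hn
  exact hp n hn

theorem ae_liminf_lt_top :
    ∀ᵐ p : Space, liminf (fun n => ENNReal.ofReal (γ n p)) atTop < ⊤ := by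
  have hmeas : ∀ n, AEMeasurable (fun p => ENNReal.ofReal (γ n p)) volume := fun n =>
    (h.isState n).integrable_gamma.1.aemeasurable.ennreal_ofReal
  have hliminf : AEMeasurable (fun p => liminf (fun n => ENNReal.ofReal (γ n p)) atTop) :=
    ⟨_, Measurable.liminf fun n => (hmeas n).measurable_mk, by
      filter_upwards [ae_all_iff.2 fun n => (hmeas n).ae_eq_mk] with p hp
      simp only [hp]⟩
  refine ae_lt_top' hliminf ((lintegral_liminf_le' hmeas).trans_lt ?_).ne
  refine lt_of_le_of_lt (liminf_le_of_frequently_le' (x := ENNReal.ofReal C)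
    (Eventually.of_forall fun n => ?_).frequently) ENNReal.ofReal_lt_top
  rw [← ofReal_integral_eq_lintegral_ofReal (h.isState n).integrable_gamma (h.isState n).nonneg,
    ← (h.isState n).integral_abs_gamma]
  exact ENNReal.ofReal_le_ofReal (h.hasBounds n).integral_abs_gamma_le

theorem ae_abs_limGradAlpha_lt_limGradGamma : ∀ᵐ p, |B p| < A p := by
  filter_upwards [h.ae_liminf_lt_top, h.ae_eventually_isLinearMin,
    ae_all_iff.2 fun n => (h.isState n).feasible, Measure.ae_ne volume 0] with p hfin hmin hfeas hp
  by_contra! hle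
  have hinfty := tendsto_atTop_of_isLinearMin (h.tendsto_gradGamma p) (h.tendsto_gradAlpha p)
    h.tendsto_eps hfeas hmin (h.limGradGamma_pos hp) hle
  exact hfin.ne (ENNReal.tendsto_ofReal_nhds_top.2 hinfty).liminf_eq

theorem abs_limGradAlpha_le_limGradGamma (p : Space) : |B p| ≤ A p := by
  have hclosed : IsClosed {p | |B p| ≤ A p} :=
    isClosed_le h.continuous_limGradAlpha.abs h.continuous_limGradGamma
  have hdense : Dense {p | |B p| ≤ A p} :=
    Measure.dense_of_ae (h.ae_abs_limGradAlpha_lt_limGradGamma.mono fun p hp => hp.le)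
  exact Set.eq_univ_iff_forall.1 (hclosed.closure_eq ▸ hdense.closure_eq) p

end IsConvSeq

/-! ### Strict gap and tightness -/

section IntegrationAndCompactness

theorem not_integrableOn_inv_norm_sub {E : Type*} [NormedAddCommGroup E] [NormedSpace ℝ E]
    [FiniteDimensional ℝ E] [Nontrivial E] [MeasurableSpace E] [BorelSpace E] (ν : Measure E)
    [ν.IsAddHaarMeasure] {r s : ℝ} (hr : 0 < r) (hrs : r < s) :
    ¬ IntegrableOn (fun p => (‖p‖ - r)⁻¹) (norm ⁻¹' Set.Ioc r s) ν := by
  intro hint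
  have hpolar : IntegrableOn (fun y : ℝ => y ^ (Module.finrank ℝ E - 1) *
      (Set.Ioc r s).indicator (fun y => (y - r)⁻¹) y) (Set.Ioi 0) :=
    (integrable_fun_norm_addHaar ν).1
      ((integrable_indicator_iff (measurable_norm measurableSet_Ioc)).2 hint)
  have hradial : IntegrableOn (fun y : ℝ => y ^ (Module.finrank ℝ E - 1) * (y - r)⁻¹)
      (Set.Ioc r s) :=
    (hpolar.mono_set fun y hy => hr.trans hy.1).congr_fun
      (fun y hy => by simp only [Set.indicator_of_mem hy]) measurableSet_Ioc
  have hinv : IntegrableOn (fun y : ℝ => (y - r)⁻¹) (Set.Ioc r s) := by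
    refine (hradial.const_mul (r ^ (Module.finrank ℝ E - 1))⁻¹).mono'
      (by fun_prop) ((ae_restrict_mem measurableSet_Ioc).mono fun y hy => ?_)
    have hinv_nonneg : 0 ≤ (y - r)⁻¹ := inv_nonneg.2 (sub_nonneg.2 hy.1.le)
    rw [Real.norm_of_nonneg hinv_nonneg, ← mul_assoc]
    refine le_mul_of_one_le_left hinv_nonneg ?_
    rw [inv_mul_eq_div, one_le_div (by positivity)]
    exact pow_le_pow_left₀ hr.le hy.1.le _
  rcases intervalIntegrable_sub_inv_iff.1
    ((intervalIntegrable_iff_integrableOn_Ioc_of_le hrs.le).2 hinv) with heq | hnotMem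
  · exact hrs.ne heq
  · exact hnotMem Set.left_mem_uIcc

theorem tendsto_integral_abs_sub_of_tight {X : Type*} [MeasurableSpace X] {ν : Measure X}
    {f : ℕ → X → ℝ} {g : X → ℝ} (hf : ∀ n, Integrable (f n) ν) (hg : Integrable g ν)
    (hfg : ∀ᵐ x ∂ν, Tendsto (fun n => f n x) atTop (𝓝 (g x)))
    (htight : ∀ δ > 0, ∃ T, MeasurableSet T ∧ ν T ≠ ⊤ ∧
      (∃ D : ℝ, ∀ᶠ n in atTop, ∀ᵐ x ∂ν, x ∈ T → |f n x| ≤ D) ∧ ∀ n, ∫ x in Tᶜ, |f n x| ∂ν ≤ δ) :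
    Tendsto (fun n => ∫ x, |f n x - g x| ∂ν) atTop (𝓝 0) := by
  refine Metric.tendsto_atTop'.2 fun e he => ?_
  obtain ⟨T, hT, hTfin, ⟨D, hD⟩, houtside⟩ := htight (e / 4) (by positivity)
  have hinside : Tendsto (fun n => ∫ x in T, |f n x - g x| ∂ν) atTop (𝓝 0) := by
    rw [← integral_zero X ℝ (μ := ν.restrict T)]
    refine tendsto_integral_filter_of_dominated_convergence (fun x => D + |g x|)
      (Eventually.of_forall fun n => ((hf n).sub hg).abs.1.restrict) (hD.mono fun n hn => ?_)
      ((integrableOn_const hTfin).add hg.abs.integrableOn)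
      (ae_restrict_of_ae (hfg.mono fun x hx => by simpa using (hx.sub_const (g x)).abs))
    filter_upwards [ae_restrict_of_ae hn, ae_restrict_mem hT] with x hx hxT
    rw [Real.norm_eq_abs, abs_abs]
    exact (abs_sub _ _).trans (add_le_add_left (hx hxT) _)
  have hlimit_outside : ∫ x in Tᶜ, |g x| ∂ν ≤ e / 4 :=
    (integrable_and_integral_le_of_tendsto (fun n => (hf n).abs.integrableOn)
      (fun n => ae_of_all _ fun x => abs_nonneg (f n x))
      (ae_restrict_of_ae (hfg.mono fun x hx => hx.abs)) houtside tendsto_const_nhds).2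
  obtain ⟨n₀, hn₀⟩ := eventually_atTop.1 (hinside.eventually (gt_mem_nhds (half_pos he)))
  refine ⟨n₀, fun n hn => ?_⟩
  have hdiff : Integrable (fun x => |f n x - g x|) ν := ((hf n).sub hg).abs
  have hdiff_outside : ∫ x in Tᶜ, |f n x - g x| ∂ν ≤ e / 4 + e / 4 :=
    (integral_mono hdiff.integrableOn ((hf n).abs.integrableOn.add hg.abs.integrableOn)
      fun x => abs_sub _ _).trans <| by
        simp only [Pi.add_apply]
        rw [integral_add (hf n).abs.integrableOn hg.abs.integrableOn]
        exact add_le_add (houtside n) hlimit_outside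
  rw [Real.dist_eq, sub_zero, abs_of_nonneg (integral_nonneg fun _ => abs_nonneg _),
    ← integral_add_compl hT hdiff]
  linarith [hn₀ n hn.le]

theorem exists_tight_set_of_tail_le {f : ℕ → Space → ℝ} {C r₀ : ℝ}
    (hf : ∀ n, Integrable (f n))
    (htail : ∀ n r, r₀ ≤ r → ∫ p in tail r, |f n p| ≤ C / r ^ 2) {η : ℝ}
    (hbound : ∀ k, ∃ D : ℝ, ∀ᶠ n in atTop, ∀ᵐ p : Space,
      p ∈ tail η ∩ Metric.closedBall 0 k → |f n p| ≤ D) {δ : ℝ} (hδ : 0 < δ) :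
    ∃ T : Set Space, MeasurableSet T ∧ volume.restrict (tail η) T ≠ ⊤ ∧
      (∃ D : ℝ, ∀ᶠ n in atTop, ∀ᵐ p ∂volume.restrict (tail η), p ∈ T → |f n p| ≤ D) ∧
      ∀ n, ∫ p in Tᶜ, |f n p| ∂volume.restrict (tail η) ≤ δ := by
  have hlim : Tendsto (fun r : ℝ => C / r ^ 2) atTop (𝓝 0) :=
    tendsto_const_nhds.div_atTop (tendsto_pow_atTop two_ne_zero)
  obtain ⟨r, hrδ, hr⟩ := ((hlim.eventually (gt_mem_nhds hδ)).and (eventually_ge_atTop r₀)).exists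
  obtain ⟨D, hD⟩ := hbound r
  refine ⟨Metric.closedBall 0 r, measurableSet_closedBall,
    (measure_closedBall_lt_top (μ := volume.restrict (tail η))).ne,
    ⟨D, hD.mono fun n hn => ?_⟩, fun n => ?_⟩
  · filter_upwards [ae_restrict_of_ae hn, ae_restrict_mem (measurableSet_tail η)] with p hp hpη hpr
    exact hp ⟨hpη, hpr⟩
  · rw [Measure.restrict_restrict measurableSet_closedBall.compl]
    refine (setIntegral_mono_set (hf n).abs.integrableOn (ae_of_all _ fun _ => abs_nonneg _)
      (ae_of_all _ fun p hp => ?_)).trans ((htail n r hr).trans hrδ.le)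
    exact (not_le.1 fun hpr => hp.1 (mem_closedBall_zero_iff.2 hpr)).le

theorem exists_pos_eventually_forall_le_of_equicontinuous {X : Type*} [TopologicalSpace X]
    {F : ℕ → X → ℝ} {f : X → ℝ} {K : Set X} (hF : Equicontinuous F)
    (hlim : ∀ x, Tendsto (fun n => F n x) atTop (𝓝 (f x))) (hK : IsCompact K)
    (hpos : ∀ x ∈ K, 0 < f x) : ∃ δ > 0, ∀ᶠ n in atTop, ∀ x ∈ K, δ ≤ F n x := by
  refine hK.induction_on ⟨1, one_pos, by simp⟩ ?_ ?_ fun x hx => ?_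
  · rintro s s' hs ⟨δ, hδ, hev⟩
    exact ⟨δ, hδ, hev.mono fun n hn x hx => hn x (hs hx)⟩
  · rintro s s' ⟨δ, hδ, hev⟩ ⟨δ', hδ', hev'⟩
    refine ⟨min δ δ', lt_min hδ hδ', ?_⟩
    filter_upwards [hev, hev'] with n hn hn' x hx
    exact hx.elim (fun h => (min_le_left _ _).trans (hn x h))
      fun h => (min_le_right _ _).trans (hn' x h)
  · have hquarter : 0 < f x / 4 := div_pos (hpos x hx) four_pos
    refine ⟨_, mem_nhdsWithin_of_mem_nhds (Metric.equicontinuousAt_iff_right.1 (hF x) _ hquarter),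
      f x / 4, hquarter, ?_⟩
    filter_upwards [(hlim x).eventually (lt_mem_nhds (by linarith : f x / 2 < f x))] with n hn y hy
    linarith [(abs_lt.1 (hy n)).2]

theorem IsRadial.le_of_second_diff_le {f : Space → ℝ} (hf : IsRadial f) (h0 : ∀ p, 0 ≤ f p)
    {K : ℝ} {p₀ : Space} (hp₀ : p₀ ≠ 0) (hzero : f p₀ = 0)
    (hsecond : ∀ k, f (p₀ + k) + f (p₀ - k) - 2 * f p₀ ≤ K * ‖k‖ ^ 2) (p : Space) :
    f p ≤ K * (‖p‖ - ‖p₀‖) ^ 2 := by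
  have hnorm : 0 < ‖p₀‖ := norm_pos_iff.2 hp₀
  set k : Space := ((‖p‖ - ‖p₀‖) / ‖p₀‖) • p₀ with hk
  have hk_norm : ‖k‖ ^ 2 = (‖p‖ - ‖p₀‖) ^ 2 := by
    rw [hk, norm_smul, Real.norm_eq_abs, mul_pow, sq_abs, div_pow, div_mul_cancel₀]
    positivity
  have hadd : ‖p₀ + k‖ = ‖p‖ := by
    have hk_add : p₀ + k = (‖p‖ / ‖p₀‖) • p₀ := by
      rw [hk, sub_div, div_self hnorm.ne', sub_smul, one_smul, add_sub_cancel]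
    rw [hk_add, norm_smul, norm_div, norm_norm, norm_norm, div_mul_cancel₀ _ hnorm.ne']
  have hle := hsecond k
  rw [hf _ p hadd, hzero, hk_norm] at hle
  linarith [h0 (p₀ - k)]

theorem div_le_mul_linearMinGamma_add {A B K d r : ℝ} (hlt : |B| < A) (hr : r ^ 2 ≤ A)
    (hK : 0 < K) (hd : 0 < d) (hle : A - |B| ≤ K * d ^ 2) :
    r / (2 * √(2 * K)) ≤ d * (linearMinGamma A B + 1 / 2) := by
  have hA : 0 < A := (abs_nonneg B).trans_lt hlt
  have hroot : 0 < A ^ 2 - B ^ 2 := sub_pos.2 (sq_lt_sq.2 (hlt.trans_le (le_abs_self A)))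
  have hdisc : A ^ 2 - B ^ 2 ≤ (√(2 * K) * d) ^ 2 * A := by
    rw [mul_pow, Real.sq_sqrt (by positivity)]
    calc A ^ 2 - B ^ 2 = (A - |B|) * (A + |B|) := by rw [← sq_abs B]; ring
      _ ≤ (K * d ^ 2) * (2 * A) := by gcongr; linarith
      _ = 2 * K * d ^ 2 * A := by ring
  have hkey : r * √(A ^ 2 - B ^ 2) ≤ √(2 * K) * d * A := by
    refine (abs_le_of_sq_le_sq' ?_ (by positivity)).2
    rw [mul_pow, Real.sq_sqrt hroot.le]
    calc r ^ 2 * (A ^ 2 - B ^ 2) ≤ A * ((√(2 * K) * d) ^ 2 * A) := by gcongr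
      _ = (√(2 * K) * d * A) ^ 2 := by ring
  have := Real.sqrt_pos.2 hroot
  rw [linearMinGamma, sub_add_cancel, mul_div_assoc', div_le_div_iff₀ (by positivity)
    (by positivity)]
  linarith

end IntegrationAndCompactness

namespace IsConvSeq

variable {v : Space → ℝ} {M μ t : ℝ} {R ε : ℕ → ℝ} {γ α : ℕ → Space → ℝ} {N C r₀ : ℝ}
  {A B : Space → ℝ} (h : IsConvSeq v M μ t R ε γ α N C r₀ A B)
include h

theorem ae_tendsto : ∀ᵐ p, Tendsto (fun n => γ n p) atTop (𝓝 (linearMinGamma (A p) (B p))) ∧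
    Tendsto (fun n => α n p) atTop (𝓝 (linearMinAlpha (A p) (B p))) := by
  filter_upwards [h.ae_abs_limGradAlpha_lt_limGradGamma, h.ae_eventually_isLinearMin,
    ae_all_iff.2 fun n => (h.isState n).feasible] with p hlt hmin hfeas
  exact tendsto_linearMin_of_isLinearMin (h.tendsto_gradGamma p) (h.tendsto_gradAlpha p)
    h.tendsto_eps hfeas hmin hlt

theorem isState_lim :
    IsState (fun p => linearMinGamma (A p) (B p)) fun p => linearMinAlpha (A p) (B p) where
  integrable_gamma := (integrable_and_integral_le_of_tendsto
    (fun n => (h.isState n).integrable_gamma) (fun n => (h.isState n).nonneg)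
    (h.ae_tendsto.mono fun _ hp => hp.1) (fun n => (h.isState n).integral_abs_gamma.symm.trans_le
      (h.hasBounds n).integral_abs_gamma_le) tendsto_const_nhds).1
  integrable_alpha := (integrable_norm_iff (aestronglyMeasurable_of_tendsto_ae _
    (fun n => (h.isState n).integrable_alpha.1) (h.ae_tendsto.mono fun _ hp => hp.2))).1
    (integrable_and_integral_le_of_tendsto (fun n => (h.isState n).integrable_alpha.abs)
      (fun _ => ae_of_all _ fun _ => abs_nonneg _) (h.ae_tendsto.mono fun _ hp => hp.2.abs)
      (fun n => (h.hasBounds n).integral_abs_alpha_le) tendsto_const_nhds).1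
  integrable_kinetic := (integrable_and_integral_le_of_tendsto
    (fun n => (h.isState n).integrable_kinetic)
    (fun n => (h.isState n).nonneg.mono fun _ hp => mul_nonneg (sq_nonneg _) hp)
    (h.ae_tendsto.mono fun p hp => hp.1.const_mul (‖p‖ ^ 2))
    (fun n => (h.hasBounds n).integral_sq_norm_mul_gamma_le) tendsto_const_nhds).1
  feasible := h.ae_abs_limGradAlpha_lt_limGradGamma.mono fun _ hp => feasible_linearMin hp

theorem gradBound_pos : 0 < gradBound M C t := by
  have hC : 0 ≤ C :=
    (integral_nonneg fun _ => abs_nonneg _).trans (h.hasBounds 0).integral_abs_gamma_le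
  exact add_pos_of_nonneg_of_pos (mul_nonneg (mul_pos c₃_pos h.isKernel.bound_pos).le hC)
    (mul_pos h.pos h.isKernel.bound_pos)

theorem limGradGamma_sub_abs_limGradAlpha_le {p₀ : Space} (hp₀ : p₀ ≠ 0) (heq : |B p₀| = A p₀)
    (p : Space) : A p - |B p| ≤ (2 + 2 * gradBound M C t) * (‖p‖ - ‖p₀‖) ^ 2 := by
  obtain ⟨σ, hσ, hσB⟩ : ∃ σ : ℝ, |σ| = 1 ∧ |B p₀| = σ * B p₀ :=
    (abs_choice (B p₀)).elim (fun hB => ⟨1, by simp, by simp [hB]⟩)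
      fun hB => ⟨-1, by simp, by simp [hB]⟩
  have hle : ∀ q, σ * B q ≤ |B q| := fun q =>
    (le_abs_self _).trans_eq (by rw [abs_mul, hσ, one_mul])
  refine (sub_le_sub_left (hle p) (A p)).trans ?_
  refine IsRadial.le_of_second_diff_le (f := fun q => A q - σ * B q) (fun q q' hq => ?_)
    (fun q => sub_nonneg.2 ((hle q).trans (h.abs_limGradAlpha_le_limGradGamma q))) hp₀
    (by rw [← hσB, heq, sub_self]) (fun k => ?_) p
  · simp only [h.isRadial_limGradGamma q q' hq, h.isRadial_limGradAlpha q q' hq]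
  · have hA := h.limGradGamma_second_diff_le p₀ k
    have hB : -(σ * (B (p₀ + k) + B (p₀ - k) - 2 * B p₀)) ≤ gradBound M C t * ‖k‖ ^ 2 :=
      (neg_le_abs _).trans (by
        rw [abs_mul, hσ, one_mul]; exact h.abs_limGradAlpha_second_diff_le p₀ k)
    linarith

/- If `|B| = A` on a sphere of radius `r > 0`, then `A - |B|` vanishes there to second order, so
the limiting density is bounded below by a multiple of `1 / (‖p‖ - r)` and is not integrable. -/
theorem abs_limGradAlpha_lt_limGradGamma {p₀ : Space} (hp₀ : p₀ ≠ 0) : |B p₀| < A p₀ := by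
  refine (h.abs_limGradAlpha_le_limGradGamma p₀).lt_of_ne fun heq => ?_
  have hr : 0 < ‖p₀‖ := norm_pos_iff.2 hp₀
  set K := 2 + 2 * gradBound M C t
  have hK : 0 < K := by linarith [h.gradBound_pos]
  set b := ‖p₀‖ / (2 * √(2 * K))
  have hb : 0 < b := by positivity
  have hmeas : MeasurableSet ((norm : Space → ℝ) ⁻¹' Set.Ioc ‖p₀‖ (2 * ‖p₀‖)) :=
    measurable_norm measurableSet_Ioc
  have hfin : volume ((norm : Space → ℝ) ⁻¹' Set.Ioc ‖p₀‖ (2 * ‖p₀‖)) ≠ ⊤ :=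
    ((measure_mono fun p hp => mem_closedBall_zero_iff.2 hp.2).trans_lt
      measure_closedBall_lt_top).ne
  refine not_integrableOn_inv_norm_sub volume hr (by linarith : ‖p₀‖ < 2 * ‖p₀‖)
    (((h.isState_lim.integrable_gamma.integrableOn.add
      (integrableOn_const hfin (C := 1 / 2))).const_mul b⁻¹).mono' (by fun_prop) ?_)
  filter_upwards [ae_restrict_of_ae h.ae_abs_limGradAlpha_lt_limGradGamma, ae_restrict_mem hmeas]
    with p hlt hp
  have hd : 0 < ‖p‖ - ‖p₀‖ := sub_pos.2 hp.1
  have hlower := div_le_mul_linearMinGamma_add hlt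
    ((pow_le_pow_left₀ hr.le hp.1.le 2).trans (h.sq_norm_le_limGradGamma p)) hK hd
    (h.limGradGamma_sub_abs_limGradAlpha_le hp₀ heq p)
  rwa [Real.norm_of_nonneg (inv_nonneg.2 hd.le), inv_mul_eq_div, le_div_iff₀ hb, mul_comm,
    ← div_eq_mul_inv, div_le_iff₀ hd, mul_comm]

theorem equicontinuous_gradGamma_sub_abs_gradAlpha :
    Equicontinuous fun n p => gradGamma v μ (γ n) t p - |gradAlpha v (α n) t p| := fun p =>
  Metric.equicontinuousAt_iff_right.2 fun e he => by
    filter_upwards [Metric.equicontinuousAt_iff_right.1 (h.equicontinuous_gradGamma p) _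
      (half_pos he), Metric.equicontinuousAt_iff_right.1 (h.equicontinuous_gradAlpha p) _
      (half_pos he)] with q hA hB n
    have hAn := abs_lt.1 (hA n)
    have hBn := abs_lt.1 ((abs_abs_sub_abs_le_abs_sub _ _).trans_lt (hB n))
    exact abs_lt.2 ⟨by linarith, by linarith⟩

theorem exists_gap {η k : ℝ} (hη : 0 < η) : ∃ δ > 0, ∀ᶠ n in atTop,
    ∀ p ∈ tail η ∩ Metric.closedBall 0 k, δ ≤ gradGamma v μ (γ n) t p - |gradAlpha v (α n) t p| :=
  exists_pos_eventually_forall_le_of_equicontinuous h.equicontinuous_gradGamma_sub_abs_gradAlpha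
    (fun p => (h.tendsto_gradGamma p).sub (h.tendsto_gradAlpha p).abs)
    ((isCompact_closedBall 0 k).inter_left (isClosed_le continuous_const continuous_norm))
    fun _ hp => sub_pos.2 (h.abs_limGradAlpha_lt_limGradGamma (norm_pos_iff.1 (hη.trans_le hp.1)))

theorem exists_bound {η k : ℝ} (hη : 0 < η) : ∃ D : ℝ, ∀ᶠ n in atTop, ∀ᵐ p : Space,
    p ∈ tail η ∩ Metric.closedBall 0 k → |γ n p| ≤ D ∧ |α n p| ≤ D := by
  obtain ⟨δ, hδ, hgap⟩ := h.exists_gap (k := k) hη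
  refine ⟨gradBound M C t / (2 * δ) + 1 / 2, hgap.mono fun n hn => ?_⟩
  filter_upwards [(h.isRegMin n).gradGamma_mul_add_gradAlpha_mul_nonpos h.isKernel (h.eps_pos n),
    (h.isState n).feasible] with p hnonpos hfeas hp
  have hγ : γ n p ≤ gradBound M C t / (2 * δ) := by
    rw [le_div_iff₀ (by positivity)]
    linarith [mul_le_mul_of_nonneg_right (hn p hp) hfeas.1, hfeas.sub_abs_mul_le hnonpos,
      h.isKernel.abs_gradAlpha_le_gradBound (h.isState n).integrable_alpha
        (h.hasBounds n).integral_abs_alpha_le h.pos.le p]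
  rw [abs_of_nonneg hfeas.1]
  exact ⟨by linarith, by linarith [hfeas.abs_le]⟩

theorem tendsto_setIntegral_tail_gamma {η : ℝ} (hη : 0 < η) : Tendsto
    (fun n => ∫ p in tail η, |γ n p - linearMinGamma (A p) (B p)|) atTop (𝓝 0) :=
  tendsto_integral_abs_sub_of_tight (fun n => (h.isState n).integrable_gamma.integrableOn)
    h.isState_lim.integrable_gamma.integrableOn
    (ae_restrict_of_ae (h.ae_tendsto.mono fun _ hp => hp.1)) fun _ hδ =>
    exists_tight_set_of_tail_le (fun n => (h.isState n).integrable_gamma)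
      (fun n => (h.hasBounds n).tail_gamma_le)
      (fun _ => (h.exists_bound hη).imp fun _ hD => hD.mono fun _ hn => hn.mono fun _ hp hpη =>
        (hp hpη).1) hδ

theorem tendsto_setIntegral_tail_alpha {η : ℝ} (hη : 0 < η) : Tendsto
    (fun n => ∫ p in tail η, |α n p - linearMinAlpha (A p) (B p)|) atTop (𝓝 0) :=
  tendsto_integral_abs_sub_of_tight (fun n => (h.isState n).integrable_alpha.integrableOn)
    h.isState_lim.integrable_alpha.integrableOn
    (ae_restrict_of_ae (h.ae_tendsto.mono fun _ hp => hp.2)) fun _ hδ =>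
    exists_tight_set_of_tail_le (fun n => (h.isState n).integrable_alpha)
      (fun n => (h.hasBounds n).tail_alpha_le)
      (fun _ => (h.exists_bound hη).imp fun _ hD => hD.mono fun _ hn => hn.mono fun _ hp hpη =>
        (hp hpη).2) hδ

end IsConvSeq

/-! ### Condensation of the lost mass -/

section Cutoff

theorem integral_abs_indicator_sub {X : Type*} [MeasurableSpace X] {ν : Measure X} {s : Set X}
    (hs : MeasurableSet s) (f g : X → ℝ) :
    ∫ x, |s.indicator f x - s.indicator g x| ∂ν = ∫ x in s, |f x - g x| ∂ν := by
  rw [← integral_indicator hs]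
  congr 1 with x
  by_cases hx : x ∈ s <;> simp [hx]

theorem integral_abs_indicator_le {X : Type*} [MeasurableSpace X] {ν : Measure X} {f : X → ℝ}
    (hf : Integrable f ν) {s : Set X} (hs : MeasurableSet s) :
    ∫ x, |s.indicator f x| ∂ν ≤ ∫ x, |f x| ∂ν :=
  integral_mono (hf.indicator hs).abs hf.abs fun x => by by_cases hx : x ∈ s <;> simp [hx]

theorem eventually_mem_tail {η : ℕ → ℝ} (hη : Tendsto η atTop (𝓝 0)) {p : Space} (hp : p ≠ 0) :
    ∀ᶠ k in atTop, p ∈ tail (η k) :=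
  (hη.eventually (gt_mem_nhds (norm_pos_iff.2 hp))).mono fun _ hk => hk.le

theorem tendsto_integral_abs_indicator_tail_sub {f : Space → ℝ} (hf : Integrable f) {η : ℕ → ℝ}
    (hη : Tendsto η atTop (𝓝 0)) :
    Tendsto (fun k => ∫ p, |(tail (η k)).indicator f p - f p|) atTop (𝓝 0) := by
  rw [← integral_zero Space ℝ]
  refine tendsto_integral_of_dominated_convergence (fun p => |f p|)
    (fun k => ((hf.indicator (measurableSet_tail (η k))).sub hf).abs.1) hf.abs
    (fun k => ae_of_all _ fun p => by by_cases hp : p ∈ tail (η k) <;> simp [hp]) ?_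
  filter_upwards [Measure.ae_ne volume 0] with p hp
  exact tendsto_const_nhds.congr' ((eventually_mem_tail hη hp).mono fun k hk => by simp [hk])

variable {γ α : Space → ℝ} (h : IsState γ α)
include h

theorem IsState.neg : IsState γ (fun p => -α p) :=
  ⟨h.integrable_gamma, h.integrable_alpha.neg, h.integrable_kinetic,
    h.feasible.mono fun _ hp => hp.neg⟩

theorem IsState.indicator {S : Set Space} (hS : MeasurableSet S) :
    IsState (S.indicator γ) (S.indicator α) where
  integrable_gamma := h.integrable_gamma.indicator hS
  integrable_alpha := h.integrable_alpha.indicator hS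
  integrable_kinetic := (h.integrable_kinetic.indicator hS).congr (ae_of_all _ fun p => by
    by_cases hp : p ∈ S <;> simp [hp])
  feasible := h.feasible.mono fun p hp => by
    by_cases hpS : p ∈ S
    · simpa only [Set.indicator_of_mem hpS] using hp
    · simpa only [Set.indicator_of_notMem hpS] using feasible_zero

theorem IsState.abs_mass_indicator_alpha_le {S : Set Space} (hS : MeasurableSet S)
    (hfin : volume S ≠ ⊤) :
    |mass (S.indicator α)| ≤ mass (S.indicator γ) + c₃ * (volume.real S / 2) := by
  have hind := h.indicator hS
  have hle := hind.setIntegral_abs_alpha_le hfin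
  rw [setIntegral_eq_integral_of_forall_compl_eq_zero fun p hp => by simp [hp],
    hind.integral_abs_gamma] at hle
  refine (abs_mass_le _).trans ((mul_le_mul_of_nonneg_left hle c₃_pos.le).trans_eq ?_)
  rw [mass]
  ring

end Cutoff

/-- The smaller of the energies of `(γ, α, t)` and `(γ, -α, t)`, for `t ≥ 0`. -/
def energyMin (v : Space → ℝ) (μ : ℝ) (γ α : Space → ℝ) (t : ℝ) : ℝ :=
  kinetic γ - μ * (t + mass γ) + v 0 / 2 * (t + mass γ) ^ 2
    + 1 / 2 * (interaction v α α + interaction v γ γ) + t * (coupling v γ - |coupling v α|)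

theorem IsState.exists_energy_eq_energyMin {γ α : Space → ℝ} (h : IsState γ α)
    (v : Space → ℝ) (μ t : ℝ) : ∃ β, IsState γ β ∧ energy v μ γ β t = energyMin v μ γ α t := by
  rcases abs_choice (coupling v α) with hα | hα
  · have hcoupling : coupling v (fun p => -α p) = -coupling v α := by
      simp only [coupling, mul_neg, integral_neg]
    have hinteraction : interaction v (fun p => -α p) (fun p => -α p) = interaction v α α := by
      simp only [interaction, neg_mul_neg]
    refine ⟨_, h.neg, ?_⟩
    rw [energy, energyMin, hcoupling, hinteraction, hα]
    ring
  · refine ⟨α, h, ?_⟩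
    rw [energy, energyMin, hα, sub_neg_eq_add]

section Condensation

/-- Bound for the change of energy when all particles of momentum less than `η` are moved to the
condensate; `C` bounds `∫ |γ|` and `∫ |α|`. -/
def condensationError (M C t η : ℝ) : ℝ :=
  2 * (c₃ ^ 2 * M * C ^ 2) * η
    + (t + c₃ * C) * (c₃ * M * (volume.real (Metric.ball (0 : Space) η) / 2))

theorem tendsto_condensationError (M C t : ℝ) {η : ℕ → ℝ} (hpos : ∀ k, 0 < η k)
    (hη : Tendsto η atTop (𝓝 0)) :
    Tendsto (fun k => condensationError M C t (η k)) atTop (𝓝 0) := by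
  have hball : ∀ k, volume.real (Metric.ball (0 : Space) (η k))
      = η k ^ 3 * volume.real (Metric.ball (0 : Space) 1) := fun k => by
    rw [measureReal_def, Measure.addHaar_ball _ _ (hpos k).le, ENNReal.toReal_mul,
      ENNReal.toReal_ofReal (pow_nonneg (hpos k).le _), finrank_euclideanSpace_fin, measureReal_def]
  simp only [condensationError, hball]
  simpa using (hη.const_mul (2 * (c₃ ^ 2 * M * C ^ 2))).add (((((hη.pow 3).mul_const
    (volume.real (Metric.ball (0 : Space) 1))).div_const 2).const_mul (c₃ * M)).const_mul
      (t + c₃ * C))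

variable {v : Space → ℝ} {M : ℝ} (hv : IsKernel v M)
include hv

theorem IsKernel.neg_volume_le_coupling_indicator_add {γ α : Space → ℝ} (h : IsState γ α)
    {S : Set Space} (hS : MeasurableSet S) (hfin : volume S ≠ ⊤) :
    -(c₃ * M * (volume.real S / 2)) ≤ coupling v (S.indicator γ) + coupling v (S.indicator α) := by
  have hind := h.indicator hS
  have hγ := hv.integrable_mul hind.integrable_gamma
  have hα := hv.integrable_mul hind.integrable_alpha
  have hpoint : ∀ᵐ p, S.indicator (fun _ => -(M / 2)) p
      ≤ v p * S.indicator γ p + v p * S.indicator α p := by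
    filter_upwards [h.feasible] with p hp
    by_cases hpS : p ∈ S
    · simp only [Set.indicator_of_mem hpS]
      linarith [hv.le p, mul_nonneg (hv.nonneg p)
        (by linarith [(_root_.abs_le.1 hp.abs_le).1] : 0 ≤ γ p + α p + 1 / 2)]
    · simp [hpS]
  calc -(c₃ * M * (volume.real S / 2)) = c₃ * ∫ p, S.indicator (fun _ => -(M / 2)) p := by
        rw [integral_indicator hS, setIntegral_const, smul_eq_mul]
        ring
    _ ≤ c₃ * ∫ p, (v p * S.indicator γ p + v p * S.indicator α p) :=
        mul_le_mul_of_nonneg_left (integral_mono_ae ((integrable_indicator_iff hS).2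
          (integrableOn_const hfin)) (hγ.add hα) hpoint) c₃_pos.le
    _ = coupling v (S.indicator γ) + coupling v (S.indicator α) := by
        rw [integral_add hγ hα, mul_add, coupling, coupling]

theorem IsKernel.abs_potential_sub_mass_mul_le {g : Space → ℝ} {η : ℝ} (hg : Integrable g)
    (hsupp : ∀ p, η < ‖p‖ → g p = 0) (p : Space) :
    |potential v g p - mass g * v p| ≤ c₃ * M * η * ∫ q, |g q| := by
  have hdiff : potential v g p - mass g * v p = c₃ * ∫ q, (v (p - q) - v p) * g q := by
    simp only [sub_mul]
    rw [integral_sub (hv.integrable_sub_mul hg p) (hg.const_mul _), integral_const_mul, potential,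
      mass]
    ring
  have hpoint : ∀ q, |(v (p - q) - v p) * g q| ≤ M * η * |g q| := fun q => by
    rw [abs_mul]
    by_cases hq : η < ‖q‖
    · simp [hsupp q hq]
    · have hlip := hv.lipschitz (p - q) p
      rw [sub_sub_cancel_left, norm_neg] at hlip
      exact mul_le_mul_of_nonneg_right (hlip.trans
        (mul_le_mul_of_nonneg_left (not_lt.1 hq) hv.bound_pos.le)) (abs_nonneg _)
  have hbound : |∫ q, (v (p - q) - v p) * g q| ≤ M * η * ∫ q, |g q| := by
    rw [← integral_const_mul, ← Real.norm_eq_abs]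
    exact norm_integral_le_of_norm_le (hg.abs.const_mul _) (ae_of_all _ hpoint)
  rw [hdiff, abs_mul, abs_of_pos c₃_pos, mul_assoc, mul_assoc, ← mul_assoc M]
  exact mul_le_mul_of_nonneg_left hbound c₃_pos.le

theorem IsKernel.mass_mul_coupling_sub_interaction_le {f g : Space → ℝ} {η C : ℝ}
    (hf : Integrable f) (hg : Integrable g) (hη : 0 ≤ η) (hsupp : ∀ p, η < ‖p‖ → g p = 0)
    (hfC : ∫ p, |f p| ≤ C) (hgC : ∫ p, |g p| ≤ C) :
    mass g * coupling v f - interaction v f g ≤ c₃ ^ 2 * M * C ^ 2 * η := by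
  have hpot : Integrable fun p => potential v g p * f p := hv.integrable_potential_mul hg hf
  have hprod : (fun p => (mass g * v p - potential v g p) * f p)
      = fun p => mass g * (v p * f p) - potential v g p * f p := by
    ext p
    ring
  have hdiff : mass g * coupling v f - interaction v f g
      = c₃ * ∫ p, (mass g * v p - potential v g p) * f p := by
    rw [hv.interaction_eq hf hg, coupling, hprod,
      integral_sub ((hv.integrable_mul hf).const_mul _) hpot, integral_const_mul]
    simp only [mul_comm (f _)]
    ring
  have := c₃_pos
  have := hv.bound_pos
  have hC : 0 ≤ C := (integral_nonneg fun _ => abs_nonneg _).trans hfC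
  rw [hdiff]
  calc c₃ * ∫ p, (mass g * v p - potential v g p) * f p
      ≤ c₃ * (c₃ * M * η * (∫ q, |g q|) * ∫ p, |f p|) :=
        mul_le_mul_of_nonneg_left ((le_abs_self _).trans (abs_integral_mul_le hf fun p => by
          rw [abs_sub_comm]
          exact hv.abs_potential_sub_mass_mul_le hg hsupp p)) c₃_pos.le
    _ ≤ c₃ * (c₃ * M * η * C * C) := by gcongr
    _ = c₃ ^ 2 * M * C ^ 2 * η := by ring

theorem IsKernel.energyMin_le_energy_add {γ₁ α₁ γ₂ α₂ : Space → ℝ} (h₁ : IsState γ₁ α₁)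
    (h₂ : IsState γ₂ α₂) (μ : ℝ) {t : ℝ} (ht : 0 ≤ t) :
    energyMin v μ γ₁ α₁ (t + mass γ₂) ≤ energy v μ (γ₁ + γ₂) (α₁ + α₂) t
      + (mass γ₂ * coupling v γ₁ - interaction v γ₁ γ₂)
      + (mass α₂ * coupling v α₁ - interaction v α₁ α₂)
      + (|mass α₂| - mass γ₂) * |coupling v α₁| - t * (coupling v γ₂ + coupling v α₂) := by
  have hγ : γ₁ + γ₂ = fun p => γ₁ p + 1 * γ₂ p := by ext p; simp
  have hα : α₁ + α₂ = fun p => α₁ p + 1 * α₂ p := by ext p; simp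
  have hsign : -((t + |mass α₂|) * |coupling v α₁|) ≤ (t + mass α₂) * coupling v α₁ := by
    refine (neg_le_neg ?_).trans (neg_abs_le _)
    rw [abs_mul]
    refine mul_le_mul_of_nonneg_right ((abs_add_le _ _).trans_eq ?_) (abs_nonneg _)
    rw [abs_of_nonneg ht]
  rw [energyMin, energy, hγ, hα, mass_add_const_mul h₁.integrable_gamma h₂.integrable_gamma,
    kinetic_add_const_mul h₁.integrable_kinetic h₂.integrable_kinetic,
    hv.interaction_self_add_const_mul h₁.integrable_gamma h₂.integrable_gamma,
    hv.interaction_self_add_const_mul h₁.integrable_alpha h₂.integrable_alpha,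
    hv.coupling_add_const_mul h₁.integrable_gamma h₂.integrable_gamma,
    hv.coupling_add_const_mul h₁.integrable_alpha h₂.integrable_alpha,
    one_mul, add_assoc t, add_comm (mass γ₂)]
  linarith [kinetic_nonneg h₂.nonneg, hv.interaction_self_nonneg h₂.integrable_gamma,
    hv.interaction_self_nonneg h₂.integrable_alpha]

theorem IsKernel.energyMin_tail_le {γ α : Space → ℝ} (h : IsState γ α) (μ : ℝ) {t η C : ℝ}
    (ht : 0 ≤ t) (hη : 0 ≤ η) (hγC : ∫ p, |γ p| ≤ C) (hαC : ∫ p, |α p| ≤ C) :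
    energyMin v μ ((tail η).indicator γ) ((tail η).indicator α)
        (t + (mass γ - mass ((tail η).indicator γ)))
      ≤ energy v μ γ α t + condensationError M C t η := by
  set T := tail η
  have hT : MeasurableSet T := measurableSet_tail η
  have hball : Tᶜ = Metric.ball (0 : Space) η := compl_tail η
  have hfin : volume Tᶜ ≠ ⊤ := by rw [hball]; exact measure_ball_lt_top.ne
  have h₁ := h.indicator hT
  have h₂ := h.indicator hT.compl
  have hsupp : ∀ (f : Space → ℝ) p, η < ‖p‖ → Tᶜ.indicator f p = 0 := fun f p hp =>
    Set.indicator_of_notMem (not_not.2 hp.le) f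
  have hmass : mass γ = mass (T.indicator γ) + mass (Tᶜ.indicator γ) := by
    rw [mass, mass, mass, ← mul_add, ← integral_add h₁.integrable_gamma h₂.integrable_gamma]
    simp only [Set.indicator_self_add_compl_apply]
  have hbound := hv.energyMin_le_energy_add h₁ h₂ μ ht
  rw [Set.indicator_self_add_compl, Set.indicator_self_add_compl] at hbound
  have hγγ := hv.mass_mul_coupling_sub_interaction_le h₁.integrable_gamma h₂.integrable_gamma hη
    (hsupp γ) ((integral_abs_indicator_le h.integrable_gamma hT).trans hγC)
    ((integral_abs_indicator_le h.integrable_gamma hT.compl).trans hγC)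
  have hα₁ := (integral_abs_indicator_le h.integrable_alpha hT).trans hαC
  have hαα := hv.mass_mul_coupling_sub_interaction_le h₁.integrable_alpha h₂.integrable_alpha hη
    (hsupp α) hα₁ ((integral_abs_indicator_le h.integrable_alpha hT.compl).trans hαC)
  have hmassα := h.abs_mass_indicator_alpha_le hT.compl hfin
  have hcoupling := hv.neg_volume_le_coupling_indicator_add h hT.compl hfin
  have hsign : (|mass (Tᶜ.indicator α)| - mass (Tᶜ.indicator γ)) * |coupling v (T.indicator α)|
      ≤ c₃ * (volume.real Tᶜ / 2) * (c₃ * M * C) :=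
    mul_le_mul (sub_le_iff_le_add'.2 hmassα) ((hv.abs_coupling_le h₁.integrable_alpha).trans
      (mul_le_mul_of_nonneg_left hα₁ (mul_pos c₃_pos hv.bound_pos).le)) (abs_nonneg _)
      (mul_nonneg c₃_pos.le (by positivity))
  have hcond := mul_le_mul_of_nonneg_left hcoupling ht
  rw [hmass, add_sub_cancel_left, condensationError, ← hball]
  linarith

theorem IsKernel.energyMin_le_of_tendsto {f g : ℕ → Space → ℝ} {γ α : Space → ℝ} {s l : ℕ → ℝ}
    {t L μ : ℝ} (hst : ∀ n, IsState (f n) (g n)) (hlim : IsState γ α)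
    (hae : ∀ᵐ p, Tendsto (fun n => f n p) atTop (𝓝 (γ p)))
    (hf : Tendsto (fun n => ∫ p, |f n p - γ p|) atTop (𝓝 0))
    (hg : Tendsto (fun n => ∫ p, |g n p - α p|) atTop (𝓝 0))
    (hs : Tendsto s atTop (𝓝 t)) (hl : Tendsto l atTop (𝓝 L))
    (hle : ∀ n, energyMin v μ (f n) (g n) (s n) ≤ l n) : energyMin v μ γ α t ≤ L := by
  have hγ := fun n => (hst n).integrable_gamma
  have hα := fun n => (hst n).integrable_alpha
  have hdensity := hs.add (tendsto_mass hγ hlim.integrable_gamma hf)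
  let rest : (Space → ℝ) → (Space → ℝ) → ℝ → ℝ := fun γ α t =>
    -(μ * (t + mass γ)) + v 0 / 2 * (t + mass γ) ^ 2
      + 1 / 2 * (interaction v α α + interaction v γ γ) + t * (coupling v γ - |coupling v α|)
  have hsplit : ∀ γ α t, energyMin v μ γ α t = (∫ p : Space, ‖p‖ ^ 2 * γ p) * c₃ + rest γ α t :=
    fun γ α t => by
      simp only [energyMin, kinetic, rest]
      ring
  have hrest : Tendsto (fun n => rest (f n) (g n) (s n)) atTop (𝓝 (rest γ α t)) :=
    (((hdensity.const_mul μ).neg.add ((hdensity.pow 2).const_mul (v 0 / 2))).add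
      (((hv.tendsto_interaction hα hlim.integrable_alpha hg).add
        (hv.tendsto_interaction hγ hlim.integrable_gamma hf)).const_mul (1 / 2))).add
      (hs.mul ((hv.tendsto_coupling hγ hlim.integrable_gamma hf).sub
        (hv.tendsto_coupling hα hlim.integrable_alpha hg).abs))
  have hkinetic : ∀ n, ∫ p : Space, ‖p‖ ^ 2 * f n p ≤ (l n - rest (f n) (g n) (s n)) / c₃ :=
    fun n => (le_div_iff₀ c₃_pos).2 (le_sub_iff_add_le.2 ((hsplit _ _ _).symm.trans_le (hle n)))
  have hfatou := (integrable_and_integral_le_of_tendsto (fun n => (hst n).integrable_kinetic)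
    (fun n => (hst n).nonneg.mono fun p hp => mul_nonneg (sq_nonneg ‖p‖) hp)
    (hae.mono fun p hp => hp.const_mul (‖p‖ ^ 2)) hkinetic ((hl.sub hrest).div_const c₃)).2
  rw [hsplit]
  exact le_sub_iff_add_le.1 ((le_div_iff₀ c₃_pos).1 hfatou)

end Condensation

namespace IsConvSeq

variable {v : Space → ℝ} {M μ t : ℝ} {R ε : ℕ → ℝ} {γ α : ℕ → Space → ℝ} {N C r₀ : ℝ}
  {A B : Space → ℝ} (h : IsConvSeq v M μ t R ε γ α N C r₀ A B)
include h

theorem mass_lim_le : mass (fun p => linearMinGamma (A p) (B p)) ≤ N := by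
  rw [mass, mul_comm, ← le_div_iff₀ c₃_pos]
  exact (integrable_and_integral_le_of_tendsto (fun n => (h.isState n).integrable_gamma)
    (fun n => (h.isState n).nonneg) (h.ae_tendsto.mono fun p hp => hp.1)
    (fun n => by rw [le_div_iff₀ c₃_pos, mul_comm, mass]) (h.tendsto_mass.div_const c₃)).2

theorem energyMin_tail_lim_le {η : ℝ} (hη : 0 < η) :
    energyMin v μ ((tail η).indicator fun p => linearMinGamma (A p) (B p))
      ((tail η).indicator fun p => linearMinAlpha (A p) (B p))
      (t + (N - mass ((tail η).indicator fun p => linearMinGamma (A p) (B p))))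
      ≤ groundEnergy v μ + condensationError M C t η := by
  have hT := measurableSet_tail η
  have hst := fun n => (h.isState n).indicator hT
  have hγ := h.tendsto_setIntegral_tail_gamma hη
  have hα := h.tendsto_setIntegral_tail_alpha hη
  simp only [← integral_abs_indicator_sub hT] at hγ hα
  refine h.isKernel.energyMin_le_of_tendsto hst (h.isState_lim.indicator hT) ?_ hγ hα
    ((h.tendsto_mass.sub (Bogoliubov.tendsto_mass (fun n => (hst n).integrable_gamma)
      (h.isState_lim.indicator hT).integrable_gamma hγ)).const_add t)
    (h.tendsto_energy.add_const _) fun n => h.isKernel.energyMin_tail_le (h.isState n) μ h.pos.le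
      hη.le (h.hasBounds n).integral_abs_gamma_le (h.hasBounds n).integral_abs_alpha_le
  filter_upwards [h.ae_tendsto] with p hp
  by_cases hpT : p ∈ tail η
  · simpa only [Set.indicator_of_mem hpT] using hp.1
  · simp only [Set.indicator_of_notMem hpT, tendsto_const_nhds]

theorem energyMin_lim_le :
    energyMin v μ (fun p => linearMinGamma (A p) (B p)) (fun p => linearMinAlpha (A p) (B p))
      (t + (N - mass fun p => linearMinGamma (A p) (B p))) ≤ groundEnergy v μ := by
  have hη : Tendsto (fun k : ℕ => 1 / ((k : ℝ) + 1)) atTop (𝓝 0) :=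
    tendsto_one_div_add_atTop_nhds_zero_nat
  have hpos : ∀ k : ℕ, 0 < 1 / ((k : ℝ) + 1) := fun _ => Nat.one_div_pos_of_nat
  have hlim := h.isState_lim
  have hind := fun k : ℕ => hlim.indicator (measurableSet_tail (1 / ((k : ℝ) + 1)))
  have hγ := tendsto_integral_abs_indicator_tail_sub hlim.integrable_gamma hη
  refine h.isKernel.energyMin_le_of_tendsto hind hlim ?_ hγ
    (tendsto_integral_abs_indicator_tail_sub hlim.integrable_alpha hη)
    (((Bogoliubov.tendsto_mass (fun k => (hind k).integrable_gamma) hlim.integrable_gamma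
      hγ).const_sub N).const_add t)
    (by simpa using (tendsto_condensationError M C t hpos hη).const_add (groundEnergy v μ))
    fun k => h.energyMin_tail_lim_le (hpos k)
  filter_upwards [Measure.ae_ne volume 0] with p hp
  exact tendsto_const_nhds.congr' ((eventually_mem_tail hη hp).mono fun k hk =>
    (Set.indicator_of_mem hk _).symm)

/- The mass `N - mass γ` lost in the pointwise limit can only concentrate at `p = 0`, and is added
to the condensate. -/
theorem exists_energy_le_groundEnergy :
    ∃ γ α s, IsState γ α ∧ 0 ≤ s ∧ energy v μ γ α s ≤ groundEnergy v μ := by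
  obtain ⟨β, hβ, heq⟩ := h.isState_lim.exists_energy_eq_energyMin v μ
    (t + (N - mass fun p => linearMinGamma (A p) (B p)))
  exact ⟨_, β, _, hβ, add_nonneg h.pos.le (sub_nonneg.2 h.mass_lim_le),
    heq.trans_le h.energyMin_lim_le⟩

end IsConvSeq

theorem IsApproxSeq.exists_energy_zero_le_groundEnergy {v : Space → ℝ} {M μ : ℝ} {R ε : ℕ → ℝ}
    {γ α : ℕ → Space → ℝ} (h : IsApproxSeq v μ 0 R ε γ α) (hv : IsKernel v M) :
    ∃ ρ, 0 ≤ ρ ∧ energy v μ (fun _ => 0) (fun _ => 0) ρ ≤ groundEnergy v μ := by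
  obtain ⟨C, r₀, hb⟩ := h.exists_hasBounds hv le_rfl
  obtain ⟨ρ, hρ, φ, hφ, hlim⟩ := (isCompact_Icc (a := 0) (b := C)).tendsto_subseq
    (x := fun n => mass (γ n)) fun n =>
      ⟨mass_nonneg (h.isState n).nonneg, by linarith [(hb n).add_mass_le]⟩
  refine ⟨ρ, hρ.1, ?_⟩
  rw [energy_zero]
  refine le_of_tendsto_of_tendsto' ((hlim.const_mul (-μ)).add ((hlim.pow 2).const_mul (v 0 / 2)))
    (h.tendsto_energy.comp hφ.tendsto_atTop) fun n => ?_
  have hst := h.isState (φ n)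
  simp only [Function.comp_apply, energy]
  linarith [hv.interaction_self_nonneg hst.integrable_gamma,
    hv.interaction_self_nonneg hst.integrable_alpha, kinetic_nonneg hst.nonneg]

theorem IsKernel.exists_energy_le_groundEnergy {v : Space → ℝ} {M : ℝ} (hv : IsKernel v M)
    (μ : ℝ) : ∃ γ α s, IsState γ α ∧ 0 ≤ s ∧ energy v μ γ α s ≤ groundEnergy v μ := by
  obtain ⟨t, ht, R, ε, γ, α, h⟩ := hv.exists_isApproxSeq μ
  rcases ht.eq_or_lt with rfl | ht
  · obtain ⟨ρ, hρ, hle⟩ := h.exists_energy_zero_le_groundEnergy hv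
    exact ⟨_, _, ρ, (isTestState_zero 0).isState, hρ, hle⟩
  · obtain ⟨_, _, _, _, _, _, _, _, _, hconv⟩ := h.exists_isConvSeq hv ht
    exact hconv.exists_energy_le_groundEnergy

/-! ### Truncation -/

theorem Feasible.abs_mul_add_mul_le {g a g' a' : ℝ} (h : Feasible g a) (h' : Feasible g' a') :
    |a * a' + g * g'| ≤ 2 * (g * g') + g + g' := by
  have hα := h.two_mul_abs_mul_le h'
  have hγ := mul_nonneg h.1 h'.1
  have hadd := abs_add_le (a * a') (g * g')
  rw [abs_of_nonneg hγ] at hadd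
  linarith [h.1, h'.1]

theorem integrable_one_add_sq_mul_iff {γ : Space → ℝ} :
    (Integrable fun p : Space => (1 + ‖p‖ ^ 2) * γ p) ↔
      Integrable γ ∧ Integrable fun p : Space => ‖p‖ ^ 2 * γ p := by
  refine ⟨fun h => ?_, fun h => by simp only [add_mul, one_mul]; exact h.1.add h.2⟩
  have hγ : Integrable fun p : Space => (1 + ‖p‖ ^ 2)⁻¹ * ((1 + ‖p‖ ^ 2) * γ p) := by
    refine h.bdd_mul (c := 1) ?_ (ae_of_all _ fun p => ?_)
    · exact (Continuous.inv₀ (by fun_prop) fun p => by positivity).aestronglyMeasurable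
    · rw [norm_inv, Real.norm_eq_abs, abs_of_pos (by positivity)]
      exact inv_le_one_of_one_le₀ (le_add_of_nonneg_right (sq_nonneg _))
  simp only [inv_mul_cancel_left₀ (by positivity : (1 + ‖(_ : Space)‖ ^ 2 : ℝ) ≠ 0)] at hγ
  exact ⟨hγ, (h.sub hγ).congr (ae_of_all _ fun p => by simp only [Pi.sub_apply]; ring)⟩

theorem IsState.mem_domain {γ α : Space → ℝ} {s : ℝ} (h : IsState γ α) (hs : 0 ≤ s) :
    (γ, α, s) ∈ domain :=
  ⟨integrable_one_add_sq_mul_iff.2 ⟨h.integrable_gamma, h.integrable_kinetic⟩,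
    h.integrable_alpha.1, h.nonneg, h.feasible.mono fun _ hp => hp.2, hs⟩

theorem memLp_two_indicator {f : Space → ℝ} (hf : AEStronglyMeasurable f) {S : Set Space}
    (hS : MeasurableSet S) (hfin : volume S ≠ ⊤) {C : ℝ} (hC : ∀ᵐ p, p ∈ S → |f p| ≤ C) :
    MemLp (S.indicator f) 2 := by
  have : IsFiniteMeasure (volume.restrict S) := isFiniteMeasure_restrict.2 hfin
  exact (memLp_indicator_iff_restrict hS).2
    (MemLp.of_bound hf.restrict C ((ae_restrict_iff' hS).2 hC))

theorem exists_aecover_isTestState_indicator {γ α : Space → ℝ} (hγ : AEStronglyMeasurable γ)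
    (hα : AEStronglyMeasurable α) (h : ∀ᵐ p, Feasible (γ p) (α p)) :
    ∃ S : ℕ → Set Space, AECover volume atTop S ∧
      ∀ k : ℕ, IsTestState k ((S k).indicator γ) ((S k).indicator α) := by
  let S : ℕ → Set Space := fun k => Metric.closedBall 0 k ∩ {p | hγ.mk γ p ≤ k}
  have hS : AECover volume atTop S :=
    { ae_eventually_mem := ae_of_all _ fun p => by
        filter_upwards [tendsto_natCast_atTop_atTop.eventually_ge_atTop ‖p‖,
          tendsto_natCast_atTop_atTop.eventually_ge_atTop (hγ.mk γ p)] with k hp hγp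
        exact ⟨mem_closedBall_zero_iff.2 hp, hγp⟩
      measurableSet := fun k => measurableSet_closedBall.inter
        (measurableSet_le hγ.stronglyMeasurable_mk.measurable measurable_const) }
  have hfin : ∀ k, volume (S k) ≠ ⊤ := fun k =>
    ((measure_mono Set.inter_subset_left).trans_lt measure_closedBall_lt_top).ne
  have hle : ∀ k : ℕ, ∀ᵐ p, p ∈ S k → γ p ≤ k := fun k => by
    filter_upwards [hγ.ae_eq_mk] with p hp hpS
    exact hp.trans_le hpS.2
  refine ⟨S, hS, fun k => ⟨?_, ?_, ae_of_all _ fun p hp => ?_, ?_⟩⟩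
  · refine memLp_two_indicator hγ (hS.measurableSet k) (hfin k) (C := k) ?_
    filter_upwards [hle k, h] with p hp hfeas hpS
    exact (abs_of_nonneg hfeas.1).trans_le (hp hpS)
  · refine memLp_two_indicator hα (hS.measurableSet k) (hfin k) (C := k + 1 / 2) ?_
    filter_upwards [hle k, h] with p hp hfeas hpS
    exact hfeas.abs_le.trans (by linarith [hp hpS])
  · have hpS : p ∉ S k := fun hpS => (mem_closedBall_zero_iff.1 hpS.1).not_gt hp
    exact ⟨Set.indicator_of_notMem hpS _, Set.indicator_of_notMem hpS _⟩
  · filter_upwards [h] with p hp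
    by_cases hpS : p ∈ S k
    · simpa only [Set.indicator_of_mem hpS] using hp
    · simpa only [Set.indicator_of_notMem hpS] using feasible_zero

theorem freeEnergy_indicator (V : Space → ℝ) (μ : ℝ) {S : Set Space} (hS : MeasurableSet S)
    (γ α : Space → ℝ) (s : ℝ) :
    freeEnergy V 0 μ (S.indicator γ, S.indicator α, s) =
      c₃ * (∫ p in S, ‖p‖ ^ 2 * γ p) - μ * (s + c₃ * ∫ p in S, γ p)
        + Vhat V 0 / 2 * (s + c₃ * ∫ p in S, γ p) ^ 2
        + 1 / 2 * c₃ ^ 2 * (∫ z in S ×ˢ S, Vhat V (z.1 - z.2) * (α z.1 * α z.2 + γ z.1 * γ z.2))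
        + s * (c₃ * ∫ p in S, Vhat V p * (γ p + α p)) := by
  have hprod : ∀ z : Space × Space, Vhat V (z.1 - z.2) * (S.indicator α z.1 * S.indicator α z.2
      + S.indicator γ z.1 * S.indicator γ z.2) = (S ×ˢ S).indicator
        (fun z => Vhat V (z.1 - z.2) * (α z.1 * α z.2 + γ z.1 * γ z.2)) z := fun z => by
    by_cases h₁ : z.1 ∈ S <;> by_cases h₂ : z.2 ∈ S <;> simp [Set.indicator, h₁, h₂]
  simp only [freeEnergy, density, hprod, zero_mul, sub_zero, integral_indicator (hS.prod hS)]
  simp only [← integral_indicator hS, Set.indicator_mul_right, Set.indicator_add]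

section Truncation

variable {v : Space → ℝ} {M : ℝ} (hv : IsKernel v M) {γ α : Space → ℝ} (hγ : Integrable γ)
  (hα : AEStronglyMeasurable α) (h : ∀ᵐ p, Feasible (γ p) (α p))
include hv hγ hα h

theorem IsKernel.integrable_mul_add : Integrable fun p => v p * (γ p + α p) := by
  refine (((hv.integrable_mul hγ).const_mul 2).add (hv.integrable.const_mul (1 / 2))).mono'
    (hv.continuous.aestronglyMeasurable.mul (hγ.1.add hα)) ?_
  filter_upwards [h] with p hp
  have hsum : |γ p + α p| ≤ 2 * γ p + 1 / 2 := by
    linarith [abs_add_le (γ p) (α p), hp.abs_le, abs_of_nonneg hp.1]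
  rw [Real.norm_eq_abs, abs_mul, abs_of_nonneg (hv.nonneg p)]
  exact (mul_le_mul_of_nonneg_left hsum (hv.nonneg p)).trans_eq
    (by simp only [Pi.add_apply]; ring)

theorem IsKernel.integrable_sub_mul_mul_add_mul :
    Integrable fun z : Space × Space => v (z.1 - z.2) * (α z.1 * α z.2 + γ z.1 * γ z.2) := by
  have hsnd := hv.integrable_sub_mul_prod hγ
  have hfst : Integrable (fun z : Space × Space => v (z.1 - z.2) * γ z.1) (volume.prod volume) :=
    hsnd.swap.congr (ae_of_all _ fun z => by
      simp only [Function.comp_apply, Prod.fst_swap, Prod.snd_swap]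
      rw [hv.sub_comm])
  refine ((((hv.integrable_interaction hγ hγ).const_mul 2).add hfst).add hsnd).mono'
    ((hv.continuous.comp (by fun_prop)).aestronglyMeasurable.mul
      ((hα.comp_fst.mul hα.comp_snd).add (hγ.1.comp_fst.mul hγ.1.comp_snd))) ?_
  filter_upwards [Measure.quasiMeasurePreserving_fst.ae h,
    Measure.quasiMeasurePreserving_snd.ae h] with z h₁ h₂
  rw [Real.norm_eq_abs, abs_mul, abs_of_nonneg (hv.nonneg _)]
  exact (mul_le_mul_of_nonneg_left (h₁.abs_mul_add_mul_le h₂) (hv.nonneg _)).trans_eq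
    (by simp only [Pi.add_apply]; ring)

end Truncation

theorem exists_isTestState_tendsto_freeEnergy {V : Space → ℝ} {M : ℝ}
    (hv : IsKernel (Vhat V) M) (μ : ℝ) {γ α : Space → ℝ} {s : ℝ} (hx : (γ, α, s) ∈ domain) :
    ∃ g a : ℕ → Space → ℝ, (∀ k : ℕ, IsTestState k (g k) (a k)) ∧
      Tendsto (fun k => freeEnergy V 0 μ (g k, a k, s)) atTop
        (𝓝 (freeEnergy V 0 μ (γ, α, s))) := by
  obtain ⟨hint, hα, hnonneg, hαγ, -⟩ := hx
  obtain ⟨hγ, hkin⟩ := integrable_one_add_sq_mul_iff.1 hint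
  have hfeas : ∀ᵐ p, Feasible (γ p) (α p) := hnonneg.and hαγ
  obtain ⟨S, hS, htest⟩ := exists_aecover_isTestState_indicator hγ.1 hα hfeas
  have hSS : AECover (volume.prod volume) atTop fun k => S k ×ˢ S k :=
    { ae_eventually_mem := by
        filter_upwards [Measure.quasiMeasurePreserving_fst.ae hS.ae_eventually_mem,
          Measure.quasiMeasurePreserving_snd.ae hS.ae_eventually_mem] with z h₁ h₂
        exact h₁.and h₂
      measurableSet := fun k => (hS.measurableSet k).prod (hS.measurableSet k) }
  refine ⟨_, _, htest, ?_⟩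
  have hmass := ((hS.integral_tendsto_of_countably_generated hγ).const_mul c₃).const_add s
  have hlim := (((((hS.integral_tendsto_of_countably_generated hkin).const_mul c₃).sub
    (hmass.const_mul μ)).add ((hmass.pow 2).const_mul (Vhat V 0 / 2))).add
    ((hSS.integral_tendsto_of_countably_generated
      (hv.integrable_sub_mul_mul_add_mul hγ hα hfeas)).const_mul (1 / 2 * c₃ ^ 2))).add
    (((hS.integral_tendsto_of_countably_generated
      (hv.integrable_mul_add hγ hα hfeas)).const_mul c₃).const_mul s)
  simp only [freeEnergy_indicator V μ (hS.measurableSet _)]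
  simp only [freeEnergy, density, zero_mul, sub_zero]
  exact hlim

end Bogoliubov

end

open Bogoliubov in
theorem theorem2p2_general {V : Space → ℝ} {M : ℝ} (hv : IsKernel (Vhat V) M) (μ : ℝ) :
    ∃ x ∈ domain, IsMinOn (freeEnergy V 0 μ) domain x := by
  obtain ⟨γ, α, s, h, hs, hle⟩ := hv.exists_energy_le_groundEnergy μ
  refine ⟨(γ, α, s), h.mem_domain hs, ?_⟩
  rintro ⟨γ', α', s'⟩ hx
  obtain ⟨g, a, htest, hlim⟩ := exists_isTestState_tendsto_freeEnergy hv μ hx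
  have hground (k : ℕ) : groundEnergy (Vhat V) μ ≤ freeEnergy V 0 μ (g k, a k, s') := by
    have hk := (htest k).isState
    rw [freeEnergy_eq_energy hv hk.integrable_gamma hk.integrable_alpha]
    exact hv.groundEnergy_le (htest k) μ hx.2.2.2.2
  calc freeEnergy V 0 μ (γ, α, s)
      = energy (Vhat V) μ γ α s :=
        freeEnergy_eq_energy hv h.integrable_gamma h.integrable_alpha μ s
    _ ≤ groundEnergy (Vhat V) μ := hle
    _ ≤ freeEnergy V 0 μ (γ', α', s') := ge_of_tendsto' hlim hground

theorem theorem2p2 (V : Bogoliubov.Space → ℝ) (hV : Bogoliubov.IsInteraction V)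
    (hC3 : ContDiff ℝ 3 (Bogoliubov.Vhat V))
    (hbdd : ∀ k : ℕ, k ≤ 3 →
      ∃ C : ℝ, ∀ p, ‖iteratedFDeriv ℝ k (Bogoliubov.Vhat V) p‖ ≤ C)
    (μ : ℝ) :
    ∃ x ∈ Bogoliubov.domain,
      IsMinOn (Bogoliubov.freeEnergy V 0 μ) Bogoliubov.domain x := by
  obtain ⟨M, hv⟩ := hV.exists_isKernel (hC3.of_le (by norm_num)) (hbdd 2 (by norm_num))
  exact theorem2p2_general hv μ
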